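/- There is a computable function $f:\mathbb N\times\mathbb N\to\mathbb N$, a constant $C$, and an algorithm $\mathbb A$ (a single program for the uniform-cost random access machine with addition and subtraction) with the following property. Let $\varphi$ be a first-order sentence in the language of graphs, built from $\top$, $\bot$, the atoms $x=y$ and $E(x,y)$, the connectives $\neg,\wedge,\vee,\to,\leftrightarrow$ and the quantifiers $\exists x,\forall x$; let $s$ be the number of distinct variable names occurring in $\varphi$ (names may be reused) and let $|\varphi|$ be the number of symbols of $\varphi$, each occurrence of a variable counting as one symbol. Let $G$ be a finite simple graph with $|G|$ vertices, and let $k$ be its tree-depth, that is, the minimum height of a rooted forest $T$ on $V(G)$ such that the endpoints of every edge of $G$ are in ancestor-descendant relation in $T$, where the height of $T$ is the maximum number of vertices on a path from a root to a leaf. Given $\varphi$ (as its string of symbols) and $G$ (by adjacency lists, in any order), and given neither $s$ nor $k$, the algorithm $\mathbb A$ halts after at most $$C\cdot f(s,k)\cdot(|G|+|\varphi|)$$ steps and decides correctly whether $G\models\varphi$. -/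

import Mathlib

/-! ## First-order formulas over graphs, with named variables that may be reused -/

/-- First-order formulas in the language of graphs; the variable names are the natural numbers. -/
inductive FOFormula : Type
  | tru : FOFormula
  | fls : FOFormula
  | eq (x y : ℕ) : FOFormula
  | adj (x y : ℕ) : FOFormula
  | neg (φ : FOFormula) : FOFormula
  | and (φ ψ : FOFormula) : FOFormula
  | or (φ ψ : FOFormula) : FOFormula
  | imp (φ ψ : FOFormula) : FOFormula
  | iff (φ ψ : FOFormula) : FOFormula
  | ex (x : ℕ) (φ : FOFormula) : FOFormula
  | all (x : ℕ) (φ : FOFormula) : FOFormula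

namespace FOFormula

/-- The set of all variable names occurring in a formula (free, bound, or only in a quantifier). -/
def vars : FOFormula → Finset ℕ
  | tru => ∅
  | fls => ∅
  | eq x y => {x, y}
  | adj x y => {x, y}
  | neg φ => φ.vars
  | and φ ψ => φ.vars ∪ ψ.vars
  | or φ ψ => φ.vars ∪ ψ.vars
  | imp φ ψ => φ.vars ∪ ψ.vars
  | iff φ ψ => φ.vars ∪ ψ.vars
  | ex x φ => insert x φ.vars
  | all x φ => insert x φ.vars

/-- The number of variables: the number of distinct variable names. -/
def numVars (φ : FOFormula) : ℕ := φ.vars.card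

/-- The set of free variables. -/
def freeVars : FOFormula → Finset ℕ
  | tru => ∅
  | fls => ∅
  | eq x y => {x, y}
  | adj x y => {x, y}
  | neg φ => φ.freeVars
  | and φ ψ => φ.freeVars ∪ ψ.freeVars
  | or φ ψ => φ.freeVars ∪ ψ.freeVars
  | imp φ ψ => φ.freeVars ∪ ψ.freeVars
  | iff φ ψ => φ.freeVars ∪ ψ.freeVars
  | ex x φ => φ.freeVars.erase x
  | all x φ => φ.freeVars.erase x

/-- A sentence is a formula without free variables. -/
def IsSentence (φ : FOFormula) : Prop := φ.freeVars = ∅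

/-- Satisfaction of a formula in a graph under a partial assignment `a` of vertices to variables.
Assignments are partial so that sentences can be evaluated in the graph without vertices too;
atoms containing an unassigned variable are false. -/
def Sat {V : Type*} (G : SimpleGraph V) : FOFormula → (ℕ → Option V) → Prop
  | tru, _ => True
  | fls, _ => False
  | eq x y, a => ∃ v, a x = some v ∧ a y = some v
  | adj x y, a => ∃ u v, a x = some u ∧ a y = some v ∧ G.Adj u v
  | neg φ, a => ¬ φ.Sat G a
  | and φ ψ, a => φ.Sat G a ∧ ψ.Sat G a
  | or φ ψ, a => φ.Sat G a ∨ ψ.Sat G a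
  | imp φ ψ, a => φ.Sat G a → ψ.Sat G a
  | iff φ ψ, a => (φ.Sat G a ↔ ψ.Sat G a)
  | ex x φ, a => ∃ v : V, φ.Sat G (Function.update a x (some v))
  | all x φ, a => ∀ v : V, φ.Sat G (Function.update a x (some v))

/-- `G ⊨ φ`, for a sentence `φ`: evaluation from the empty assignment. -/
def Models {V : Type*} (G : SimpleGraph V) (φ : FOFormula) : Prop := φ.Sat G fun _ => none

/-- The formula as a string of symbols in prefix (Polish) notation. Each connective, quantifier,
relation symbol and occurrence of a variable is one symbol. -/
def encode : FOFormula → List ℕ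
  | tru => [0]
  | fls => [1]
  | eq x y => [2, x, y]
  | adj x y => [3, x, y]
  | neg φ => 4 :: φ.encode
  | and φ ψ => 5 :: (φ.encode ++ ψ.encode)
  | or φ ψ => 6 :: (φ.encode ++ ψ.encode)
  | imp φ ψ => 7 :: (φ.encode ++ ψ.encode)
  | iff φ ψ => 8 :: (φ.encode ++ ψ.encode)
  | ex x φ => 9 :: x :: φ.encode
  | all x φ => 10 :: x :: φ.encode

/-- The length `|φ|`: the number of symbols. -/
def length (φ : FOFormula) : ℕ := φ.encode.length

end FOFormula

/-! ## Tree-depth -/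

/-- A rooted forest on the vertex set `V`, given by its parent function (roots have no parent). -/
structure RootedForest (V : Type*) where
  parent : V → Option V
  wf : WellFounded fun u v : V => parent v = some u

namespace RootedForest

variable {V : Type*}

/-- `T.Anc u v`: the vertex `u` is an ancestor of `v` (every vertex is an ancestor of itself). -/
def Anc (T : RootedForest V) : V → V → Prop :=
  Relation.ReflTransGen fun u v : V => T.parent v = some u

/-- The number of vertices on the path from the root to `v`. -/
noncomputable def level (T : RootedForest V) (v : V) : ℕ := {u | T.Anc u v}.ncard

/-- The height: the maximum number of vertices on a path from a root to a leaf. -/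
noncomputable def height [Fintype V] (T : RootedForest V) : ℕ := Finset.univ.sup T.level

/-- `T` is an elimination forest of `G`: the endpoints of every edge are in ancestor-descendant
relation. -/
def IsElimination (T : RootedForest V) (G : SimpleGraph V) : Prop :=
  ∀ u v, G.Adj u v → T.Anc u v ∨ T.Anc v u

end RootedForest

/-- The tree-depth of a finite graph: the minimum height of its elimination forests. -/
noncomputable def SimpleGraph.treeDepth {V : Type*} [Fintype V] (G : SimpleGraph V) : ℕ :=
  sInf {h | ∃ T : RootedForest V, T.IsElimination G ∧ T.height = h}

/-! ## Random access machines

The uniform-cost random access machine with addition and subtraction, programmed with structured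
control flow. A machine has registers and a memory, both holding natural numbers. -/

namespace RAM

/-- The registers and the memory of a machine. A program names only finitely many registers,
while the memory is accessed through computed addresses. -/
structure State where
  reg : ℕ → ℕ
  mem : ℕ → ℕ

/-- Expressions: constants, registers, sums, truncated differences, and memory contents. -/
inductive Expr : Type
  | lit (c : ℕ) : Expr
  | reg (x : ℕ) : Expr
  | add (e₁ e₂ : Expr) : Expr
  | sub (e₁ e₂ : Expr) : Expr
  | load (e : Expr) : Expr

/-- The value of an expression; `load e` reads the memory cell whose address is the value of `e`. -/
def Expr.eval (σ : State) : Expr → ℕ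
  | .lit c => c
  | .reg x => σ.reg x
  | .add e₁ e₂ => e₁.eval σ + e₂.eval σ
  | .sub e₁ e₂ => e₁.eval σ - e₂.eval σ
  | .load e => σ.mem (e.eval σ)

/-- The number of steps to evaluate an expression: one for each operation and operand. -/
def Expr.cost : Expr → ℕ
  | .lit _ => 1
  | .reg _ => 1
  | .add e₁ e₂ => 1 + e₁.cost + e₂.cost
  | .sub e₁ e₂ => 1 + e₁.cost + e₂.cost
  | .load e => 1 + e.cost

/-- Programs. -/
inductive Prog : Type
  | skip : Prog
  | assign (x : ℕ) (e : Expr) : Prog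
  | store (e₁ e₂ : Expr) : Prog
  | seq (p q : Prog) : Prog
  | ite (e : Expr) (p q : Prog) : Prog
  | loop (e : Expr) (p : Prog) : Prog

/-- `Exec p σ t τ`: started in the state `σ`, the program `p` halts after `t` steps in the state
`τ`. `assign x e` writes the value of `e` to register `x`; `store e₁ e₂` writes the value of `e₂`
to the memory cell whose address is the value of `e₁`; `ite e p q` runs `p` if the value of `e` is
nonzero, and `q` otherwise; `loop e p` repeats `p` as long as the value of `e` is nonzero. Every
instruction and every test takes one step plus the evaluation of its expressions. -/
inductive Exec : Prog → State → ℕ → State → Prop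
  | skip (σ : State) : Exec .skip σ 1 σ
  | assign (x : ℕ) (e : Expr) (σ : State) :
      Exec (.assign x e) σ (1 + e.cost) ⟨Function.update σ.reg x (e.eval σ), σ.mem⟩
  | store (e₁ e₂ : Expr) (σ : State) :
      Exec (.store e₁ e₂) σ (1 + e₁.cost + e₂.cost)
        ⟨σ.reg, Function.update σ.mem (e₁.eval σ) (e₂.eval σ)⟩
  | seq {p q : Prog} {σ τ υ : State} {t₁ t₂ : ℕ} (h₁ : Exec p σ t₁ τ) (h₂ : Exec q τ t₂ υ) :
      Exec (.seq p q) σ (t₁ + t₂) υ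
  | ite_true {e : Expr} {p q : Prog} {σ τ : State} {t : ℕ} (h : e.eval σ ≠ 0)
      (h₁ : Exec p σ t τ) : Exec (.ite e p q) σ (1 + e.cost + t) τ
  | ite_false {e : Expr} {p q : Prog} {σ τ : State} {t : ℕ} (h : e.eval σ = 0)
      (h₁ : Exec q σ t τ) : Exec (.ite e p q) σ (1 + e.cost + t) τ
  | loop_true {e : Expr} {p : Prog} {σ τ υ : State} {t₁ t₂ : ℕ} (h : e.eval σ ≠ 0)
      (h₁ : Exec p σ t₁ τ) (h₂ : Exec (.loop e p) τ t₂ υ) :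
      Exec (.loop e p) σ (1 + e.cost + t₁ + t₂) υ
  | loop_false {e : Expr} {p : Prog} {σ : State} (h : e.eval σ = 0) :
      Exec (.loop e p) σ (1 + e.cost) σ

/-- Execution is deterministic: the final state and the number of steps are unique. -/
theorem Exec.unique {p : Prog} {σ τ τ' : State} {t t' : ℕ} (h : Exec p σ t τ)
    (h' : Exec p σ t' τ') : t = t' ∧ τ = τ' := by
  induction h generalizing t' τ' with
  | skip => cases h'; exact ⟨rfl, rfl⟩
  | assign => cases h'; exact ⟨rfl, rfl⟩
  | store => cases h'; exact ⟨rfl, rfl⟩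
  | seq _ _ ih₁ ih₂ =>
    cases h' with
    | seq g₁ g₂ =>
      obtain ⟨rfl, rfl⟩ := ih₁ g₁
      obtain ⟨rfl, rfl⟩ := ih₂ g₂
      exact ⟨rfl, rfl⟩
  | ite_true h _ ih =>
    cases h' with
    | ite_true _ g => obtain ⟨rfl, rfl⟩ := ih g; exact ⟨rfl, rfl⟩
    | ite_false k _ => exact absurd k h
  | ite_false h _ ih =>
    cases h' with
    | ite_true k _ => exact absurd h k
    | ite_false _ g => obtain ⟨rfl, rfl⟩ := ih g; exact ⟨rfl, rfl⟩
  | loop_true h _ _ ih₁ ih₂ =>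
    cases h' with
    | loop_true _ g₁ g₂ =>
      obtain ⟨rfl, rfl⟩ := ih₁ g₁
      obtain ⟨rfl, rfl⟩ := ih₂ g₂
      exact ⟨rfl, rfl⟩
    | loop_false k => exact absurd k h
  | loop_false h =>
    cases h' with
    | loop_true k _ _ => exact absurd h k
    | loop_false _ => exact ⟨rfl, rfl⟩

/-- The initial state on the input word `w`: the word is in the memory cells `0, 1, …`, its length
is in register `0`, and everything else is `0`. -/
def initial (w : List ℕ) : State where
  reg := fun x => if x = 0 then w.length else 0
  mem := fun i => w.getD i 0

/-- Started on the input word `w`, the program `p` halts after exactly `t` steps with the output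
(in register `0`) `1` if `Q` is true, and `0` if `Q` is false. -/
def DecidesIn (p : Prog) (w : List ℕ) (t : ℕ) (Q : Prop) : Prop :=
  ∃ τ : State, Exec p (initial w) t τ ∧ ((Q ∧ τ.reg 0 = 1) ∨ (¬ Q ∧ τ.reg 0 = 0))

end RAM

/-! ## Graphs as inputs -/

/-- `N` represents the graph `G` by adjacency lists: `N u` lists the neighbors of `u`, each of them
once, in an arbitrary order. -/
def IsAdjacencyLists {n : ℕ} (G : SimpleGraph (Fin n)) (N : Fin n → List (Fin n)) : Prop :=
  ∀ u : Fin n, (N u).Nodup ∧ ∀ v, v ∈ N u ↔ G.Adj u v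

/-- The input word for a graph with vertices `0, …, n - 1`, given by adjacency lists, and a formula:
the number `n`, then for each vertex its degree followed by its neighbors, then the formula. -/
def modelCheckingInput {n : ℕ} (N : Fin n → List (Fin n)) (φ : FOFormula) : List ℕ :=
  n :: ((List.finRange n).flatMap fun u => (N u).length :: (N u).map Fin.val) ++ φ.encode

/-! A depth-first search forest replaces an optimal elimination forest. Every edge of `G` joins a
vertex to one of its ancestors in the search forest, and the path of the search is a path of `G`.
Paths in a graph of tree-depth `k` have fewer than `2 ^ k` vertices
(`SimpleGraph.length_lt_two_pow_treeDepth`), since a vertex of least level splits a path into two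
paths strictly below it. So the search forest has height below `h = 2 ^ k`, and `k` enters only the
analysis, never the program.

A subtree of the search forest that hangs on a path `P` is determined, up to isomorphism over `P`,
by its code: in preorder, the level of each vertex and the levels of its adjacent ancestors. If `s`
other subtrees on `P` have the same code, the subtree can be deleted without changing the truth of
sentences with at most `s` variable names (`FOFormula.satOn_diff_iff`,
`VBlock.Attached.satOn_diff_iff`). Indeed, when a quantifier picks a vertex of the subtree, the
other variables hold fewer than `s` vertices, so one of the copies avoids them all, and exchanging
the subtree with that copy is an automorphism. The number of names matters and not the quantifier
rank, because rebinding a name frees its old value.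

The search makes these deletions when it closes a vertex (`Search.Inv.close`). At most `s` copies of
each code then survive at each vertex, so by induction from the leaves the recorded state has a code
bounded in terms of `s` and `h` (`AutoBounded.encode_le`). Each step of the search passes one event
to the automaton `autoStep`, which updates that state. The update is primitive recursive, and a
random access machine computes every primitive recursive function in primitive recursive time
(`RAM.exists_computes`). So each step costs at most a computable function of `s` and `h`, and the
number of steps is linear in the numbers of vertices and edges, where the degrees sum to at most `2
* n * k` (`SimpleGraph.sum_length_le_treeDepth`).

The sentence is then evaluated in the reduced graph, whose size depends on `s` and `k` only. Its
Polish notation is processed from the last symbol to the first with a stack of tables, where a table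
is the set of satisfying assignments of a subformula (`RAM.evalProg_run`). Each symbol costs one
operation on tables of bounded code. The loops are assembled in `RAM.modelChecker_runs`, and
`RAM.timeBound_le` separates a constant, a function of `(s, k)` and the factor `n + l`, where `l` is
the length of the sentence. -/

set_option linter.unusedSimpArgs false

/-! ## Running times of random access machines, and primitive recursive functions -/

namespace RAM

/-- Started in `σ`, the program `p` halts within `t` steps in a state satisfying `Q`. -/
def Runs (p : Prog) (σ : State) (t : ℕ) (Q : State → Prop) : Prop :=
  ∃ t' τ, Exec p σ t' τ ∧ t' ≤ t ∧ Q τ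

namespace Runs

variable {p q : Prog} {σ : State} {t t₁ t₂ : ℕ} {Q R : State → Prop}

theorem mono (h : Runs p σ t₁ Q) (ht : t₁ ≤ t₂) (hQ : ∀ τ, Q τ → R τ) : Runs p σ t₂ R := by
  obtain ⟨t', τ, h, h', hq⟩ := h
  exact ⟨t', τ, h, h'.trans ht, hQ _ hq⟩

theorem skip (h : Q σ) : Runs .skip σ 1 Q := ⟨_, _, .skip σ, le_rfl, h⟩

theorem assign {x : ℕ} {e : Expr} (h : Q ⟨Function.update σ.reg x (e.eval σ), σ.mem⟩) :
    Runs (.assign x e) σ (1 + e.cost) Q := ⟨_, _, .assign x e σ, le_rfl, h⟩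

theorem store {e₁ e₂ : Expr} (h : Q ⟨σ.reg, Function.update σ.mem (e₁.eval σ) (e₂.eval σ)⟩) :
    Runs (.store e₁ e₂) σ (1 + e₁.cost + e₂.cost) Q := ⟨_, _, .store e₁ e₂ σ, le_rfl, h⟩

theorem seq (h : Runs p σ t₁ fun τ => Runs q τ t₂ Q) : Runs (.seq p q) σ (t₁ + t₂) Q := by
  obtain ⟨a, τ, h, h', b, υ, g, g', hq⟩ := h
  exact ⟨_, _, .seq h g, by omega, hq⟩

theorem ite {e : Expr} (h₁ : e.eval σ ≠ 0 → Runs p σ t Q) (h₂ : e.eval σ = 0 → Runs q σ t Q) :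
    Runs (.ite e p q) σ (1 + e.cost + t) Q := by
  by_cases h : e.eval σ = 0
  · obtain ⟨a, τ, g, g', hq⟩ := h₂ h
    exact ⟨_, _, .ite_false h g, by omega, hq⟩
  · obtain ⟨a, τ, g, g', hq⟩ := h₁ h
    exact ⟨_, _, .ite_true h g, by omega, hq⟩

/-- Loops with a potential function that pays for the running time. -/
theorem loop_potential {e : Expr} (I : State → Prop) (μ : State → ℕ)
    (h : ∀ σ, I σ → e.eval σ ≠ 0 →
      ∃ T, Runs p σ T fun τ => I τ ∧ T + 1 + e.cost + μ τ ≤ μ σ) (hI : I σ) :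
    Runs (.loop e p) σ (μ σ + 1 + e.cost) fun τ => I τ ∧ e.eval τ = 0 := by
  induction hm : μ σ using Nat.strong_induction_on generalizing σ with
  | _ m ih =>
    by_cases h0 : e.eval σ = 0
    · exact ⟨_, _, .loop_false h0, by omega, hI, h0⟩
    · obtain ⟨T, a, τ, g, ha, hτ, hμ⟩ := h σ hI h0
      obtain ⟨b, υ, g', hb, hq⟩ := ih (μ τ) (by omega) hτ rfl
      exact ⟨_, _, .loop_true h0 g g', by omega, hq⟩

/-- Loops with a decreasing measure, and a bounded running time of the body. -/
theorem loop_measure {e : Expr} (I : State → Prop) (μ : State → ℕ) (T : ℕ)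
    (h : ∀ σ, I σ → e.eval σ ≠ 0 → Runs p σ T fun τ => I τ ∧ μ τ < μ σ) (hI : I σ) :
    Runs (.loop e p) σ (μ σ * (T + 1 + e.cost) + 1 + e.cost) fun τ => I τ ∧ e.eval τ = 0 := by
  refine loop_potential I (fun σ => μ σ * (T + 1 + e.cost)) (fun σ hσ h0 => ⟨T, ?_⟩) hI
  refine (h σ hσ h0).mono le_rfl fun τ hτ => ⟨hτ.1, ?_⟩
  have := Nat.mul_le_mul_right (T + 1 + e.cost) hτ.2
  rw [Nat.succ_mul] at this
  omega

end Runs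

/-- The program family `p`, parametrized by a register `r`, computes `f` in place in the
register `r`, within `c` steps, using only registers from `r` on. -/
def Computes (p : ℕ → Prog) (f c : ℕ → ℕ) : Prop :=
  ∀ r σ, Runs (p r) σ (c (σ.reg r)) fun τ =>
    τ.mem = σ.mem ∧ τ.reg r = f (σ.reg r) ∧ ∀ x < r, τ.reg x = σ.reg x

/-- Repeats `r + 3 := r + 3 + y` as often as the contents of `r + 2` says. -/
def mulAddProg (r y : ℕ) : Prog :=
  .loop (.reg (r + 2)) (.seq (.assign (r + 3) (.add (.reg (r + 3)) (.reg y)))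
    (.assign (r + 2) (.sub (.reg (r + 2)) (.lit 1))))

/-- Multiplication by repeated addition: the part of the product still to be added, plus the
accumulator, is constant. The bound `hy` keeps the summand out of the two registers that the loop
overwrites. -/
theorem mulAddProg_runs (r y : ℕ) (hy : y < r + 2) (σ : State) :
    Runs (mulAddProg r y) σ (10 * σ.reg (r + 2) + 2) fun τ => τ.mem = σ.mem ∧
      τ.reg (r + 3) = σ.reg (r + 2) * σ.reg y + σ.reg (r + 3) ∧ ∀ x < r + 2, τ.reg x = σ.reg x := by
  have := Runs.loop_measure (σ := σ) (e := .reg (r + 2))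
    (p := .seq (.assign (r + 3) (.add (.reg (r + 3)) (.reg y)))
      (.assign (r + 2) (.sub (.reg (r + 2)) (.lit 1))))
    (fun τ => τ.mem = σ.mem ∧ τ.reg (r + 2) * σ.reg y + τ.reg (r + 3) =
      σ.reg (r + 2) * σ.reg y + σ.reg (r + 3) ∧ ∀ x < r + 2, τ.reg x = σ.reg x)
    (fun τ => τ.reg (r + 2)) 8 ?_ ⟨rfl, rfl, fun _ _ => rfl⟩
  · refine this.mono (by simp [Expr.cost]; omega) ?_
    rintro τ ⟨⟨h1, h2, h3⟩, h4⟩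
    simp only [Expr.eval] at h4
    refine ⟨h1, ?_, h3⟩
    rw [← h2, h4]; simp
  · rintro τ ⟨h1, h2, h3⟩ h4
    simp only [Expr.eval] at h4
    refine (Runs.seq (.assign (.assign (Q := fun υ => _) ?_))).mono
      (by simp [Expr.cost]) (fun _ h => h)
    refine ⟨⟨h1, ?_, fun x hx => ?_⟩, ?_⟩
    · obtain ⟨m, hm⟩ := Nat.exists_eq_succ_of_ne_zero h4
      rw [← h2]
      simp [Expr.eval, Function.update_apply, hm, h3 y hy]
      ring
    · simp [Function.update_apply, show x ≠ r + 2 by omega, show x ≠ r + 3 by omega, h3 x hx]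
    · simp [Expr.eval, Function.update_apply]; omega

/-- Replaces the contents `a` of register `r` by `Nat.pair a b`, where `b` is the contents of
register `r + 1`. -/
def pairProg (r : ℕ) : Prog :=
  .ite (.sub (.reg (r + 1)) (.reg r))
    (.seq (.assign (r + 2) (.reg (r + 1))) (.seq (.assign (r + 3) (.reg r))
      (.seq (mulAddProg r (r + 1)) (.assign r (.reg (r + 3))))))
    (.seq (.assign (r + 2) (.reg r)) (.seq (.assign (r + 3) (.add (.reg r) (.reg (r + 1))))
      (.seq (mulAddProg r r) (.assign r (.reg (r + 3))))))

/-- `Nat.pair a b` is `b * b + a` or `a * a + a + b`, so one multiplication suffices. Since `a + b ≤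
Nat.pair a b`, the time is linear in the result. -/
theorem pairProg_runs (r : ℕ) (σ : State) :
    Runs (pairProg r) σ (20 * (Nat.pair (σ.reg r) (σ.reg (r + 1)) + 1)) fun τ => τ.mem = σ.mem ∧
      τ.reg r = Nat.pair (σ.reg r) (σ.reg (r + 1)) ∧ ∀ x < r, τ.reg x = σ.reg x := by
  have hle := Nat.add_le_pair (σ.reg r) (σ.reg (r + 1))
  refine (Runs.ite (t := 10 * (σ.reg r + σ.reg (r + 1)) + 16) ?_ ?_).mono
    (by simp [Expr.cost]; omega) (fun _ h => h)
  · intro h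
    have hlt : σ.reg r < σ.reg (r + 1) := by simp [Expr.eval] at h; omega
    refine (Runs.seq (.assign (.seq (.assign (.seq ((mulAddProg_runs r (r + 1) (by omega) _).mono
      le_rfl fun τ hτ => .assign ?_)))))).mono (by simp [Expr.cost, Expr.eval]; omega) (fun _ h => h)
    simp [Expr.eval, Function.update_apply] at hτ ⊢
    obtain ⟨h1, h2, h3⟩ := hτ
    refine ⟨h1, by rw [h2, Nat.pair, if_pos hlt], fun x hx => ?_⟩
    rw [if_neg (by omega), h3 x (by omega), if_neg (by omega), if_neg (by omega)]
  · intro h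
    have hlt : ¬ σ.reg r < σ.reg (r + 1) := by simp [Expr.eval] at h; omega
    refine (Runs.seq (.assign (.seq (.assign (.seq ((mulAddProg_runs r r (by omega) _).mono
      le_rfl fun τ hτ => .assign ?_)))))).mono (by simp [Expr.cost, Expr.eval]; omega) (fun _ h => h)
    simp [Expr.eval, Function.update_apply] at hτ ⊢
    obtain ⟨h1, h2, h3⟩ := hτ
    refine ⟨h1, by rw [h2, Nat.pair, if_neg hlt]; ring, fun x hx => ?_⟩
    rw [if_neg (by omega), h3 x (by omega), if_neg (by omega), if_neg (by omega)]

/-- Replaces the contents of register `r` by the two components of its inverse image under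
`Nat.pair`, in the registers `r` and `r + 1`. -/
def unpairProg (r : ℕ) : Prog :=
  .seq (.assign (r + 1) (.lit 0))
  (.seq (.loop (.sub (.reg r) (.add (.reg (r + 1)) (.reg (r + 1))))
    (.seq (.assign r (.sub (.reg r) (.add (.add (.reg (r + 1)) (.reg (r + 1))) (.lit 1))))
      (.assign (r + 1) (.add (.reg (r + 1)) (.lit 1)))))
  (.ite (.sub (.reg (r + 1)) (.reg r)) .skip
    (.seq (.assign (r + 2) (.sub (.reg r) (.reg (r + 1))))
      (.seq (.assign r (.reg (r + 1))) (.assign (r + 1) (.reg (r + 2)))))))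

/-- Subtracting the first `j` odd numbers from `n` leaves `n - j * j`. The loop stops when this
remainder is at most `2 * j`, which means that `j` is the integer square root of `n`. -/
theorem unpairProg_runs (r : ℕ) (σ : State) :
    Runs (unpairProg r) σ (40 * (σ.reg r + 1)) fun τ => τ.mem = σ.mem ∧
      τ.reg r = (Nat.unpair (σ.reg r)).1 ∧ τ.reg (r + 1) = (Nat.unpair (σ.reg r)).2 ∧
      ∀ x < r, τ.reg x = σ.reg x := by
  refine (Runs.seq (.assign (.seq ?_))).mono (t₁ := (1 + 1) + (σ.reg r * (12 + 1 + 5) + 1 + 5 +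
    (1 + 3 + 9))) (by omega) (fun _ h => h)
  have := Runs.loop_measure (σ := ⟨Function.update σ.reg (r + 1) 0, σ.mem⟩)
    (e := .sub (.reg r) (.add (.reg (r + 1)) (.reg (r + 1))))
    (p := .seq (.assign r (.sub (.reg r) (.add (.add (.reg (r + 1)) (.reg (r + 1))) (.lit 1))))
      (.assign (r + 1) (.add (.reg (r + 1)) (.lit 1))))
    (fun τ => τ.mem = σ.mem ∧ τ.reg r + τ.reg (r + 1) * τ.reg (r + 1) = σ.reg r ∧
      ∀ x < r, τ.reg x = σ.reg x)
    (fun τ => τ.reg r) 12 ?_ ⟨rfl, by simp, fun x hx => ?_⟩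
  · refine this.mono (by simp [Expr.cost, Function.update_apply]) ?_
    rintro τ ⟨⟨h1, h2, h3⟩, h4⟩
    simp only [Expr.eval] at h4
    have hs : Nat.sqrt (σ.reg r) = τ.reg (r + 1) := by
      rw [← h2, add_comm, Nat.sqrt_add_eq]; omega
    have hu : Nat.unpair (σ.reg r) = if τ.reg r < τ.reg (r + 1) then (τ.reg r, τ.reg (r + 1))
        else (τ.reg (r + 1), τ.reg r - τ.reg (r + 1)) := by
      simp only [Nat.unpair, hs]
      rw [show σ.reg r - τ.reg (r + 1) * τ.reg (r + 1) = τ.reg r by omega]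
    rw [hu]
    refine Runs.ite (t := 9) (fun h => ?_) (fun h => ?_)
    · simp only [Expr.eval] at h
      rw [if_pos (by omega)]
      exact (Runs.skip ⟨h1, rfl, rfl, h3⟩).mono (by simp) fun _ h => h
    · simp only [Expr.eval] at h
      rw [if_neg (by omega)]
      refine (Runs.seq (.assign (.seq (.assign (.assign ?_))))).mono (by simp [Expr.cost])
        fun _ h => h
      refine ⟨h1, by simp [Expr.eval, Function.update_apply],
        by simp [Expr.eval, Function.update_apply], fun x hx => ?_⟩
      simp [Function.update_apply, show x ≠ r by omega, show x ≠ r + 1 by omega,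
        show x ≠ r + 2 by omega, h3 x hx]
  · rintro τ ⟨h1, h2, h3⟩ h4
    simp only [Expr.eval] at h4
    refine (Runs.seq (.assign (.assign (Q := fun υ => _) ?_))).mono
      (by simp [Expr.cost]) (fun _ h => h)
    refine ⟨⟨h1, ?_, fun x hx => ?_⟩, ?_⟩
    · simp [Expr.eval, Function.update_apply]
      obtain ⟨m, hm⟩ := Nat.exists_eq_add_of_lt (Nat.pos_of_ne_zero h4)
      rw [← h2, show τ.reg r = m + 1 + (τ.reg (r + 1) + τ.reg (r + 1)) by omega,
        show m + 1 + (τ.reg (r + 1) + τ.reg (r + 1)) - (τ.reg (r + 1) + τ.reg (r + 1) + 1) = m by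
          omega]
      ring
    · simp [Function.update_apply, show x ≠ r by omega, show x ≠ r + 1 by omega, h3 x hx]
    · simp [Expr.eval, Function.update_apply]; omega
  · simp [Function.update_apply, show x ≠ r + 1 by omega]

/-- Every primitive recursive function is computed by a random access machine in primitive
recursive time. -/
theorem exists_computes {f : ℕ → ℕ} (hf : Nat.Primrec f) :
    ∃ (p : ℕ → Prog) (c : ℕ → ℕ), Primrec c ∧ Computes p f c := by
  induction hf with
  | zero =>
    refine ⟨fun r => .assign r (.lit 0), fun _ => 2, Primrec.const _, fun r σ =>
      .assign ⟨rfl, by simp [Expr.eval], fun x hx => ?_⟩⟩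
    simp [Function.update_apply, hx.ne]
  | succ =>
    refine ⟨fun r => .assign r (.add (.reg r) (.lit 1)), fun _ => 4, Primrec.const _, fun r σ =>
      .assign ⟨rfl, by simp [Expr.eval], fun x hx => ?_⟩⟩
    simp [Function.update_apply, hx.ne]
  | left =>
    refine ⟨unpairProg, fun n => 40 * (n + 1), ?_, fun r σ => (unpairProg_runs r σ).mono le_rfl
      fun τ h => ⟨h.1, h.2.1, h.2.2.2⟩⟩
    exact Primrec.nat_mul.comp (.const _) .succ
  | right =>
    refine ⟨fun r => .seq (unpairProg r) (.assign r (.reg (r + 1))), fun n => 40 * (n + 1) + 2, ?_,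
      fun r σ => .seq ((unpairProg_runs r σ).mono le_rfl
      fun τ h => .assign ⟨h.1, by simp [Expr.eval, h.2.2.1], fun x hx => ?_⟩)⟩
    · exact Primrec.nat_add.comp (Primrec.nat_mul.comp (.const _) .succ) (.const _)
    · simp [Function.update_apply, hx.ne, h.2.2.2 x hx]
  | @pair f g hf hg ihf ihg =>
    obtain ⟨p, c, hc, hp⟩ := ihf
    obtain ⟨q, d, hd, hq⟩ := ihg
    replace hf := Primrec.nat_iff.2 hf
    replace hg := Primrec.nat_iff.2 hg
    -- The argument stays in `r` and the value of `f` in `r + 1`, below the registers that the later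
    -- programs may overwrite.
    refine ⟨fun r => .seq (.assign (r + 1) (.reg r)) (.seq (p (r + 1))
      (.seq (.assign (r + 2) (.reg r)) (.seq (q (r + 2)) (.seq (pairProg (r + 1))
      (.assign r (.reg (r + 1))))))),
      fun n => 2 + (c n + (2 + (d n + (20 * (Nat.pair (f n) (g n) + 1) + 2)))), ?_, fun r σ => ?_⟩
    · exact Primrec.nat_add.comp (.const _) (Primrec.nat_add.comp hc (Primrec.nat_add.comp (.const _)
        (Primrec.nat_add.comp hd (Primrec.nat_add.comp (Primrec.nat_mul.comp (.const _)
          (Primrec.succ.comp (Primrec₂.natPair.comp hf hg))) (.const _)))))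
    · refine Runs.seq (.assign (.seq ((hp (r + 1) _).mono
        (by simp [Expr.eval]) fun τ hτ => .seq (.assign (.seq
        ((hq (r + 2) _).mono ?_ fun υ hυ => .seq ((pairProg_runs (r + 1) υ).mono ?_ fun ω hω =>
          .assign ?_)))))))
      all_goals simp [Expr.eval, Function.update_apply] at hτ
      all_goals obtain ⟨h1, h2, h3⟩ := hτ
      · simp [Expr.eval, h3]
      all_goals simp [Expr.eval, Function.update_apply] at hυ
      all_goals obtain ⟨g1, g2, g3⟩ := hυ
      all_goals
        have e1 : υ.reg (r + 1) = f (σ.reg r) := by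
          have := g3 (r + 1) (by omega)
          simpa [h2] using this
        have e2 : υ.reg (r + 2) = g (σ.reg r) := by rw [g2, h3 r (by omega)]; simp
      · rw [e1, show r + 1 + 1 = r + 2 from rfl, e2]
      · obtain ⟨k1, k2, k3⟩ := hω
        refine ⟨by rw [k1, g1, h1], by simp [Expr.eval, k2, e1, e2], fun x hx => ?_⟩
        have a1 := k3 x (by omega)
        have a2 := g3 x (by omega)
        have a3 := h3 x (by omega)
        simp only [show x ≠ r + 2 by omega, show x ≠ r + 1 by omega, if_false] at a2 a3
        simp [Function.update_apply, hx.ne, a1, a2, a3]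
  | @comp f g hf hg ihf ihg =>
    obtain ⟨p, c, hc, hp⟩ := ihf
    obtain ⟨q, d, hd, hq⟩ := ihg
    replace hf := Primrec.nat_iff.2 hf
    replace hg := Primrec.nat_iff.2 hg
    refine ⟨fun r => .seq (q r) (p r), fun n => d n + c (g n),
      Primrec.nat_add.comp hd (hc.comp hg), fun r σ => .seq ((hq r σ).mono le_rfl fun τ hτ =>
      (hp r τ).mono (by rw [hτ.2.1]) fun υ hυ => ⟨hυ.1.trans hτ.1, by rw [hυ.2.1, hτ.2.1],
        fun x hx => (hυ.2.2 x hx).trans (hτ.2.2 x hx)⟩)⟩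
  | @prec f g hf hg ihf ihg =>
    obtain ⟨p, c, hc, hp⟩ := ihf
    obtain ⟨q, d, hd, hq⟩ := ihg
    replace hf := Primrec.nat_iff.2 hf
    replace hg := Primrec.nat_iff.2 hg
    -- `F z n` is the value of the recursion, `A z y` the argument of `g` in round `y`, `D z y` a
    -- bound for the cost of that round, and `S z n` the total for the first `n` rounds. The loop is
    -- paid for by the potential `S z m - S z y`.
    let F : ℕ → ℕ → ℕ := fun z n => n.rec (f z) fun y IH => g <| Nat.pair z <| Nat.pair y IH
    let A : ℕ → ℕ → ℕ := fun z y => Nat.pair z (Nat.pair y (F z y))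
    let D : ℕ → ℕ → ℕ := fun z y => 40 * (A z y + 1) + d (A z y) + 20
    let S : ℕ → ℕ → ℕ := fun z n => n.rec 0 fun y acc => acc + D z y
    have hF : Primrec₂ F := by
      refine Primrec.nat_rec (f := f) (g := fun z a => g (Nat.pair z (Nat.pair a.1 a.2))) hf ?_
      exact hg.comp (Primrec₂.natPair.comp .fst (Primrec₂.natPair.comp (Primrec.fst.comp .snd)
        (Primrec.snd.comp .snd)))
    have hA : Primrec₂ A := Primrec₂.natPair.comp .fst (Primrec₂.natPair.comp .snd hF)
    have hD : Primrec₂ D := Primrec.nat_add.comp (Primrec.nat_add.comp (Primrec.nat_mul.comp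
      (.const _) (Primrec.succ.comp hA)) (hd.comp hA)) (.const _)
    have hS : Primrec₂ S := by
      refine Primrec.nat_rec (f := fun _ => 0) (g := fun z a => a.2 + D z a.1) (.const _) ?_
      exact Primrec.nat_add.comp (Primrec.snd.comp .snd) (hD.comp .fst (Primrec.fst.comp .snd))
    have hl : ∀ z m, ∀ y < m, S z y + D z y ≤ S z m := by
      intro z m
      induction m with
      | zero => intro y hy; omega
      | succ m ih =>
        intro y hy
        show _ ≤ S z m + D z m
        rcases Nat.lt_succ_iff_lt_or_eq.1 hy with h | rfl
        · have := ih y h; omega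
        · rfl
    refine ⟨fun r => .seq (.assign (r + 1) (.reg r)) (.seq (unpairProg (r + 1))
      (.seq (.assign (r + 3) (.lit 0)) (.seq (.assign (r + 4) (.reg (r + 1)))
      (.seq (p (r + 4)) (.seq (.loop (.sub (.reg (r + 2)) (.reg (r + 3)))
        (.seq (.assign (r + 5) (.reg (r + 1))) (.seq (.assign (r + 6) (.reg (r + 3)))
        (.seq (.assign (r + 7) (.reg (r + 4))) (.seq (pairProg (r + 6))
        (.seq (pairProg (r + 5)) (.seq (q (r + 5)) (.seq (.assign (r + 4) (.reg (r + 5)))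
          (.assign (r + 3) (.add (.reg (r + 3)) (.lit 1)))))))))))
      (.assign r (.reg (r + 4)))))))),
      fun n => 2 + (40 * (n + 1) + (2 + (2 + (c n.unpair.1 + (S n.unpair.1 n.unpair.2 + 1 + 3
        + 2))))), ?_, fun r σ => ?_⟩
    · have h1 := Primrec.fst.comp Primrec.unpair
      have h2 := Primrec.snd.comp Primrec.unpair
      exact Primrec.nat_add.comp (.const _) (Primrec.nat_add.comp (Primrec.nat_mul.comp (.const _)
        .succ) (Primrec.nat_add.comp (.const _) (Primrec.nat_add.comp (.const _)
        (Primrec.nat_add.comp (hc.comp h1) (Primrec.nat_add.comp (Primrec.succ.comp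
          (Primrec.succ.comp (Primrec.succ.comp (Primrec.succ.comp (hS.comp h1 h2)))))
          (.const _))))))
    · set n := σ.reg r with hn
      set z := n.unpair.1 with hz
      set m := n.unpair.2 with hm
      refine Runs.seq (.assign (.seq ((unpairProg_runs (r + 1) _).mono ?_ fun τ hτ => .seq
        (.assign (.seq (.assign (.seq ((hp (r + 4) _).mono ?_ fun υ hυ => .seq ?_))))))))
      · simp [Expr.eval, hn]
      all_goals simp [Expr.eval, Function.update_apply, ← hn, ← hm, ← hz] at hτ
      all_goals obtain ⟨h1, h2, h3, h4⟩ := hτ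
      · simp [Expr.eval, h2, ← hz]
      simp [Expr.eval, Function.update_apply] at hυ
      obtain ⟨g1, g2, g3⟩ := hυ
      -- Between rounds, `r + 1` and `r + 2` hold `z` and `m`, `r + 3` holds the number of completed
      -- rounds, and `r + 4` the current value of the recursion.
      have := Runs.loop_potential (σ := υ) (e := .sub (.reg (r + 2)) (.reg (r + 3)))
        (p := (.seq (.assign (r + 5) (.reg (r + 1))) (.seq (.assign (r + 6) (.reg (r + 3)))
        (.seq (.assign (r + 7) (.reg (r + 4))) (.seq (pairProg (r + 6))
        (.seq (pairProg (r + 5)) (.seq (q (r + 5)) (.seq (.assign (r + 4) (.reg (r + 5)))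
          (.assign (r + 3) (.add (.reg (r + 3)) (.lit 1)))))))))))
        (fun ω => ω.mem = σ.mem ∧ (∀ x ≤ r, ω.reg x = σ.reg x) ∧ ω.reg (r + 1) = z ∧
          ω.reg (r + 2) = m ∧ ω.reg (r + 3) ≤ m ∧ ω.reg (r + 4) = F z (ω.reg (r + 3)))
        (fun ω => S z m - S z (ω.reg (r + 3))) ?_ ?_
      · have e3 : υ.reg (r + 3) = 0 := by simpa using g3 (r + 3) (by omega)
        refine this.mono (by rw [e3]; simp [Expr.cost, S, ← hz, ← hm]) ?_
        rintro ω ⟨⟨k1, k2, k3, k4, k5, k6⟩, k7⟩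
        simp only [Expr.eval] at k7
        refine Runs.assign ⟨k1, ?_, fun x hx => ?_⟩
        · have : ω.reg (r + 3) = m := by omega
          simp [Expr.eval, k6, this, F, Nat.unpaired, ← hz, ← hm]
        · simp [Function.update_apply, hx.ne, k2 x hx.le]
      · rintro ω ⟨k1, k2, k3, k4, k5, k6⟩ k7
        simp only [Expr.eval] at k7
        set y := ω.reg (r + 3) with hy
        have hA1 : Nat.pair y (F z y) ≤ A z y := Nat.right_le_pair _ _
        refine ⟨2 + (2 + (2 + (20 * (Nat.pair y (F z y) + 1) + (20 * (A z y + 1) +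
          (d (A z y) + (2 + 4)))))), Runs.seq (.assign (.seq (.assign (.seq (.assign (.seq
          ((pairProg_runs (r + 6) _).mono ?_ fun ρ hρ => .seq ((pairProg_runs (r + 5) _).mono ?_
          fun ρ' hρ' => .seq ((hq (r + 5) _).mono ?_ fun ρ'' hρ'' => .seq
          (.assign (.assign ?_)))))))))))⟩
        · simp [Expr.eval, ← hy, k6]
        all_goals simp [Expr.eval, ← hy, k6, k3, Function.update_apply] at hρ
        all_goals obtain ⟨a1, a2, a3⟩ := hρ
        all_goals
          have a4 : ρ.reg (r + 5) = z := by
            have := a3 (r + 5) (by omega)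
            simpa using this
        · simp [a2, a4, A]
        all_goals simp [a2, a4] at hρ'
        all_goals obtain ⟨b1, b2, b3⟩ := hρ'
        · simp [b2, A]
        simp only [b2] at hρ''
        obtain ⟨c1, c2, c3⟩ := hρ''
        have key : ∀ x < r + 5, ρ''.reg x = ω.reg x := by
          intro x hx
          have t1 := a3 x (by omega)
          simp only [show x ≠ r + 7 by omega, show x ≠ r + 6 by omega, show x ≠ r + 5 by omega,
            if_false] at t1
          rw [c3 x hx, b3 x hx, t1]
        have hlt : y < m := by omega
        have hS' := hl z m y hlt
        refine ⟨⟨by simp only [c1, b1, a1, k1], fun x hx => ?_, ?_, ?_, ?_, ?_⟩, ?_⟩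
        · simp [Function.update_apply, show x ≠ r + 3 by omega, show x ≠ r + 4 by omega,
            key x (by omega), k2 x hx]
        · simp [Function.update_apply, key, k3]
        · simp [Function.update_apply, key, k4]
        · simp [Function.update_apply, key, Expr.eval]; omega
        · simp [Function.update_apply, key, Expr.eval, c2, ← hy, F]
        · have e1 : S z (y + 1) = S z y + D z y := rfl
          have e2 : S z (y + 1) ≤ S z m := by omega
          simp [Function.update_apply, key, Expr.eval, Expr.cost, ← hy]
          simp only [D] at e1
          omega
      · refine ⟨by simp only [g1, h1], fun x hx => ?_, ?_, ?_, ?_, ?_⟩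
        · have t1 := g3 x (by omega)
          have t2 := h4 x (by omega)
          simp only [show x ≠ r + 4 by omega, show x ≠ r + 3 by omega, show x ≠ r + 1 by omega,
            if_false] at t1 t2
          rw [t1, t2]
        · simpa [h2] using g3 (r + 1) (by omega)
        · simpa [h3] using g3 (r + 2) (by omega)
        · have : υ.reg (r + 3) = 0 := by simpa using g3 (r + 3) (by omega)
          omega
        · have : υ.reg (r + 3) = 0 := by simpa using g3 (r + 3) (by omega)
          rw [this, g2, h2]
          rfl

end RAM

/-! ## A machine with named registers and arrays -/

namespace RAM

/-- The named registers. -/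
inductive Reg
  | len | size | next | height | auto | names | cur | count | vert | nbr | event | left | right
  deriving DecidableEq

/-- The number of a named register. -/
def Reg.index : Reg → ℕ
  | len => 1 | size => 2 | next => 3 | height => 4 | auto => 5 | names => 6 | cur => 7
  | count => 8 | vert => 9 | nbr => 10 | event => 11 | left => 12 | right => 13

theorem Reg.index_inj {x y : Reg} : x.index = y.index ↔ x = y := by
  cases x <;> cases y <;> simp [Reg.index]

theorem Reg.index_pos (x : Reg) : 0 < x.index := by cases x <;> simp [Reg.index]

theorem Reg.index_lt (x : Reg) : x.index < 40 := by cases x <;> simp [Reg.index]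

/-- The named arrays. -/
inductive Arr
  | ptr | rem | status | stack | idx | pos | vals | aux
  deriving DecidableEq

/-- The number of a named array. -/
def Arr.index : Arr → ℕ
  | ptr => 0 | rem => 1 | status => 2 | stack => 3 | idx => 4 | pos => 5 | vals => 6 | aux => 7

/-- The array with a given number. -/
def Arr.ofIndex : ℕ → Arr
  | 0 => ptr | 1 => rem | 2 => status | 3 => stack | 4 => idx | 5 => pos | 6 => vals | _ => aux

theorem Arr.ofIndex_index (a : Arr) : Arr.ofIndex a.index = a := by cases a <;> rfl

theorem Arr.index_lt (a : Arr) : a.index < 8 := by cases a <;> simp [Arr.index]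

theorem Arr.ofIndex_eq_iff (a : Arr) {m : ℕ} (hm : m < 8) : Arr.ofIndex m = a ↔ m = a.index := by
  interval_cases m <;> cases a <;> simp [Arr.index, Arr.ofIndex]

/-- The contents of the named registers and of the arrays. -/
structure NState where
  reg : Reg → ℕ
  arr : Arr → ℕ → ℕ

namespace NState

/-- The memory of the random access machine: the input word, and the interleaved arrays. -/
def mem (w : List ℕ) (S : NState) (a : ℕ) : ℕ :=
  if a < w.length + 4 then w.getD a 0
  else S.arr (.ofIndex ((a - (w.length + 4)) % 8)) ((a - (w.length + 4)) / 8)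

/-- Four padding cells follow the input, so that reading up to three places past a valid position
still yields the default `0` of `getD` and never an array entry. -/
theorem mem_of_lt {w : List ℕ} (S : NState) {a : ℕ} (h : a < w.length + 4) :
    S.mem w a = w.getD a 0 := if_pos h

/-- Writing to a register. -/
def set (S : NState) (x : Reg) (c : ℕ) : NState := ⟨Function.update S.reg x c, S.arr⟩

/-- Writing to an array. -/
def put (S : NState) (a : Arr) (i c : ℕ) : NState :=
  ⟨S.reg, Function.update S.arr a (Function.update (S.arr a) i c)⟩

@[simp] theorem set_arr (S : NState) (x : Reg) (c : ℕ) : (S.set x c).arr = S.arr := rfl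

@[simp] theorem put_reg (S : NState) (a : Arr) (i c : ℕ) : (S.put a i c).reg = S.reg := rfl

theorem set_reg (S : NState) (x y : Reg) (c : ℕ) :
    (S.set x c).reg y = if y = x then c else S.reg y := by
  simp [set, Function.update_apply]

theorem put_arr (S : NState) (a b : Arr) (i k c : ℕ) :
    (S.put a i c).arr b k = if b = a ∧ k = i then c else S.arr b k := by
  by_cases h : b = a
  · subst h; simp [put, Function.update_apply]
  · simp [put, Function.update_apply, h]

/-- The state `σ` of the random access machine represents `S`. -/
structure Rep (w : List ℕ) (S : NState) (σ : State) : Prop where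
  mem : σ.mem = S.mem w
  base : σ.reg 0 = w.length + 4
  reg : ∀ x : Reg, σ.reg x.index = S.reg x

theorem Rep.set {w : List ℕ} {S : NState} {σ : State} (h : Rep w S σ) (x : Reg) (c : ℕ) :
    Rep w (S.set x c) ⟨Function.update σ.reg x.index c, σ.mem⟩ := by
  refine ⟨h.mem, ?_, fun y => ?_⟩
  · simp [Function.update_apply, x.index_pos.ne, h.base]
  · simp [set_reg, Function.update_apply, Reg.index_inj, h.reg]

/-- Entry `i` of the array number `m` lies at offset `8 * i + m` with `m < 8`. Quotient and
remainder by `8` recover both, so no other entry changes, and the input lies below all these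
addresses. -/
theorem Rep.put {w : List ℕ} {S : NState} {σ : State} (h : Rep w S σ) (a : Arr) (i c : ℕ) :
    Rep w (S.put a i c)
      ⟨σ.reg, Function.update σ.mem (w.length + 4 + 8 * i + a.index) c⟩ := by
  refine ⟨?_, h.base, h.reg⟩
  have ha := a.index_lt
  funext k
  simp only [h.mem, Function.update_apply, NState.mem, put_arr]
  simp only [Arr.ofIndex_eq_iff a (Nat.mod_lt _ (show 8 > 0 by omega))]
  by_cases h1 : k < w.length + 4
  · rw [if_neg (by omega), if_pos h1, if_pos h1]
  · rw [if_neg h1, if_neg h1]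
    congr 1
    simp only [eq_iff_iff]
    omega

end NState

/-- Expressions over the named registers and arrays; `inp` reads the input word. -/
inductive NExpr
  | lit (c : ℕ)
  | reg (x : Reg)
  | add (e₁ e₂ : NExpr)
  | sub (e₁ e₂ : NExpr)
  | inp (e : NExpr)
  | arr (a : Arr) (e : NExpr)

namespace NExpr

/-- The value of an expression. -/
def eval (w : List ℕ) (S : NState) : NExpr → ℕ
  | lit c => c
  | reg x => S.reg x
  | add e₁ e₂ => e₁.eval w S + e₂.eval w S
  | sub e₁ e₂ => e₁.eval w S - e₂.eval w S
  | inp e => S.mem w (e.eval w S)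
  | arr a e => S.arr a (e.eval w S)

/-- The address of an array entry. -/
def address (a : Arr) (e : Expr) : Expr :=
  .add (.add (.reg 0) (.add (.add (.add e e) (.add e e)) (.add (.add e e) (.add e e))))
    (.lit a.index)

/-- Translation to expressions of the random access machine. -/
def compile : NExpr → Expr
  | lit c => .lit c
  | reg x => .reg x.index
  | add e₁ e₂ => .add e₁.compile e₂.compile
  | sub e₁ e₂ => .sub e₁.compile e₂.compile
  | inp e => .load e.compile
  | arr a e => .load (address a e.compile)

/-- The machine cannot multiply, so the factor `8` is a sum of eight copies of `e`. -/
theorem address_eval {w : List ℕ} {S : NState} {σ : State} (h : S.Rep w σ) (a : Arr) (e : Expr) :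
    (address a e).eval σ = w.length + 4 + 8 * e.eval σ + a.index := by
  simp only [address, Expr.eval, h.base]; omega

theorem compile_eval {w : List ℕ} {S : NState} {σ : State} (h : S.Rep w σ) (e : NExpr) :
    e.compile.eval σ = e.eval w S := by
  induction e with
  | lit c => rfl
  | reg x => exact h.reg x
  | add e₁ e₂ ih₁ ih₂ => simp [compile, Expr.eval, eval, ih₁, ih₂]
  | sub e₁ e₂ ih₁ ih₂ => simp [compile, Expr.eval, eval, ih₁, ih₂]
  | inp e ih => simp [compile, Expr.eval, eval, ih, h.mem]
  | arr a e ih =>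
    have ha := a.index_lt
    rw [compile, Expr.eval, address_eval h, ih, h.mem, NState.mem, if_neg (by omega), eval,
      show w.length + 4 + 8 * eval w S e + a.index - (w.length + 4) = 8 * eval w S e + a.index by
        omega, Nat.mul_add_mod, Nat.mod_eq_of_lt ha, Arr.ofIndex_index, Nat.mul_add_div (by omega),
      Nat.div_eq_of_lt ha, add_zero]

end NExpr

/-- A program family computing a primitive recursive function. -/
noncomputable def callProg (F : ℕ → ℕ) (hF : Nat.Primrec F) : ℕ → Prog :=
  (exists_computes hF).choose

/-- The running time of a call of a primitive recursive function. -/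
noncomputable def callCost (F : ℕ → ℕ) (hF : Nat.Primrec F) (n : ℕ) : ℕ :=
  (exists_computes hF).choose_spec.choose n + 20 * (n + 1)

theorem callCost_primrec (F : ℕ → ℕ) (hF : Nat.Primrec F) : Primrec (callCost F hF) :=
  Primrec.nat_add.comp (exists_computes hF).choose_spec.choose_spec.1
    (Primrec.nat_mul.comp (.const _) .succ)

/-- Loop-free programs over the named registers and arrays. The instruction `call F _ x e₁ e₂`
writes the value of the primitive recursive function `F` at the pair of the values of `e₁` and `e₂`
to the register `x`. -/
inductive NProg
  | skip
  | set (x : Reg) (e : NExpr)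
  | put (a : Arr) (e₁ e₂ : NExpr)
  | seq (p q : NProg)
  | ite (e : NExpr) (p q : NProg)
  | call (F : ℕ → ℕ) (hF : Nat.Primrec F) (x : Reg) (e₁ e₂ : NExpr)

namespace NProg

/-- The effect of a loop-free program. -/
def run (w : List ℕ) : NProg → NState → NState
  | skip, S => S
  | set x e, S => S.set x (e.eval w S)
  | put a e₁ e₂, S => S.put a (e₁.eval w S) (e₂.eval w S)
  | seq p q, S => q.run w (p.run w S)
  | ite e p q, S => if e.eval w S = 0 then q.run w S else p.run w S
  | call F _ x e₁ e₂, S => S.set x (F (Nat.pair (e₁.eval w S) (e₂.eval w S)))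

/-- The running time spent on calls. -/
noncomputable def dynCost (w : List ℕ) : NProg → NState → ℕ
  | skip, _ => 0
  | set _ _, _ => 0
  | put _ _ _, _ => 0
  | seq p q, S => p.dynCost w S + q.dynCost w (p.run w S)
  | ite e p q, S => if e.eval w S = 0 then q.dynCost w S else p.dynCost w S
  | call F hF _ e₁ e₂, S => callCost F hF (Nat.pair (e₁.eval w S) (e₂.eval w S))

/-- A bound for the running time that is not spent on calls. -/
def baseCost : NProg → ℕ
  | skip => 1
  | set _ e => 1 + e.compile.cost
  | put a e₁ e₂ => 1 + (NExpr.address a e₁.compile).cost + e₂.compile.cost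
  | seq p q => p.baseCost + q.baseCost
  | ite e p q => 1 + e.compile.cost + (p.baseCost + q.baseCost)
  | call _ _ _ e₁ e₂ => e₁.compile.cost + e₂.compile.cost + 4

/-- Translation to programs of the random access machine. -/
noncomputable def compile : NProg → Prog
  | skip => .skip
  | set x e => .assign x.index e.compile
  | put a e₁ e₂ => .store (NExpr.address a e₁.compile) e₂.compile
  | seq p q => .seq p.compile q.compile
  | ite e p q => .ite e.compile p.compile q.compile
  | call F hF x e₁ e₂ => .seq (.assign 40 e₁.compile) (.seq (.assign 41 e₂.compile)
      (.seq (pairProg 40) (.seq (callProg F hF 40) (.assign x.index (.reg 40)))))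

/-- A call works in the registers from `40` on. All named registers and the base address are below,
and `pairProg` and `callProg` keep what is below their starting register, so only the target of the
call changes. -/
theorem compile_runs {w : List ℕ} (p : NProg) {S : NState} {σ : State} (h : S.Rep w σ) :
    Runs p.compile σ (p.baseCost + p.dynCost w S) ((p.run w S).Rep w) := by
  induction p generalizing S σ with
  | skip => exact .skip h
  | set x e =>
    refine .assign ?_
    rw [NExpr.compile_eval h]
    exact h.set _ _
  | put a e₁ e₂ =>
    refine .store ?_
    rw [NExpr.address_eval h, NExpr.compile_eval h, NExpr.compile_eval h]
    exact h.put _ _ _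
  | seq p q ihp ihq =>
    exact (Runs.seq ((ihp h).mono le_rfl fun τ hτ => ihq hτ)).mono
      (by simp only [baseCost, dynCost]; omega) fun _ h => h
  | ite e p q ihp ihq =>
    have key : Runs (.ite e.compile p.compile q.compile) σ (1 + e.compile.cost +
        (p.baseCost + q.baseCost + (if e.eval w S = 0 then q.dynCost w S else p.dynCost w S)))
        (((NProg.ite e p q).run w S).Rep w) := by
      refine Runs.ite (fun h0 => ?_) (fun h0 => ?_)
      all_goals rw [NExpr.compile_eval h] at h0
      · rw [if_neg h0, run, if_neg h0]
        exact (ihp h).mono (by omega) fun _ h => h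
      · rw [if_pos h0, run, if_pos h0]
        exact (ihq h).mono (by omega) fun _ h => h
    exact key.mono (by simp only [baseCost, dynCost]; omega) fun _ h => h
  | call F hF x e₁ e₂ =>
    have hF' := (exists_computes hF).choose_spec.choose_spec.2
    have e41 : e₂.compile.eval ⟨Function.update σ.reg 40 (e₁.compile.eval σ), σ.mem⟩ =
        e₂.eval w S := by
      refine NExpr.compile_eval (σ := ⟨Function.update σ.reg 40 (e₁.compile.eval σ), σ.mem⟩)
        ⟨h.mem, ?_, fun x => ?_⟩ e₂
      · simp [Function.update_apply, h.base]
      · simp [Function.update_apply, x.index_lt.ne, h.reg]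
    rw [NExpr.compile_eval h] at e41
    refine (Runs.seq (.assign (.seq (.assign (.seq ((pairProg_runs 40 _).mono (t₂ := 20 *
      (Nat.pair (e₁.eval w S) (e₂.eval w S) + 1)) ?_ fun τ hτ => .seq
      ((hF' 40 τ).mono (t₂ := (exists_computes hF).choose_spec.choose
        (Nat.pair (e₁.eval w S) (e₂.eval w S))) ?_ fun υ hυ => .assign ?_))))))).mono ?_
      fun _ h => h
    · simp only [NExpr.compile_eval h, e41]
      simp [Function.update_apply]
    rotate_left 2
    · simp only [baseCost, dynCost, callCost, Expr.cost]; omega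
    all_goals simp only [NExpr.compile_eval h, e41] at hτ
    all_goals simp [Function.update_apply] at hτ
    all_goals obtain ⟨h1, h2, h3⟩ := hτ
    · simp [h2]
    · obtain ⟨g1, g2, g3⟩ := hυ
      have hυ : S.Rep w υ := by
        refine ⟨by rw [g1, h1, h.mem], ?_, fun y => ?_⟩
        · rw [g3 0 (by omega), h3 0 (by omega)]; simp [h.base]
        · have hy := y.index_lt
          rw [g3 _ hy, h3 _ hy]
          simp [show y.index ≠ 40 by omega, show y.index ≠ 41 by omega, h.reg]
      simpa [run, Expr.eval, g2, h2] using hυ.set x (F (Nat.pair (e₁.eval w S) (e₂.eval w S)))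

/-- Loops over loop-free programs, with a measure for the number of repetitions. -/
theorem loop_runs {w : List ℕ} {e : NExpr} {p : NProg} (I : NState → Prop) (μ : NState → ℕ)
    (D : ℕ) (h : ∀ S, I S → e.eval w S ≠ 0 →
      I (p.run w S) ∧ μ (p.run w S) < μ S ∧ p.dynCost w S ≤ D)
    {S : NState} {σ : State} (hS : S.Rep w σ) (hI : I S) :
    Runs (.loop e.compile p.compile) σ
      (μ S * (p.baseCost + D + 1 + e.compile.cost) + 1 + e.compile.cost)
      fun τ => ∃ S' : NState, S'.Rep w τ ∧ I S' ∧ e.eval w S' = 0 := by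
  induction hm : μ S using Nat.strong_induction_on generalizing S σ with
  | _ m ih =>
    by_cases h0 : e.compile.eval σ = 0
    · exact ⟨_, _, .loop_false h0, by omega, S, hS, hI, by rwa [NExpr.compile_eval hS] at h0⟩
    · obtain ⟨h1, h2, h3⟩ := h S hI (by rwa [NExpr.compile_eval hS] at h0)
      obtain ⟨a, τ, g, ha, hτ⟩ := p.compile_runs hS
      obtain ⟨b, υ, g', hb, hq⟩ := ih _ (hm ▸ h2) hτ h1 rfl
      refine ⟨_, _, .loop_true h0 g g', ?_, hq⟩
      have := Nat.mul_le_mul_right (p.baseCost + D + 1 + e.compile.cost) (hm ▸ h2)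
      rw [Nat.succ_mul] at this
      omega

end NProg

end RAM

/-! ## Relativized satisfaction, and removal of redundant parts -/

namespace FOFormula

/-- Satisfaction in the substructure with domain `A` of the structure given by the relation `E`. -/
def SatOn {V : Type*} (A : Set V) (E : V → V → Prop) : FOFormula → (ℕ → Option V) → Prop
  | tru, _ => True
  | fls, _ => False
  | eq x y, a => ∃ v, a x = some v ∧ a y = some v
  | adj x y, a => ∃ u v, a x = some u ∧ a y = some v ∧ E u v
  | neg φ, a => ¬ φ.SatOn A E a
  | and φ ψ, a => φ.SatOn A E a ∧ ψ.SatOn A E a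
  | or φ ψ, a => φ.SatOn A E a ∨ ψ.SatOn A E a
  | imp φ ψ, a => φ.SatOn A E a → ψ.SatOn A E a
  | iff φ ψ, a => (φ.SatOn A E a ↔ ψ.SatOn A E a)
  | ex x φ, a => ∃ v ∈ A, φ.SatOn A E (Function.update a x (some v))
  | all x φ, a => ∀ v ∈ A, φ.SatOn A E (Function.update a x (some v))

theorem satOn_univ {V : Type*} (G : SimpleGraph V) (φ : FOFormula) (a : ℕ → Option V) :
    φ.SatOn Set.univ G.Adj a ↔ φ.Sat G a := by
  induction φ generalizing a <;> simp_all [SatOn, Sat]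

/-- Satisfaction is invariant under isomorphism, where an isomorphism is given by its graph. -/
theorem satOn_iff_of_rel {V W : Type*} {A : Set V} {B : Set W} {E : V → V → Prop}
    {E' : W → W → Prop} (r : V → W → Prop) (h₁ : ∀ x ∈ A, ∃ y ∈ B, r x y)
    (h₂ : ∀ y ∈ B, ∃ x ∈ A, r x y)
    (h₃ : ∀ x y x' y', r x y → r x' y' → ((x = x' ↔ y = y') ∧ (E x x' ↔ E' y y')))
    (φ : FOFormula) (a : ℕ → Option V) (b : ℕ → Option W)
    (hab : ∀ z ∈ φ.vars, Option.Rel r (a z) (b z)) : φ.SatOn A E a ↔ φ.SatOn B E' b := by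
  have hup : ∀ (x : ℕ) (φ : FOFormula) (a : ℕ → Option V) (b : ℕ → Option W) (v : V) (w : W),
      (∀ z ∈ insert x φ.vars, Option.Rel r (a z) (b z)) → r v w → ∀ z ∈ φ.vars,
        Option.Rel r (Function.update a x (some v) z) (Function.update b x (some w) z) := by
    intro x φ a b v w h hr z hz
    by_cases hzx : z = x
    · subst hzx; simpa using hr
    · simpa [hzx] using h z (Finset.mem_insert_of_mem hz)
  induction φ generalizing a b with
  | tru => rfl
  | fls => rfl
  | eq x y =>
    have hx := hab x (by simp [vars])
    have hy := hab y (by simp [vars])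
    simp only [SatOn]
    rcases hx' : a x with _ | u <;> rcases hx'' : b x with _ | u' <;>
      rcases hy' : a y with _ | v <;> rcases hy'' : b y with _ | v' <;>
      simp_all [eq_comm]
    have := (h₃ _ _ _ _ hx hy).1
    simpa [eq_comm] using this
  | adj x y =>
    have hx := hab x (by simp [vars])
    have hy := hab y (by simp [vars])
    simp only [SatOn]
    rcases hx' : a x with _ | u <;> rcases hx'' : b x with _ | u' <;>
      rcases hy' : a y with _ | v <;> rcases hy'' : b y with _ | v' <;>
      simp_all
    exact (h₃ _ _ _ _ hx hy).2
  | neg φ ih => exact not_congr (ih a b hab)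
  | and φ ψ ih ih' =>
    exact and_congr (ih a b fun z hz => hab z (Finset.mem_union_left _ hz))
      (ih' a b fun z hz => hab z (Finset.mem_union_right _ hz))
  | or φ ψ ih ih' =>
    exact or_congr (ih a b fun z hz => hab z (Finset.mem_union_left _ hz))
      (ih' a b fun z hz => hab z (Finset.mem_union_right _ hz))
  | imp φ ψ ih ih' =>
    exact imp_congr (ih a b fun z hz => hab z (Finset.mem_union_left _ hz))
      (ih' a b fun z hz => hab z (Finset.mem_union_right _ hz))
  | iff φ ψ ih ih' =>
    exact iff_congr (ih a b fun z hz => hab z (Finset.mem_union_left _ hz))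
      (ih' a b fun z hz => hab z (Finset.mem_union_right _ hz))
  | ex x φ ih =>
    constructor
    · rintro ⟨v, hv, h⟩
      obtain ⟨w, hw, hr⟩ := h₁ v hv
      exact ⟨w, hw, (ih _ _ (hup x φ a b v w hab hr)).1 h⟩
    · rintro ⟨w, hw, h⟩
      obtain ⟨v, hv, hr⟩ := h₂ w hw
      exact ⟨v, hv, (ih _ _ (hup x φ a b v w hab hr)).2 h⟩
  | all x φ ih =>
    constructor
    · intro h w hw
      obtain ⟨v, hv, hr⟩ := h₂ w hw
      exact (ih _ _ (hup x φ a b v w hab hr)).1 (h v hv)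
    · intro h v hv
      obtain ⟨w, hw, hr⟩ := h₁ v hv
      exact (ih _ _ (hup x φ a b v w hab hr)).2 (h w hw)

/-- If every element of `U` can be moved out of `U` by an automorphism that fixes fewer than `s`
given elements outside of `U`, then removing `U` does not change the truth of formulas with at most
`s` variables. -/
theorem satOn_diff_iff {V : Type*} {A U : Set V} {E : V → V → Prop} {s : ℕ}
    (h : ∀ F : Finset V, F.card < s → (∀ x ∈ F, x ∈ A \ U) → ∀ v ∈ U, v ∈ A → ∃ r : V → V → Prop,
      (∀ x ∈ A, ∃ y ∈ A, r x y) ∧ (∀ y ∈ A, ∃ x ∈ A, r x y) ∧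
      (∀ x y x' y', r x y → r x' y' → ((x = x' ↔ y = y') ∧ (E x x' ↔ E y y'))) ∧
      (∀ x ∈ F, r x x) ∧ ∃ y ∈ A \ U, r v y)
    (X : Finset ℕ) (hX : X.card ≤ s) (φ : FOFormula) (hφ : φ.vars ⊆ X) (a : ℕ → Option V)
    (ha : ∀ z ∈ X, ∀ v, a z = some v → v ∈ A \ U) :
    φ.SatOn A E a ↔ φ.SatOn (A \ U) E a := by
  classical
  have hup : ∀ (x : ℕ) (a : ℕ → Option V) (w : V), w ∈ A \ U →
      (∀ z ∈ X, ∀ v, a z = some v → v ∈ A \ U) →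
      ∀ z ∈ X, ∀ v, Function.update a x (some w) z = some v → v ∈ A \ U := by
    intro x a w hw ha z hz v hv
    by_cases hzx : z = x
    · subst hzx; simp at hv; exact hv ▸ hw
    · exact ha z hz v (by simpa [hzx] using hv)
  -- The old value of `x` is overwritten, so only the values of the names in `X.erase x` must be
  -- fixed. There are fewer than `s` of these, and the automorphism carries the new value out of `U`
  -- without changing the truth of `φ`.
  have hmove : ∀ (x : ℕ) (φ : FOFormula), x ∈ X → φ.vars ⊆ X → ∀ a : ℕ → Option V,
      (∀ z ∈ X, ∀ v, a z = some v → v ∈ A \ U) → ∀ v ∈ A, ∃ w ∈ A \ U,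
        (φ.SatOn A E (Function.update a x (some v)) ↔
          φ.SatOn A E (Function.update a x (some w))) := by
    intro x φ hx hφ a ha v hv
    by_cases hvU : v ∈ U
    · have hcard : ((X.erase x).biUnion fun z => (a z).toFinset).card < s := by
        refine lt_of_le_of_lt (Finset.card_biUnion_le_card_mul _ _ 1 fun z _ => ?_) ?_
        · cases a z <;> simp
        · have := Finset.card_erase_lt_of_mem hx; omega
      obtain ⟨r, h₁, h₂, h₃, h₄, w, hw, h₅⟩ := h _ hcard (fun y hy => by
        simp only [Finset.mem_biUnion, Finset.mem_erase, Option.mem_toFinset, Option.mem_def] at hy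
        obtain ⟨z, hz, hy⟩ := hy
        exact ha z hz.2 y hy) v hvU hv
      refine ⟨w, hw, satOn_iff_of_rel r h₁ h₂ h₃ φ _ _ fun z hz => ?_⟩
      by_cases hzx : z = x
      · subst hzx; simpa using h₅
      · rw [Function.update_of_ne hzx, Function.update_of_ne hzx]
        rcases haz : a z with _ | y
        · exact .none
        · refine .some (h₄ y ?_)
          simp only [Finset.mem_biUnion, Finset.mem_erase, Option.mem_toFinset, Option.mem_def]
          exact ⟨z, ⟨hzx, hφ hz⟩, haz⟩
    · exact ⟨v, ⟨hv, hvU⟩, Iff.rfl⟩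
  induction φ generalizing a with
  | tru => rfl
  | fls => rfl
  | eq x y => rfl
  | adj x y => rfl
  | neg φ ih => exact not_congr (ih hφ a ha)
  | and φ ψ ih ih' =>
    exact and_congr (ih (Finset.union_subset_left hφ) a ha) (ih' (Finset.union_subset_right hφ) a ha)
  | or φ ψ ih ih' =>
    exact or_congr (ih (Finset.union_subset_left hφ) a ha) (ih' (Finset.union_subset_right hφ) a ha)
  | imp φ ψ ih ih' =>
    exact imp_congr (ih (Finset.union_subset_left hφ) a ha) (ih' (Finset.union_subset_right hφ) a ha)
  | iff φ ψ ih ih' =>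
    exact iff_congr (ih (Finset.union_subset_left hφ) a ha) (ih' (Finset.union_subset_right hφ) a ha)
  | ex x φ ih =>
    have hx : x ∈ X := hφ (Finset.mem_insert_self _ _)
    have hφ' : φ.vars ⊆ X := (Finset.subset_insert _ _).trans hφ
    constructor
    · rintro ⟨v, hv, hs⟩
      obtain ⟨w, hw, hvw⟩ := hmove x φ hx hφ' a ha v hv
      exact ⟨w, hw, (ih hφ' _ (hup x a w hw ha)).1 (hvw.1 hs)⟩
    · rintro ⟨w, hw, hs⟩
      exact ⟨w, hw.1, (ih hφ' _ (hup x a w hw ha)).2 hs⟩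
  | all x φ ih =>
    have hx : x ∈ X := hφ (Finset.mem_insert_self _ _)
    have hφ' : φ.vars ⊆ X := (Finset.subset_insert _ _).trans hφ
    constructor
    · intro hs w hw
      exact (ih hφ' _ (hup x a w hw ha)).1 (hs w hw.1)
    · intro hs v hv
      obtain ⟨w, hw, hvw⟩ := hmove x φ hx hφ' a ha v hv
      exact hvw.2 ((ih hφ' _ (hup x a w hw ha)).2 (hs w hw))

end FOFormula

/-! ## Paths and edges in graphs of bounded tree-depth -/

namespace RootedForest

variable {V : Type*} (T : RootedForest V)

/-- Parents are unique, so the ancestors of `w` form a chain. -/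
theorem Anc.total {T : RootedForest V} {u v w : V} (h : T.Anc u w) (h' : T.Anc v w) :
    T.Anc u v ∨ T.Anc v u := by
  have h := Relation.reflTransGen_swap.2 h
  have h' := Relation.reflTransGen_swap.2 h'
  refine (Relation.ReflTransGen.total_of_right_unique ?_ h h').symm.imp
    Relation.reflTransGen_swap.1 Relation.reflTransGen_swap.1
  intro a b c hb hc
  simpa [Function.swap] using (show some b = some c from hb.symm.trans hc)

theorem Anc.antisymm {T : RootedForest V} {u v : V} (h : T.Anc u v) (h' : T.Anc v u) : u = v := by
  by_contra hne
  have h1 : Relation.TransGen (fun u v : V => T.parent v = some u) u v :=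
    (Relation.reflTransGen_iff_eq_or_transGen.1 h).resolve_left (fun e => hne e.symm)
  have h2 : Relation.TransGen (fun u v : V => T.parent v = some u) u u := h1.trans_left h'
  exact T.wf.transGen.irrefl.irrefl _ h2

theorem Anc.level_lt [Finite V] {T : RootedForest V} {u v : V} (h : T.Anc u v) (hne : u ≠ v) :
    T.level u < T.level v := by
  refine Set.ncard_lt_ncard ⟨fun w (hw : T.Anc w u) => hw.trans h, fun hs => hne ?_⟩
  exact h.antisymm (hs (show T.Anc v v from Relation.ReflTransGen.refl))

theorem level_pos [Finite V] (v : V) : 0 < T.level v :=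
  (Set.ncard_pos (Set.toFinite _)).2 ⟨v, Relation.ReflTransGen.refl⟩

theorem level_le_height [Fintype V] (v : V) : T.level v ≤ T.height :=
  Finset.le_sup (f := T.level) (Finset.mem_univ v)

/-- A path cannot leave the subtree of `r` without visiting a level above that of `r`: the next
vertex is comparable with the current one, hence with `r`, and a proper ancestor of `r` would have a
smaller level. -/
theorem IsElimination.anc_of_isChain [Finite V] {T : RootedForest V} {G : SimpleGraph V}
    (hT : T.IsElimination G) {r : V} (l : List V) : ∀ y, T.Anc r y → List.IsChain G.Adj (y :: l) →
    (∀ x ∈ l, T.level r ≤ T.level x) → ∀ x ∈ l, T.Anc r x := by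
  induction l with
  | nil => simp
  | cons z l ih =>
    intro y hy hc hl
    rw [List.isChain_cons_cons] at hc
    have hz : T.Anc r z := by
      rcases hT y z hc.1 with h | h
      · exact hy.trans h
      · rcases hy.total h with h' | h'
        · exact h'
        · by_cases e : z = r
          · exact e ▸ Relation.ReflTransGen.refl
          · have := h'.level_lt e
            have := hl z (by simp)
            omega
    intro x hx
    rcases List.mem_cons.1 hx with rfl | hx
    · exact hz
    · exact ih z hz hc.2 (fun x hx => hl x (List.mem_cons_of_mem _ hx)) x hx

/-- Induction on the number `j` of available levels. If the path meets the topmost of them in `r`,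
then by `anc_of_isChain` both parts of the path stay strictly below `r`, so each has fewer than `2 ^
j` vertices. -/
theorem IsElimination.length_lt_two_pow [Fintype V] {T : RootedForest V} {G : SimpleGraph V}
    (hT : T.IsElimination G) (j : ℕ) : ∀ l : List V, l.Nodup → List.IsChain G.Adj l →
    (∀ x ∈ l, T.height < T.level x + j) → l.length < 2 ^ j := by
  induction j with
  | zero =>
    intro l _ _ h
    rcases l with _ | ⟨x, l⟩
    · simp
    · have := h x (by simp)
      have := T.level_le_height x
      omega
  | succ j ih =>
    intro l hn hc hl
    by_cases hr : ∃ r ∈ l, T.level r + j = T.height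
    · obtain ⟨r, hr, hlev⟩ := hr
      obtain ⟨l₁, l₂, rfl⟩ := List.append_of_mem hr
      have hge : ∀ x ∈ l₁ ++ r :: l₂, T.level r ≤ T.level x := fun x hx => by
        have := hl x hx; omega
      have hc₂ : List.IsChain G.Adj (r :: l₂) := hc.right_of_append
      have hc₁ : List.IsChain G.Adj (r :: l₁.reverse) := by
        have := (List.isChain_reverse.2 (hc.imp fun a b (h : G.Adj a b) => h.symm) :
          List.IsChain G.Adj (l₁ ++ r :: l₂).reverse)
        rw [List.reverse_append, List.reverse_cons, List.append_assoc] at this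
        exact this.right_of_append
      rw [List.nodup_append] at hn
      obtain ⟨hn₁, hn₂, hn₃⟩ := hn
      rw [List.nodup_cons] at hn₂
      have k₁ := ih l₁ hn₁ hc.left_of_append fun x hx => by
        have := (hT.anc_of_isChain _ r .refl hc₁ (fun x hx => hge x (by simp_all)) x
          (by simpa using hx)).level_lt (hn₃ x hx r (by simp)).symm
        omega
      have k₂ := ih l₂ hn₂.2 hc₂.tail fun x hx => by
        have := (hT.anc_of_isChain _ r .refl hc₂ (fun x hx => hge x (by simp_all)) x
          hx).level_lt (fun e => hn₂.1 (e ▸ hx))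
        omega
      rw [List.length_append, List.length_cons, pow_succ]
      omega
    · push Not at hr
      have := ih l hn hc fun x hx => by
        have := hl x hx
        have := hr x hx
        omega
      rw [pow_succ]
      omega

end RootedForest

namespace SimpleGraph

/-- A finite graph has an elimination forest whose height is the tree-depth. -/
theorem exists_isElimination {n : ℕ} (G : SimpleGraph (Fin n)) :
    ∃ T : RootedForest (Fin n), T.IsElimination G ∧ T.height = G.treeDepth := by
  have hlt : ∀ u v : Fin n, (if h : v.1 = 0 then none else some (⟨v.1 - 1, by omega⟩ : Fin n)) =
      some u ↔ u.1 + 1 = v.1 := by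
    intro u v
    split_ifs with h
    · simp; omega
    · simp [Fin.ext_iff]; omega
  -- The forest that is the single path `0, 1, …` is an elimination forest of every graph; it shows
  -- that the set of heights is nonempty, so that its infimum is attained.
  let T : RootedForest (Fin n) :=
    ⟨fun v => if h : v.1 = 0 then none else some ⟨v.1 - 1, by omega⟩, by
      refine Subrelation.wf (r := fun u v : Fin n => u < v) (fun {u v} h => ?_) wellFounded_lt
      have := (hlt u v).1 h
      show u < v
      rw [Fin.lt_def]; omega⟩
  have hanc : ∀ d (u v : Fin n), u.1 + d = v.1 → T.Anc u v := by
    intro d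
    induction d with
    | zero => intro u v h; rw [show u = v from Fin.ext (by omega)]; exact .refl
    | succ d ih =>
      intro u v h
      exact (ih u ⟨v.1 - 1, by omega⟩ (by simp; omega)).tail ((hlt _ _).2 (by simp; omega))
  refine Nat.sInf_mem (s := {h | ∃ T : RootedForest (Fin n), T.IsElimination G ∧ T.height = h})
    ⟨_, T, fun u v _ => ?_, rfl⟩
  rcases le_total u.1 v.1 with h | h
  · exact .inl (hanc (v.1 - u.1) u v (by omega))
  · exact .inr (hanc (u.1 - v.1) v u (by omega))

/-- Paths in a graph of tree-depth `k` have fewer than `2 ^ k` vertices. -/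
theorem length_lt_two_pow_treeDepth {n : ℕ} (G : SimpleGraph (Fin n)) {l : List (Fin n)}
    (hn : l.Nodup) (hc : List.IsChain G.Adj l) : l.length < 2 ^ G.treeDepth := by
  obtain ⟨T, hT, hh⟩ := G.exists_isElimination
  refine hT.length_lt_two_pow _ l hn hc fun x _ => ?_
  have := T.level_pos x
  omega

/-- A graph with `n` vertices and tree-depth `k` has at most `n * k` edges. -/
theorem sum_length_le_treeDepth {n : ℕ} (G : SimpleGraph (Fin n)) {N : Fin n → List (Fin n)}
    (hN : IsAdjacencyLists G N) : ∑ u, (N u).length ≤ 2 * (n * G.treeDepth) := by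
  classical
  obtain ⟨T, hT, hh⟩ := G.exists_isElimination
  have hlev : ∀ u, (Finset.univ.filter fun v => T.Anc v u).card ≤ G.treeDepth := by
    intro u
    rw [← hh, ← Set.ncard_coe_finset]
    simpa [RootedForest.level] using T.level_le_height u
  have hu : ∀ u, (N u).length ≤ (Finset.univ.filter fun v => T.Anc v u).card +
      (Finset.univ.filter fun v => T.Anc u v).card := by
    intro u
    rw [← List.toFinset_card_of_nodup (hN u).1]
    refine (Finset.card_le_card fun v hv => ?_).trans (Finset.card_union_le _ _)
    have := hT u v (((hN u).2 v).1 (List.mem_toFinset.1 hv))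
    simpa [or_comm] using this
  -- A vertex can have many descendants, but counting pairs from the other end replaces them by
  -- ancestors, of which each vertex has at most `k`.
  have hswap : ∑ u, (Finset.univ.filter fun v => T.Anc u v).card =
      ∑ u, (Finset.univ.filter fun v => T.Anc v u).card := by
    simp only [Finset.card_filter]
    exact Finset.sum_comm
  calc ∑ u, (N u).length
      ≤ ∑ u, ((Finset.univ.filter fun v => T.Anc v u).card +
        (Finset.univ.filter fun v => T.Anc u v).card) := Finset.sum_le_sum fun u _ => hu u
    _ = 2 * ∑ u, (Finset.univ.filter fun v => T.Anc v u).card := by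
        rw [Finset.sum_add_distrib, hswap, two_mul]
    _ ≤ 2 * (n * G.treeDepth) := by
        refine Nat.mul_le_mul_left _ ((Finset.sum_le_sum fun u _ => hlev u).trans ?_)
        simp

end SimpleGraph

/-! ## The automaton that computes a reduced graph from a depth-first search -/

/-- The level of a vertex in a forest, and the levels of the ancestors adjacent to it. -/
abbrev Row := ℕ × List ℕ

/-- The rows of the vertices of a tree or forest, in preorder. -/
abbrev Block := List Row

/-- The levels of the ancestors adjacent to the current vertex, and the trees at its children. -/
abbrev Frame := List ℕ × List Block

namespace Frame

/-- The tree described by the frame of a vertex at level `d`. -/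
def block (d : ℕ) (f : Frame) : Block := (d, f.1) :: f.2.flatten

/-- Adds a level to the levels of the adjacent ancestors. -/
def addLevel (l : ℕ) (f : Frame) : Frame := (if l ∈ f.1 then f.1 else l :: f.1, f.2)

/-- Adds a tree to the trees at the children, unless it is there `s` times. -/
def addBlock (s : ℕ) (b : Block) (f : Frame) : Frame :=
  (f.1, if f.2.count b < s then b :: f.2 else f.2)

end Frame

/-- The step of the automaton. The event `0` is void, `1` opens a vertex, `2` closes the current
vertex, and `l + 3` is an edge from the current vertex to its ancestor at level `l`. -/
def autoStep (s : ℕ) : ℕ → List Frame → List Frame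
  | 0, Z => Z
  | 1, Z => ([], []) :: Z
  | 2, f :: g :: Z => g.addBlock s (f.block Z.length) :: Z
  | 2, Z => Z
  | l + 3, f :: Z => f.addLevel l :: Z
  | _ + 3, [] => []

/-! ### The automaton is primitive recursive -/

section Primrec

open Primrec

theorem Primrec.list_count {α : Type*} [Primcodable α] [BEq α] [LawfulBEq α] :
    Primrec₂ fun (a : α) (l : List α) => l.count a := by
  classical
  refine (list_length.comp ((PrimrecRel.listFilter (R := fun (b a : α) => b = a)
    Primrec.eq).comp .snd .fst)).of_eq fun p => ?_
  show _ = p.2.count p.1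
  rw [List.count_eq_countP, List.countP_eq_length_filter]
  congr 2
  funext x
  by_cases h : x = p.1 <;> simp [h]

theorem Frame.primrec_block : Primrec₂ Frame.block :=
  list_cons.comp (Primrec.pair .fst (fst.comp .snd)) (list_flatten.comp (snd.comp .snd))

theorem Frame.primrec_addLevel : Primrec₂ Frame.addLevel := by
  refine Primrec.pair (Primrec.ite ?_ (fst.comp .snd) (list_cons.comp .fst (fst.comp .snd)))
    (snd.comp .snd)
  have : PrimrecRel fun (L : List ℕ) b => ∃ a ∈ L, a = b :=
    PrimrecRel.exists_mem_list Primrec.eq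
  exact (this.comp (fst.comp .snd) .fst).of_eq fun p => by simp

theorem Frame.primrec_addBlock :
    Primrec fun p : (ℕ × Block) × Frame => Frame.addBlock p.1.1 p.1.2 p.2 := by
  refine Primrec.pair (fst.comp .snd) (Primrec.ite ?_
    (list_cons.comp (snd.comp .fst) (snd.comp .snd)) (snd.comp .snd))
  exact nat_lt.comp (list_count.comp (snd.comp .fst) (snd.comp .snd)) (fst.comp .fst)

theorem primrec_autoStep_close : Primrec₂ fun s Z => autoStep s 2 Z := by
  have h₁ : Primrec fun p : (ℕ × List Frame) × (Frame × List Frame) × (Frame × List Frame) =>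
      p.2.2.1.addBlock p.1.1 (p.2.1.1.block p.2.2.2.length) :: p.2.2.2 :=
    list_cons.comp (Frame.primrec_addBlock.comp (Primrec.pair (Primrec.pair (fst.comp .fst)
      (Frame.primrec_block.comp (list_length.comp (snd.comp (snd.comp .snd)))
        (fst.comp (fst.comp .snd)))) (fst.comp (snd.comp .snd)))) (snd.comp (snd.comp .snd))
  have h₂ : Primrec fun p : (ℕ × List Frame) × (Frame × List Frame) =>
      (p.2.2.casesOn p.1.2 fun g Y => g.addBlock p.1.1 (p.2.1.block Y.length) :: Y : List Frame) :=
    list_casesOn (h := fun (p : (ℕ × List Frame) × (Frame × List Frame)) (q : Frame × List Frame) =>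
      q.1.addBlock p.1.1 (p.2.1.block q.2.length) :: q.2)
      (snd.comp .snd) (snd.comp .fst)
      (h₁.comp (Primrec.pair (fst.comp .fst) (Primrec.pair (snd.comp .fst) .snd)))
  let k : ℕ × List Frame → Frame × List Frame → List Frame := fun p q =>
    q.2.casesOn p.2 fun g Y => g.addBlock p.1 (q.1.block Y.length) :: Y
  have hk : Primrec₂ k := h₂
  refine (list_casesOn (h := k) .snd (.const []) hk).of_eq ?_
  rintro ⟨s, _ | ⟨f, _ | ⟨g, Z⟩⟩⟩ <;> rfl

theorem primrec_autoStep_back : Primrec₂ fun l Z => autoStep 0 (l + 3) Z := by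
  refine (list_casesOn (h := fun (p : ℕ × List Frame) q => q.1.addLevel p.1 :: q.2) .snd
    (.const []) (list_cons.comp (Frame.primrec_addLevel.comp (fst.comp .fst) (fst.comp .snd))
      (snd.comp .snd))).of_eq ?_
  rintro ⟨l, _ | ⟨f, Z⟩⟩ <;> rfl

/-- The case distinction is on the event. Events from `3` on do not involve `s`, so `0` is put in
its place, and there `e - 3 + 3` is `e`. -/
theorem primrec_autoStep : Primrec fun p : (ℕ × ℕ) × List Frame => autoStep p.1.1 p.1.2 p.2 := by
  have hb : Primrec fun p : ((ℕ × ℕ) × List Frame) => autoStep 0 (p.1.2 - 3 + 3) p.2 :=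
    primrec_autoStep_back.comp (nat_sub.comp (snd.comp .fst) (.const 3)) .snd
  have hc : Primrec fun p : ((ℕ × ℕ) × List Frame) => autoStep p.1.1 2 p.2 :=
    primrec_autoStep_close.comp (fst.comp .fst) .snd
  have he : ∀ m, PrimrecPred fun p : ((ℕ × ℕ) × List Frame) => p.1.2 = m := fun m =>
    Primrec.eq.comp (snd.comp .fst) (.const m)
  refine (Primrec.ite (he 0) .snd (Primrec.ite (he 1) (list_cons.comp (.const ([], [])) .snd)
    (Primrec.ite (he 2) hc hb))).of_eq ?_
  rintro ⟨⟨s, _ | _ | _ | e⟩, _ | ⟨f, Z⟩⟩ <;> simp [autoStep]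

end Primrec

/-! ### Bounds -/

/-- A bound for the codes of lists of length `m` whose elements have codes of size at most `c`. -/
def listBound (m c : ℕ) : ℕ := m.rec 0 fun _ x => Nat.succ (Nat.pair c x)

theorem primrec_listBound : Primrec₂ listBound :=
  Primrec.nat_rec' (f := fun p : ℕ × ℕ => p.1) (h := fun p q => Nat.succ (Nat.pair p.2 q.2))
    .fst (.const 0) (Primrec.succ.comp
      (Primrec₂.natPair.comp (Primrec.snd.comp .fst) (Primrec.snd.comp .snd)))

theorem Nat.pair_mono {a b c d : ℕ} (h : a ≤ b) (h' : c ≤ d) : Nat.pair a c ≤ Nat.pair b d := by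
  refine le_trans (b := Nat.pair b c) ?_ ?_
  · rcases h.eq_or_lt with rfl | h
    · rfl
    · exact (Nat.pair_lt_pair_left c h).le
  · rcases h'.eq_or_lt with rfl | h
    · rfl
    · exact (Nat.pair_lt_pair_right b h).le

theorem listBound_mono {m n c d : ℕ} (h : m ≤ n) (h' : c ≤ d) : listBound m c ≤ listBound n d := by
  induction h with
  | refl =>
    induction m with
    | zero => rfl
    | succ m ih => exact Nat.succ_le_succ (Nat.pair_mono h' ih)
  | step h ih =>
    exact ih.trans ((Nat.right_le_pair _ _).trans (Nat.le_succ _))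

-- `listBound` iterates the clause for the code of a nonempty list, and that clause is monotone
-- because `Nat.pair` is.
open Encodable in
theorem encode_le_listBound {α : Type*} [Encodable α] {l : List α} {m c : ℕ} (hm : l.length ≤ m)
    (h : ∀ x ∈ l, encode x ≤ c) : encode l ≤ listBound m c := by
  induction l generalizing m with
  | nil => simp
  | cons a l ih =>
    obtain ⟨m, rfl⟩ : ∃ k, m = k + 1 := ⟨m - 1, by simp at hm; omega⟩
    rw [encode_list_cons]
    exact Nat.succ_le_succ (Nat.pair_mono (h a (by simp))
      (ih (by simpa using hm) fun x hx => h x (by simp [hx])))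

-- Only `c + 1` different codes are available, and each element is repeated at most `s` times.
open Encodable in
theorem length_le_of_count_le {α : Type*} [Encodable α] [BEq α] [LawfulBEq α]
    {l : List α} {s c : ℕ}
    (hs : ∀ x, l.count x ≤ s) (h : ∀ x ∈ l, encode x ≤ c) : l.length ≤ s * (c + 1) := by
  classical
  rw [← List.sum_toFinset_count_eq_length]
  refine (Finset.sum_le_card_nsmul _ _ s fun x _ => ?_).trans ?_
  · refine le_of_eq_of_le ?_ (hs x)
    congr 1
    exact lawful_beq_subsingleton _ _
  rw [smul_eq_mul, mul_comm]
  refine Nat.mul_le_mul_left _ ?_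
  rw [← Finset.card_range (c + 1)]
  exact Finset.card_le_card_of_injOn encode (fun x hx => by
    have := h x (by simpa using hx)
    simp; omega) fun x _ y _ e => encode_injective e

namespace Block

/-- A bound for the codes of rows. -/
def rowBound (h : ℕ) : ℕ := Nat.pair h (listBound h h)

/-- A bound for the number of vertices of reduced trees of height `j`. -/
def lengthBound (s h j : ℕ) : ℕ :=
  j.rec 0 fun _ x => x + (1 + s * (listBound x (rowBound h) + 1) * x)

/-- A bound for the codes of reduced trees. -/
def codeBound (s h : ℕ) : ℕ := listBound (lengthBound s h h) (rowBound h)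

/-- A bound for the codes of the states of the automaton. -/
def autoBound (s h : ℕ) : ℕ := listBound (h + 1) (Nat.pair (listBound h h)
  (listBound (s * (codeBound s h + 1)) (codeBound s h)))

theorem primrec_rowBound : Primrec rowBound :=
  Primrec₂.natPair.comp .id (primrec_listBound.comp .id .id)

theorem primrec_lengthBound : Primrec fun p : (ℕ × ℕ) × ℕ => lengthBound p.1.1 p.1.2 p.2 := by
  refine Primrec.nat_rec' (f := fun p : (ℕ × ℕ) × ℕ => p.2) (h := fun p q => q.2 + (1 + p.1.1 *
    (listBound q.2 (rowBound p.1.2) + 1) * q.2)) .snd (.const 0) ?_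
  have x := Primrec.snd.comp (Primrec.snd (α := (ℕ × ℕ) × ℕ) (β := ℕ × ℕ))
  have s := Primrec.fst.comp (Primrec.fst.comp (Primrec.fst (α := (ℕ × ℕ) × ℕ) (β := ℕ × ℕ)))
  have h := Primrec.snd.comp (Primrec.fst.comp (Primrec.fst (α := (ℕ × ℕ) × ℕ) (β := ℕ × ℕ)))
  exact Primrec.nat_add.comp x (Primrec.nat_add.comp (.const 1) (Primrec.nat_mul.comp
    (Primrec.nat_mul.comp s (Primrec.succ.comp (primrec_listBound.comp x (primrec_rowBound.comp h))))
    x))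

theorem primrec_codeBound : Primrec₂ codeBound :=
  primrec_listBound.comp (primrec_lengthBound.comp (.pair .id .snd)) (primrec_rowBound.comp .snd)

theorem primrec_autoBound : Primrec₂ autoBound :=
  primrec_listBound.comp (Primrec.succ.comp .snd) (Primrec₂.natPair.comp
    (primrec_listBound.comp .snd .snd) (primrec_listBound.comp (Primrec.nat_mul.comp .fst
      (Primrec.succ.comp primrec_codeBound)) primrec_codeBound))

/-- The leading summand `x` in the recursion for `lengthBound` is there for this. -/
theorem lengthBound_mono {s h i j : ℕ} (hij : i ≤ j) : lengthBound s h i ≤ lengthBound s h j := by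
  induction hij with
  | refl => rfl
  | step _ ih => exact ih.trans (Nat.le_add_right _ _)

end Block

namespace Frame

open Block

/-- The invariant of the frame of a vertex at level `d - 1`. -/
structure Bounded (s h d : ℕ) (f : Frame) : Prop where
  nodup : f.1.Nodup
  lt : ∀ l ∈ f.1, l < h
  count : ∀ b, f.2.count b ≤ s
  length : ∀ b ∈ f.2, b.length ≤ lengthBound s h (h - d)
  row : ∀ b ∈ f.2, ∀ x ∈ b, Encodable.encode x ≤ rowBound h

theorem Bounded.encode_fst_le {s h d : ℕ} {f : Frame} (hf : f.Bounded s h d) :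
    Encodable.encode f.1 ≤ listBound h h := by
  refine encode_le_listBound ?_ fun l hl => (hf.lt l hl).le
  rw [← List.toFinset_card_of_nodup hf.nodup, ← Finset.card_range h]
  exact Finset.card_le_card fun l hl => by simpa using hf.lt l (by simpa using hl)

theorem Bounded.length_le {s h d : ℕ} {f : Frame} (hf : f.Bounded s h d) :
    f.2.length ≤ s * (listBound (lengthBound s h (h - d)) (rowBound h) + 1) :=
  length_le_of_count_le hf.count fun b hb => encode_le_listBound (hf.length b hb) (hf.row b hb)

theorem Bounded.encode_le {s h d : ℕ} {f : Frame} (hf : f.Bounded s h d) :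
    Encodable.encode f ≤ Nat.pair (listBound h h)
      (listBound (s * (codeBound s h + 1)) (codeBound s h)) := by
  have hmono : listBound (lengthBound s h (h - d)) (rowBound h) ≤ codeBound s h :=
    listBound_mono (lengthBound_mono (Nat.sub_le _ _)) le_rfl
  exact Nat.pair_mono hf.encode_fst_le (encode_le_listBound (hf.length_le.trans
    (Nat.mul_le_mul_left _ (Nat.succ_le_succ hmono)))
    fun b hb => (encode_le_listBound (hf.length b hb) (hf.row b hb)).trans hmono)

/-- The step from height `j` to height `j + 1`: one root, and at most `s` copies of each possible
code of a child tree. -/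
theorem Bounded.block_length {s h d : ℕ} {f : Frame} (hf : f.Bounded s h (d + 1)) (hd : d < h)
    (d' : ℕ) : (f.block d').length ≤ lengthBound s h (h - d) := by
  obtain ⟨j, hj⟩ : ∃ j, h - d = j + 1 := ⟨h - d - 1, by omega⟩
  have hj' : h - (d + 1) = j := by omega
  rw [hj, block, List.length_cons, List.length_flatten]
  have h1 := hf.length_le
  have h2 : (f.2.map List.length).sum ≤ f.2.length * lengthBound s h j := by
    have := List.sum_le_card_nsmul (f.2.map List.length) (lengthBound s h j) (by
      simpa [hj'] using hf.length)
    simpa using this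
  rw [hj'] at h1
  have h3 := Nat.mul_le_mul_right (lengthBound s h j) h1
  have h4 : lengthBound s h (j + 1) = lengthBound s h j +
    (1 + s * (listBound (lengthBound s h j) (rowBound h) + 1) * lengthBound s h j) := rfl
  omega

end Frame

/-- The invariant of the states of the automaton. -/
inductive AutoBounded (s h : ℕ) : List Frame → Prop
  | nil : AutoBounded s h []
  | cons {f : Frame} {Z : List Frame} (hf : f.Bounded s h Z.length) (hZ : AutoBounded s h Z) :
      AutoBounded s h (f :: Z)

namespace AutoBounded

open Block

variable {s h : ℕ} {Z : List Frame}

/-- The reason for the invariant: the argument of each call of the automaton, and with it the cost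
of the call, is bounded in terms of `s` and `h`. -/
theorem encode_le (hZ : AutoBounded s h Z) (hl : Z.length ≤ h + 1) :
    Encodable.encode Z ≤ autoBound s h := by
  refine encode_le_listBound hl ?_
  clear hl
  induction hZ with
  | nil => simp
  | cons hf _ ih =>
    intro x hx
    rcases List.mem_cons.1 hx with rfl | hx
    · exact hf.encode_le
    · exact ih x hx

theorem step_open (hZ : AutoBounded s h Z) : AutoBounded s h (autoStep s 1 Z) :=
  .cons ⟨by simp, by simp, by simp, by simp, by simp⟩ hZ

theorem step_back (hZ : AutoBounded s h Z) {l : ℕ} (hl : l < h) :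
    AutoBounded s h (autoStep s (l + 3) Z) := by
  cases hZ with
  | nil => exact .nil
  | @cons f Z hf hZ =>
    refine .cons ⟨?_, fun m hm => ?_, hf.count, hf.length, hf.row⟩ hZ
    · by_cases h : l ∈ f.1
      · simpa [Frame.addLevel, h] using hf.nodup
      · simpa [Frame.addLevel, h] using hf.nodup
    · by_cases h : l ∈ f.1
      · simp [Frame.addLevel, h] at hm; exact hf.lt m hm
      · simp [Frame.addLevel, h] at hm
        rcases hm with rfl | hm
        · exact hl
        · exact hf.lt m hm

/-- The bound on the length puts the closed vertex at a level below `h`, which bounds its row and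
leaves room for one more level in `lengthBound`. The test `count < s` keeps the multiplicities at
most `s`. -/
theorem step_close (hZ : AutoBounded s h Z) (hl : Z.length ≤ h + 1) :
    AutoBounded s h (autoStep s 2 Z) := by
  cases hZ with
  | nil => exact .nil
  | @cons f Z hf hZ =>
    cases hZ with
    | nil => exact .cons hf .nil
    | @cons g Z hg hZ =>
      simp only [List.length_cons] at hl hf
      by_cases hc : g.2.count (f.block Z.length) < s
      · have hrow : ∀ x ∈ f.block Z.length, Encodable.encode x ≤ rowBound h := by
          intro x hx
          rcases List.mem_cons.1 hx with rfl | hx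
          · exact Nat.pair_mono (by simp; omega) hf.encode_fst_le
          · obtain ⟨b, hb, hx⟩ := List.mem_flatten.1 hx
            exact hf.row b hb x hx
        refine .cons ?_ hZ
        simp only [Frame.addBlock, hc, if_true]
        refine ⟨hg.nodup, hg.lt, fun b => ?_, fun b hb => ?_, fun b hb => ?_⟩
        · have := hg.count b
          rw [List.count_cons]
          split_ifs with e
          · have e : f.block Z.length = b := by simpa using e
            rw [e] at hc; omega
          · omega
        · rcases List.mem_cons.1 hb with rfl | hb
          · exact hf.block_length (by omega) _
          · exact hg.length b hb
        · rcases List.mem_cons.1 hb with rfl | hb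
          · exact hrow
          · exact hg.row b hb
      · refine .cons ?_ hZ
        simpa [Frame.addBlock, hc] using hg

end AutoBounded

/-! ## Depth-first search and the reduced graph -/

/-- `AtLevel P l x`: the vertex `x` is at the level `l` of the path `P`, whose last vertex comes
first. -/
def AtLevel {V : Type*} : List V → ℕ → V → Prop
  | [], _, _ => False
  | v :: P, l, x => l = P.length ∧ x = v ∨ AtLevel P l x

namespace AtLevel

variable {V : Type*} {P : List V} {l m : ℕ} {x y : V}

theorem lt (h : AtLevel P l x) : l < P.length := by
  induction P with
  | nil => exact h.elim
  | cons v P ih =>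
    rcases h with ⟨rfl, -⟩ | h
    · simp
    · have := ih h
      simp; omega

theorem mem (h : AtLevel P l x) : x ∈ P := by
  induction P with
  | nil => exact h.elim
  | cons v P ih =>
    rcases h with ⟨-, rfl⟩ | h
    · simp
    · exact List.mem_cons_of_mem _ (ih h)

theorem exists_of_mem (h : x ∈ P) : ∃ l, AtLevel P l x := by
  induction P with
  | nil => simp at h
  | cons v P ih =>
    rcases List.mem_cons.1 h with rfl | h
    · exact ⟨_, .inl ⟨rfl, rfl⟩⟩
    · exact (ih h).imp fun l h => .inr h

theorem right_unique (h : AtLevel P l x) (h' : AtLevel P l y) : x = y := by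
  induction P with
  | nil => exact h.elim
  | cons v P ih =>
    rcases h with ⟨rfl, rfl⟩ | h <;> rcases h' with ⟨e, rfl⟩ | h'
    · rfl
    · exact absurd h'.lt (lt_irrefl _)
    · exact absurd (e ▸ h.lt) (lt_irrefl _)
    · exact ih h h'

theorem left_unique (hP : P.Nodup) (h : AtLevel P l x) (h' : AtLevel P m x) : l = m := by
  induction P with
  | nil => exact h.elim
  | cons v P ih =>
    rw [List.nodup_cons] at hP
    rcases h with ⟨rfl, rfl⟩ | h <;> rcases h' with ⟨rfl, e⟩ | h'
    · rfl
    · exact absurd h'.mem hP.1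
    · exact absurd (e ▸ h.mem) hP.1
    · exact ih hP.2 h h'

end AtLevel

/-- Vertices with their rows. -/
abbrev VBlock (V : Type*) := List (V × Row)

namespace VBlock

variable {V : Type*}

/-- The vertices of a block. -/
def verts (b : VBlock V) : List V := b.map Prod.fst

/-- The block without its vertices. -/
def code (b : VBlock V) : Block := b.map Prod.snd

/-- The rows describe the edges between the vertices of `b`. -/
def Describes (G : SimpleGraph V) (b : VBlock V) : Prop :=
  ∀ (i j : ℕ) (x y : V × Row), i < j → b[i]? = some x → b[j]? = some y → (G.Adj x.1 y.1 ↔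
    (∀ (k : ℕ) (z : V × Row), i < k → k ≤ j → b[k]? = some z → x.2.1 < z.2.1) ∧ x.2.1 ∈ y.2.2)

/-- The first row of `d` has a level no greater than any in `b`, so no row of `b` counts as an
ancestor of a row of `d`, in agreement with the absence of edges. -/
theorem Describes.append {G : SimpleGraph V} {b d : VBlock V} (hb : b.Describes G)
    (hc : d.Describes G) (hadj : ∀ x ∈ b, ∀ y ∈ d, ¬ G.Adj x.1 y.1)
    (hlev : ∀ z, d[0]? = some z → ∀ x ∈ b, z.2.1 ≤ x.2.1) : Describes G (b ++ d) := by
  intro i j x y hij hi hj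
  rw [List.getElem?_append] at hi hj
  by_cases hj' : j < b.length
  · rw [if_pos (by omega)] at hi
    rw [if_pos hj'] at hj
    rw [hb i j x y hij hi hj]
    refine and_congr_left fun _ => forall_congr' fun k => forall_congr' fun z =>
      forall_congr' fun h1 => forall_congr' fun h2 => ?_
    rw [List.getElem?_append_left (by omega)]
  · rw [if_neg hj'] at hj
    by_cases hi' : i < b.length
    · rw [if_pos hi'] at hi
      refine iff_of_false (hadj x (List.mem_of_getElem? hi) y (List.mem_of_getElem? hj)) ?_
      rintro ⟨h, -⟩
      have hpos : 0 < d.length := by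
        have := (List.getElem?_eq_some_iff.1 hj).1
        omega
      have h0 := hlev _ (List.getElem?_eq_getElem hpos) x (List.mem_of_getElem? hi)
      have h1 := h b.length d[0] hi' (by omega) (by simp [List.getElem?_append, hpos])
      omega
    · rw [if_neg hi'] at hi
      rw [hc (i - b.length) (j - b.length) x y (by omega) hi hj]
      refine and_congr_left fun _ => ⟨fun h k z h1 h2 h3 => ?_, fun h k z h1 h2 h3 => ?_⟩
      · rw [List.getElem?_append_right (by omega)] at h3
        exact h (k - b.length) z (by omega) (by omega) h3
      · refine h (k + b.length) z (by omega) (by omega) ?_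
        rw [List.getElem?_append_right (by omega)]
        simpa using h3

/-- All later levels are greater, so the new row counts as an ancestor of every row of `b`, and only
the recorded levels decide adjacency. -/
theorem Describes.cons {G : SimpleGraph V} {b : VBlock V} (hb : b.Describes G) (v : V × Row)
    (hlev : ∀ x ∈ b, v.2.1 < x.2.1) (hadj : ∀ x ∈ b, (G.Adj v.1 x.1 ↔ v.2.1 ∈ x.2.2)) :
    Describes G (v :: b) := by
  intro i j x y hij hi hj
  obtain ⟨j, rfl⟩ : ∃ k, j = k + 1 := ⟨j - 1, by omega⟩
  rw [List.getElem?_cons_succ] at hj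
  rcases i with _ | i
  · simp only [List.getElem?_cons_zero, Option.some.injEq] at hi
    subst hi
    rw [hadj y (List.mem_of_getElem? hj)]
    refine (and_iff_right fun k z h1 _ h3 => ?_).symm
    obtain ⟨k, rfl⟩ : ∃ m, k = m + 1 := ⟨k - 1, by omega⟩
    exact hlev z (List.mem_of_getElem? (by simpa using h3))
  · rw [List.getElem?_cons_succ] at hi
    rw [hb i j x y (by omega) hi hj]
    refine and_congr_left fun _ => ⟨fun h k z h1 h2 h3 => ?_, fun h k z h1 h2 h3 => ?_⟩
    · obtain ⟨k, rfl⟩ : ∃ m, k = m + 1 := ⟨k - 1, by omega⟩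
      exact h k z (by omega) (by omega) (by simpa using h3)
    · exact h (k + 1) z (by omega) (by omega) (by simpa using h3)

/-- The block `b` is a part of the reduced graph on `A` that is attached to the path `P`. -/
structure Attached (G : SimpleGraph V) (A : Set V) (P : List V) (b : VBlock V) : Prop where
  head : ∀ z, b[0]? = some z → z.2.1 = P.length
  level : ∀ x ∈ b, P.length ≤ x.2.1
  describes : b.Describes G
  up : ∀ x ∈ b, ∀ l y, AtLevel P l y → (G.Adj x.1 y ↔ l ∈ x.2.2)
  closed : ∀ x ∈ b.verts, ∀ y ∈ A, G.Adj x y → y ∈ b.verts ∨ y ∈ P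

theorem Attached.mono {G : SimpleGraph V} {A B : Set V} {P : List V} {b : VBlock V}
    (h : b.Attached G A P) (hB : B ⊆ A) : b.Attached G B P :=
  ⟨h.head, h.level, h.describes, h.up, fun x hx y hy => h.closed x hx y (hB hy)⟩

/-- All vertices of a list of blocks. -/
def allVerts (k : List (VBlock V)) : List V := verts k.flatten

theorem mem_allVerts {k : List (VBlock V)} {x : V} : x ∈ allVerts k ↔ ∃ b ∈ k, x ∈ b.verts := by
  simp only [allVerts, verts, List.mem_map, List.mem_flatten]
  constructor
  · rintro ⟨a, ⟨b, hb, ha⟩, rfl⟩; exact ⟨b, hb, a, ha, rfl⟩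
  · rintro ⟨b, hb, a, ha, rfl⟩; exact ⟨a, ⟨b, hb, ha⟩, rfl⟩

theorem allVerts_cons (b : VBlock V) (k : List (VBlock V)) :
    allVerts (b :: k) = b.verts ++ allVerts k := by
  simp [allVerts, verts]

/-- Blocks on the same path are not joined by edges: by `closed`, a neighbor outside of a block lies
on `P`. Each nonempty block starts at the least possible level, so `Describes.append` applies. -/
theorem describes_flatten {G : SimpleGraph V} {A : Set V} {P : List V} (k : List (VBlock V))
    (hk : ∀ b ∈ k, b.Attached G A P) (hn : (allVerts k).Nodup) (hA : ∀ x ∈ allVerts k, x ∈ A)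
    (hP : ∀ x ∈ allVerts k, x ∉ P) : Describes G k.flatten := by
  induction k with
  | nil => intro i j x y _ hi; simp at hi
  | cons b k ih =>
    rw [allVerts_cons] at hn hA hP
    rw [List.nodup_append] at hn
    simp only [List.mem_append] at hA hP
    rw [List.flatten_cons]
    refine (hk b (by simp)).describes.append (ih (fun b hb => hk b (by simp [hb])) hn.2.1
      (fun x hx => hA x (.inr hx)) (fun x hx => hP x (.inr hx))) (fun x hx y hy hxy => ?_)
      (fun z hz x hx => ?_)
    · have hy' : y.1 ∈ allVerts k := List.mem_map_of_mem hy
      rcases (hk b (by simp)).closed x.1 (List.mem_map_of_mem hx) y.1 (hA _ (.inr hy')) hxy with h | h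
      · exact hn.2.2 _ h _ hy' rfl
      · exact hP _ (.inr hy') h
    · have hx' := (hk b (by simp)).level x hx
      -- `Attached` does not exclude empty blocks, so the first row of the concatenation comes from
      -- the first nonempty block.
      have : z.2.1 = P.length := by
        clear ih hn hA hP
        induction k with
        | nil => simp at hz
        | cons d k ih =>
          rw [List.flatten_cons] at hz
          rcases d with _ | ⟨w, d⟩
          · exact ih (fun b hb => hk b (by
              rcases List.mem_cons.1 hb with rfl | hb <;> simp [*])) (by simpa using hz)
          · exact (hk (w :: d) (by simp)).head z (by simpa using hz)
      omega

/-- The blocks at the children of `v` already record adjacency to `v`, as a vertex of their path.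
Moving `v` from the end of the path to the root of the new block turns this information into edges
inside the block. -/
theorem Attached.close {G : SimpleGraph V} {A : Set V} {P : List V} {k : List (VBlock V)} {v : V}
    {a : List ℕ} (hk : ∀ b ∈ k, b.Attached G A (v :: P)) (hn : (allVerts k).Nodup)
    (hA : ∀ x ∈ allVerts k, x ∈ A) (hP : ∀ x ∈ allVerts k, x ∉ v :: P)
    (ha : ∀ l y, AtLevel P l y → (G.Adj v y ↔ l ∈ a))
    (hv : ∀ y ∈ A, G.Adj v y → y ∈ allVerts k ∨ y ∈ P) :
    Attached G A P ((v, (P.length, a)) :: k.flatten) := by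
  have hmem : ∀ x ∈ k.flatten, P.length < x.2.1 ∧
      ∀ l y, AtLevel (v :: P) l y → (G.Adj x.1 y ↔ l ∈ x.2.2) := by
    intro x hx
    obtain ⟨b, hb, hx⟩ := List.mem_flatten.1 hx
    exact ⟨(hk b hb).level x hx, (hk b hb).up x hx⟩
  refine ⟨by simp, fun x hx => ?_, (describes_flatten k hk hn hA hP).cons _
    (fun x hx => (hmem x hx).1) (fun x hx => ?_), fun x hx l y hy => ?_, fun x hx y hy hxy => ?_⟩
  · rcases List.mem_cons.1 hx with rfl | hx
    · exact le_rfl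
    · exact (hmem x hx).1.le
  · rw [G.adj_comm]
    exact (hmem x hx).2 _ _ (.inl ⟨rfl, rfl⟩)
  · rcases List.mem_cons.1 hx with rfl | hx
    · exact ha l y hy
    · exact (hmem x hx).2 l y (.inr hy)
  · have e : verts ((v, (P.length, a)) :: k.flatten) = v :: allVerts k := rfl
    rw [e] at hx ⊢
    rcases List.mem_cons.1 hx with rfl | hx
    · exact (hv y hy hxy).imp (List.mem_cons_of_mem _) id
    · obtain ⟨b, hb, hx⟩ := mem_allVerts.1 hx
      rcases (hk b hb).closed x hx y hy hxy with h | h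
      · exact .inl (List.mem_cons_of_mem _ (mem_allVerts.2 ⟨b, hb, h⟩))
      · rcases List.mem_cons.1 h with rfl | h
        · exact .inl (by simp)
        · exact .inr h

/-- Two blocks with equal codes, attached to the same path, can be exchanged. -/
def Swap (A : Set V) (b d : VBlock V) (x y : V) : Prop :=
  (∃ (i : ℕ) (z z' : V × Row), b[i]? = some z ∧ d[i]? = some z' ∧ x = z.1 ∧ y = z'.1) ∨
  (∃ (i : ℕ) (z z' : V × Row), b[i]? = some z ∧ d[i]? = some z' ∧ x = z'.1 ∧ y = z.1) ∨
  (x = y ∧ x ∈ A ∧ x ∉ b.verts ∧ x ∉ d.verts)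

section Swap

variable {G : SimpleGraph V} {A : Set V} {P : List V} {b d : VBlock V}

theorem Swap.symm {x y : V} (h : Swap A b d x y) : Swap A b d y x := by
  rcases h with ⟨i, z, z', h1, h2, h3, h4⟩ | ⟨i, z, z', h1, h2, h3, h4⟩ | ⟨rfl, h⟩
  · exact .inr (.inl ⟨i, z, z', h1, h2, h4, h3⟩)
  · exact .inl ⟨i, z, z', h1, h2, h4, h3⟩
  · exact .inr (.inr ⟨rfl, h⟩)

theorem exists_of_code_eq (h : b.code = d.code) {i : ℕ} {z : V × Row} (hz : b[i]? = some z) :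
    ∃ z', d[i]? = some z' ∧ z'.2 = z.2 := by
  have := congrArg (fun l => l[i]?) h
  simp only [code, List.getElem?_map, hz] at this
  rcases hc : d[i]? with _ | z'
  · simp [hc] at this
  · simp [hc] at this; exact ⟨z', rfl, this.symm⟩

theorem eq_of_code_eq (h : b.code = d.code) {i : ℕ} {z z' : V × Row} (hz : b[i]? = some z)
    (hz' : d[i]? = some z') : z.2 = z'.2 := by
  obtain ⟨w, hw, e⟩ := exists_of_code_eq h hz
  rw [hw] at hz'
  simp only [Option.some.injEq] at hz'
  rw [← hz', e]

theorem Swap.exists_right (h : b.code = d.code) (hb : ∀ x ∈ b.verts, x ∈ A)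
    (hc : ∀ x ∈ d.verts, x ∈ A) {x : V} (hx : x ∈ A) : ∃ y ∈ A, Swap A b d x y := by
  by_cases hxb : x ∈ b.verts
  · obtain ⟨z, hz, rfl⟩ := List.mem_map.1 hxb
    obtain ⟨i, hi⟩ := List.mem_iff_getElem?.1 hz
    obtain ⟨z', hz', -⟩ := exists_of_code_eq h hi
    exact ⟨z'.1, hc _ (List.mem_map_of_mem (List.mem_of_getElem? hz')),
      .inl ⟨i, z, z', hi, hz', rfl, rfl⟩⟩
  by_cases hxc : x ∈ d.verts
  · obtain ⟨z, hz, rfl⟩ := List.mem_map.1 hxc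
    obtain ⟨i, hi⟩ := List.mem_iff_getElem?.1 hz
    obtain ⟨z', hz', -⟩ := exists_of_code_eq h.symm hi
    exact ⟨z'.1, hb _ (List.mem_map_of_mem (List.mem_of_getElem? hz')),
      .inr (.inl ⟨i, z', z, hz', hi, rfl, rfl⟩)⟩
  · exact ⟨x, hx, .inr (.inr ⟨rfl, hx, hxb, hxc⟩)⟩

theorem index_unique (hn : b.verts.Nodup) {i j : ℕ} {z z' : V × Row} (hi : b[i]? = some z)
    (hj : b[j]? = some z') (e : z.1 = z'.1) : i = j := by
  have h1 : b.verts[i]? = some z.1 := by simp [verts, hi]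
  have h2 : b.verts[j]? = some z.1 := by simp [verts, hj, e]
  exact (List.getElem?_inj (List.getElem?_eq_some_iff.1 h1).1 hn).1 (h1.trans h2.symm)

/-- `Describes` expresses adjacency inside a block by rows and positions alone, and these agree in
blocks with equal codes. -/
theorem Attached.adj_iff_of_code_eq (hb : b.Attached G A P) (hc : d.Attached G A P)
    (h : b.code = d.code) {i j : ℕ} {x x' y y' : V × Row} (hx : b[i]? = some x)
    (hx' : d[i]? = some x') (hy : b[j]? = some y) (hy' : d[j]? = some y') :
    G.Adj x.1 y.1 ↔ G.Adj x'.1 y'.1 := by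
  have key : ∀ {i j : ℕ} {x x' y y' : V × Row}, i < j → b[i]? = some x → d[i]? = some x' →
      b[j]? = some y → d[j]? = some y' → (G.Adj x.1 y.1 ↔ G.Adj x'.1 y'.1) := by
    intro i j x x' y y' hij hx hx' hy hy'
    rw [hb.describes i j x y hij hx hy, hc.describes i j x' y' hij hx' hy',
      eq_of_code_eq h hx hx', eq_of_code_eq h hy hy']
    refine and_congr_left fun _ => ⟨fun hk k z h1 h2 h3 => ?_, fun hk k z h1 h2 h3 => ?_⟩
    · obtain ⟨w, hw, e⟩ := exists_of_code_eq h.symm h3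
      rw [← e]; exact hk k w h1 h2 hw
    · obtain ⟨w, hw, e⟩ := exists_of_code_eq h h3
      rw [← e]; exact hk k w h1 h2 hw
  rcases lt_trichotomy i j with hij | rfl | hij
  · exact key hij hx hx' hy hy'
  · rw [hx] at hy; rw [hx'] at hy'
    simp only [Option.some.injEq] at hy hy'
    simp [hy, hy']
  · rw [G.adj_comm, key hij hy hy' hx hx', G.adj_comm]

/-- Outside of its block a vertex has neighbors in `A` only on `P`, and the row records their
levels. -/
theorem Attached.adj_iff_of_not_mem (hb : b.Attached G A P) (hc : d.Attached G A P)
    {x x' : V × Row} (hx : x ∈ b) (hx' : x' ∈ d) (e : x.2 = x'.2) {y : V} (hy : y ∈ A)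
    (hyb : y ∉ b.verts) (hyc : y ∉ d.verts) : G.Adj x.1 y ↔ G.Adj x'.1 y := by
  by_cases hyP : y ∈ P
  · obtain ⟨l, hl⟩ := AtLevel.exists_of_mem hyP
    rw [hb.up x hx l y hl, hc.up x' hx' l y hl, e]
  · refine iff_of_false (fun h => ?_) (fun h => ?_)
    · exact (hb.closed x.1 (List.mem_map_of_mem hx) y hy h).elim hyb hyP
    · exact (hc.closed x'.1 (List.mem_map_of_mem hx') y hy h).elim hyc hyP

/-- The exchange is an automorphism. Edges inside a block and edges to the rest are determined by
the codes, and there are no edges between `b` and `d`, since each block is closed up to `P` and the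
three lists are disjoint. -/
theorem Swap.compat (hb : b.Attached G A P) (hc : d.Attached G A P) (h : b.code = d.code)
    (hcA : ∀ x ∈ d.verts, x ∈ A)
    (hn : (b.verts ++ d.verts ++ P).Nodup) {x y x' y' : V} (hxy : Swap A b d x y)
    (hxy' : Swap A b d x' y') : (x = x' ↔ y = y') ∧ (G.Adj x x' ↔ G.Adj y y') := by
  rw [List.nodup_append, List.nodup_append] at hn
  obtain ⟨⟨nb, nc, nbc⟩, -, nP⟩ := hn
  have mb : ∀ {i : ℕ} {z : V × Row}, b[i]? = some z → z.1 ∈ b.verts := fun h =>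
    List.mem_map_of_mem (List.mem_of_getElem? h)
  have mc : ∀ {i : ℕ} {z : V × Row}, d[i]? = some z → z.1 ∈ d.verts := fun h =>
    List.mem_map_of_mem (List.mem_of_getElem? h)
  have hno : ∀ x ∈ b.verts, ∀ y ∈ d.verts, ¬ G.Adj x y := fun x hx y hy hxy =>
    (hb.closed x hx y (hcA y hy) hxy).elim (fun h => nbc _ h _ hy rfl)
      (fun h => nP _ (List.mem_append_right _ hy) _ h rfl)
  have hinj : ∀ {i j : ℕ} {z w z' w' : V × Row}, b[i]? = some z → d[i]? = some z' →
      b[j]? = some w → d[j]? = some w' → (z.1 = w.1 ↔ z'.1 = w'.1) := by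
    intro i j z w z' w' h1 h2 h3 h4
    constructor
    · intro e
      obtain rfl := index_unique nb h1 h3 e
      rw [h2] at h4; simp only [Option.some.injEq] at h4; rw [h4]
    · intro e
      obtain rfl := index_unique nc h2 h4 e
      rw [h1] at h3; simp only [Option.some.injEq] at h3; rw [h3]
  rcases hxy with ⟨i, z, z', h1, h2, rfl, rfl⟩ | ⟨i, z, z', h1, h2, rfl, rfl⟩ | ⟨rfl, hA, nxb, nxc⟩ <;>
  rcases hxy' with ⟨j, w, w', g1, g2, rfl, rfl⟩ | ⟨j, w, w', g1, g2, rfl, rfl⟩ |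
    ⟨rfl, hA', nxb', nxc'⟩
  · exact ⟨hinj h1 h2 g1 g2, hb.adj_iff_of_code_eq hc h h1 h2 g1 g2⟩
  · refine ⟨iff_of_false (nbc _ (mb h1) _ (mc g2)) (fun e => nbc _ (mb g1) _ (mc h2) e.symm),
      iff_of_false (hno _ (mb h1) _ (mc g2)) (fun e => hno _ (mb g1) _ (mc h2) e.symm)⟩
  · exact ⟨iff_of_false (fun e => nxb' (e ▸ mb h1)) (fun e => nxc' (e ▸ mc h2)),
      hb.adj_iff_of_not_mem hc (List.mem_of_getElem? h1) (List.mem_of_getElem? h2)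
        (eq_of_code_eq h h1 h2) hA' nxb' nxc'⟩
  · refine ⟨iff_of_false (fun e => nbc _ (mb g1) _ (mc h2) e.symm) (nbc _ (mb h1) _ (mc g2)),
      iff_of_false (fun e => hno _ (mb g1) _ (mc h2) e.symm) (hno _ (mb h1) _ (mc g2))⟩
  · exact ⟨(hinj h1 h2 g1 g2).symm, (hb.adj_iff_of_code_eq hc h h1 h2 g1 g2).symm⟩
  · exact ⟨iff_of_false (fun e => nxc' (e ▸ mc h2)) (fun e => nxb' (e ▸ mb h1)),
      (hb.adj_iff_of_not_mem hc (List.mem_of_getElem? h1) (List.mem_of_getElem? h2)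
        (eq_of_code_eq h h1 h2) hA' nxb' nxc').symm⟩
  · refine ⟨iff_of_false (fun e => nxb (e ▸ mb g1)) (fun e => nxc (e ▸ mc g2)), ?_⟩
    rw [G.adj_comm, G.adj_comm x]
    exact hb.adj_iff_of_not_mem hc (List.mem_of_getElem? g1) (List.mem_of_getElem? g2)
        (eq_of_code_eq h g1 g2) hA nxb nxc
  · refine ⟨iff_of_false (fun e => nxc (e ▸ mc g2)) (fun e => nxb (e ▸ mb g1)), ?_⟩
    rw [G.adj_comm, G.adj_comm x]
    exact (hb.adj_iff_of_not_mem hc (List.mem_of_getElem? g1) (List.mem_of_getElem? g2)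
        (eq_of_code_eq h g1 g2) hA nxb nxc).symm
  · exact ⟨Iff.rfl, Iff.rfl⟩

end Swap

/-- The blocks are disjoint, so each uses up an element of `F` of its own. The contrapositive
supplies a copy that avoids the fixed elements. -/
theorem length_le_card_of_meets [DecidableEq V] (k : List (VBlock V)) (F : Finset V)
    (hn : (allVerts k).Nodup) (h : ∀ b ∈ k, ∃ x ∈ b.verts, x ∈ F) : k.length ≤ F.card := by
  induction k generalizing F with
  | nil => simp
  | cons b k ih =>
    rw [allVerts_cons, List.nodup_append] at hn
    obtain ⟨x, hxb, hxF⟩ := h b (by simp)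
    have := ih (F.erase x) hn.2.1 fun d hc => by
      obtain ⟨y, hy, hyF⟩ := h d (by simp [hc])
      exact ⟨y, hy, Finset.mem_erase.2
        ⟨fun e => hn.2.2 x hxb y (mem_allVerts.2 ⟨d, hc, hy⟩) e.symm, hyF⟩⟩
    have := Finset.card_erase_add_one hxF
    simp; omega

/-- A block may be removed if there are `s` blocks with the same code attached to the same path. -/
theorem Attached.satOn_diff_iff {G : SimpleGraph V} {A : Set V} {P : List V} {b : VBlock V}
    {k : List (VBlock V)} {s : ℕ} (hb : b.Attached G A P) (hk : ∀ d ∈ k, d.Attached G A P)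
    (hbA : ∀ x ∈ b.verts, x ∈ A) (hkA : ∀ x ∈ allVerts k, x ∈ A)
    (hn : (b.verts ++ allVerts k ++ P).Nodup) (hs : s ≤ (k.map code).count b.code)
    (φ : FOFormula) (hφ : φ.numVars ≤ s) :
    φ.SatOn A G.Adj (fun _ => none) ↔ φ.SatOn (A \ {x | x ∈ b.verts}) G.Adj fun _ => none := by
  classical
  have hn' := hn
  rw [List.nodup_append, List.nodup_append] at hn'
  obtain ⟨⟨nb, nk, nbk⟩, nP, nbP⟩ := hn'
  refine FOFormula.satOn_diff_iff (s := s) (fun F hF hFA v hv hvA => ?_) φ.vars hφ φ subset_rfl _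
    (by simp)
  -- There are at least `s` disjoint copies and fewer than `s` elements in `F`, so some copy misses
  -- `F`; the exchange with it fixes `F` pointwise.
  obtain ⟨d, hc, hcb, hcF⟩ : ∃ d ∈ k, d.code = b.code ∧ ∀ x ∈ d.verts, x ∉ F := by
    by_contra hcon
    push Not at hcon
    have h1 := length_le_card_of_meets (k.filter fun d => d.code == b.code) F ?_ fun d hc => by
      rw [List.mem_filter] at hc
      exact hcon d hc.1 (by simpa using hc.2)
    · rw [List.count_eq_countP, List.countP_map, List.countP_eq_length_filter] at hs
      have e : ((fun x => x == b.code) ∘ code : VBlock V → Bool) = fun d => d.code == b.code := rfl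
      rw [e] at hs
      omega
    · exact nk.sublist (List.Sublist.map _ (List.Sublist.flatten (List.filter_sublist)))
  have hcA : ∀ x ∈ d.verts, x ∈ A := fun x hx => hkA x (mem_allVerts.2 ⟨d, hc, hx⟩)
  have hbc : ∀ x ∈ b.verts, x ∉ d.verts := fun x hx hx' =>
    nbk x hx x (mem_allVerts.2 ⟨d, hc, hx'⟩) rfl
  have hsub : d.verts.Sublist (allVerts k) :=
    List.Sublist.map _ (List.sublist_flatten_of_mem hc)
  refine ⟨Swap A b d, fun x hx => Swap.exists_right hcb.symm hbA hcA hx, fun x hx => ?_, ?_,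
    fun x hx => .inr (.inr ⟨rfl, (hFA x hx).1, (hFA x hx).2, fun h => hcF x h hx⟩), ?_⟩
  · obtain ⟨y, hy, h⟩ := Swap.exists_right hcb.symm hbA hcA hx
    exact ⟨y, hy, h.symm⟩
  · intro x y x' y' h h'
    exact Swap.compat hb (hk d hc) hcb.symm hcA
      (hn.sublist (((List.Sublist.refl _).append hsub).append (List.Sublist.refl _))) h h'
  · obtain ⟨z, hz, rfl⟩ := List.mem_map.1 hv
    obtain ⟨i, hi⟩ := List.mem_iff_getElem?.1 hz
    obtain ⟨z', hz', -⟩ := exists_of_code_eq hcb.symm hi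
    have hm : z'.1 ∈ d.verts := List.mem_map_of_mem (List.mem_of_getElem? hz')
    exact ⟨z'.1, ⟨hcA _ hm, fun h => hbc _ h hm⟩, .inl ⟨i, z, z', hi, hz', rfl, rfl⟩⟩

end VBlock

/-! ### States of the search -/

/-- A vertex on the current path of the search, its unread neighbors, and the levels of the
neighbors found on the path. -/
structure SFrame (V : Type*) where
  vert : V
  rem : List V
  adj : List ℕ

/-- A state of the search: the current path, with its end first; for the vertices of the path and
the (virtual) root, the blocks at their closed children; and the unvisited vertices. -/
structure Search (V : Type*) where
  stack : List (SFrame V)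
  kept : List (List (VBlock V))
  fresh : Set V

namespace Search

open VBlock

variable {V : Type*}

/-- The current path. -/
def path (S : Search V) : List V := S.stack.map SFrame.vert

/-- The vertices that are visited and not deleted. -/
def verts (S : Search V) : List V := S.path ++ allVerts S.kept.flatten

/-- The vertices that are not deleted. -/
def alive (S : Search V) : Set V := {x | x ∈ S.fresh ∨ x ∈ S.verts}

/-- The state of the automaton. -/
def auto (S : Search V) : List Frame :=
  List.zipWith (fun a k => (a, k.map code)) (S.stack.map SFrame.adj ++ [[]]) S.kept

/-- The blocks are attached to the vertices of a path. -/
inductive KeptOK (G : SimpleGraph V) (A : Set V) : List V → List (List (VBlock V)) → Prop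
  | nil {k : List (VBlock V)} : (∀ b ∈ k, b.Attached G A []) → KeptOK G A [] [k]
  | cons {v : V} {P : List V} {k : List (VBlock V)} {ks : List (List (VBlock V))} :
      (∀ b ∈ k, b.Attached G A (v :: P)) → KeptOK G A P ks → KeptOK G A (v :: P) (k :: ks)

namespace KeptOK

variable {G : SimpleGraph V} {A B : Set V} {P : List V} {k k' : List (VBlock V)}
  {ks : List (List (VBlock V))}

theorem length_eq (h : KeptOK G A P ks) : ks.length = P.length + 1 := by
  induction h with
  | nil => rfl
  | cons _ _ ih => simp [ih]

theorem mono (h : KeptOK G A P ks) (hB : B ⊆ A) : KeptOK G B P ks := by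
  induction h with
  | nil h => exact .nil fun b hb => (h b hb).mono hB
  | cons h _ ih => exact .cons (fun b hb => (h b hb).mono hB) ih

theorem head (h : KeptOK G A P (k :: ks)) : ∀ b ∈ k, b.Attached G A P := by
  cases h with
  | nil h => exact h
  | cons h _ => exact h

theorem set_head (h : KeptOK G A P (k :: ks)) (h' : ∀ b ∈ k', b.Attached G A P) :
    KeptOK G A P (k' :: ks) := by
  cases h with
  | nil h => exact .nil h'
  | cons h g => exact .cons h' g

/-- Closed subtrees have no edges to anything but the closed subtrees and the path. This is used to
exclude cross edges when a vertex is closed. -/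
theorem closed (h : KeptOK G A P ks) :
    ∀ x ∈ allVerts ks.flatten, ∀ y ∈ A, G.Adj x y → y ∈ allVerts ks.flatten ∨ y ∈ P := by
  induction h with
  | nil h =>
    intro x hx y hy hxy
    simp only [List.flatten_cons, List.flatten_nil, List.append_nil] at hx ⊢
    obtain ⟨b, hb, hx⟩ := mem_allVerts.1 hx
    exact ((h b hb).closed x hx y hy hxy).imp (fun h => mem_allVerts.2 ⟨b, hb, h⟩) id
  | @cons v P k ks h _ ih =>
    intro x hx y hy hxy
    simp only [mem_allVerts, List.flatten_cons, List.mem_append] at hx ih ⊢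
    obtain ⟨b, hb | hb, hx⟩ := hx
    · exact ((h b hb).closed x hx y hy hxy).imp (fun h => ⟨b, .inl hb, h⟩) id
    · rcases ih x ⟨b, hb, hx⟩ y hy hxy with ⟨b', hb', hy⟩ | hy
      · exact .inl ⟨b', .inr hb', hy⟩
      · exact .inr (List.mem_cons_of_mem _ hy)

end KeptOK

/-- The neighbors of the vertices on the path are recorded correctly. -/
inductive StackOK (N : V → List V) (fresh : Set V) : List (SFrame V) → Prop
  | nil : StackOK N fresh []
  | cons {f : SFrame V} {t : List (SFrame V)} (done : List V) (hN : N f.vert = done ++ f.rem)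
      (hadj : ∀ l y, AtLevel (t.map SFrame.vert) l y → (l ∈ f.adj ↔ y ∈ done))
      (hdone : ∀ y ∈ done, y ∉ fresh) (ht : StackOK N fresh t) : StackOK N fresh (f :: t)

theorem StackOK.mono {N : V → List V} {A B : Set V} {t : List (SFrame V)} (h : StackOK N A t)
    (hB : B ⊆ A) : StackOK N B t := by
  induction h with
  | nil => exact .nil
  | cons done h1 h2 h3 _ ih => exact .cons done h1 h2 (fun y hy h => h3 y hy (hB h)) ih

/-- The invariant of the search. -/
structure Inv (G : SimpleGraph V) (N : V → List V) (s : ℕ) (S : Search V) : Prop where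
  nodup : S.verts.Nodup
  not_fresh : ∀ x ∈ S.verts, x ∉ S.fresh
  chain : List.IsChain G.Adj S.path
  stack : StackOK N S.fresh S.stack
  kept : KeptOK G S.alive S.path S.kept
  equiv : ∀ φ : FOFormula, φ.numVars ≤ s →
    (φ.SatOn Set.univ G.Adj (fun _ => none) ↔ φ.SatOn S.alive G.Adj fun _ => none)

variable {G : SimpleGraph V} {N : V → List V} {s : ℕ} {S : Search V}

/-- Opening a vertex. -/
theorem Inv.open (h : S.Inv G N s) {v : V} (hv : v ∈ S.fresh) {t : List (SFrame V)}
    (ht : t.map SFrame.vert = S.path) (hst : StackOK N (S.fresh \ {v}) t)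
    (hadj : ∀ u ∈ S.path.head?, G.Adj v u) :
    Inv G N s ⟨⟨v, N v, []⟩ :: t, [] :: S.kept, S.fresh \ {v}⟩ := by
  have ht' : t.map SFrame.vert = S.stack.map SFrame.vert := ht
  have hverts : verts (V := V) ⟨⟨v, N v, []⟩ :: t, [] :: S.kept, S.fresh \ {v}⟩ = v :: S.verts := by
    simp [verts, path, ht']
  -- Fresh vertices count as alive, so opening one changes neither the substructure nor the truth of
  -- any formula in it.
  have halive : alive (V := V) ⟨⟨v, N v, []⟩ :: t, [] :: S.kept, S.fresh \ {v}⟩ = S.alive := by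
    ext x
    simp only [alive, hverts, Set.mem_ofPred_eq, List.mem_cons, Set.mem_sdiff, Set.mem_singleton_iff]
    by_cases e : x = v
    · simp [e, hv]
    · simp [e]
  have hpath : path (V := V) ⟨⟨v, N v, []⟩ :: t, [] :: S.kept, S.fresh \ {v}⟩ = v :: S.path := by
    simp [path, ht']
  refine ⟨?_, ?_, ?_, .cons [] rfl (fun l y _ => by simp) (by simp) hst, ?_, ?_⟩
  · rw [hverts, List.nodup_cons]
    exact ⟨fun h' => h.not_fresh v h' hv, h.nodup⟩
  · intro x hx
    rw [hverts] at hx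
    rintro ⟨hx1, hx2⟩
    rcases List.mem_cons.1 hx with rfl | hx
    · exact hx2 rfl
    · exact h.not_fresh x hx hx1
  · rw [hpath]
    rcases hp : S.path with _ | ⟨u, P⟩
    · simp
    · rw [List.isChain_cons_cons]
      exact ⟨hadj u (by simp [hp]), hp ▸ h.chain⟩
  · rw [halive, hpath]
    exact .cons (by simp) h.kept
  · rw [halive]
    exact h.equiv

/-- Reading a neighbor that is not opened. -/
theorem Inv.read (h : S.Inv G N s) {v u : V} {rem : List V} {a a' : List ℕ} {t : List (SFrame V)}
    (hS : S.stack = ⟨v, u :: rem, a⟩ :: t) (hu : u ∉ S.fresh)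
    (ha : ∀ l y, AtLevel (t.map SFrame.vert) l y → (l ∈ a' ↔ l ∈ a ∨ y = u)) :
    Inv G N s ⟨⟨v, rem, a'⟩ :: t, S.kept, S.fresh⟩ := by
  have hpath : path (V := V) ⟨⟨v, rem, a'⟩ :: t, S.kept, S.fresh⟩ = S.path := by simp [path, hS]
  have hverts : verts (V := V) ⟨⟨v, rem, a'⟩ :: t, S.kept, S.fresh⟩ = S.verts := by
    simp [verts, hpath]
  have halive : alive (V := V) ⟨⟨v, rem, a'⟩ :: t, S.kept, S.fresh⟩ = S.alive := by
    simp [alive, hverts]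
  refine ⟨hverts ▸ h.nodup, hverts ▸ h.not_fresh, hpath ▸ h.chain, ?_, by
    rw [halive, hpath]; exact h.kept, by rw [halive]; exact h.equiv⟩
  have := h.stack
  rw [hS] at this
  cases this with
  | cons done h1 h2 h3 h4 =>
    refine .cons (done ++ [u]) (by simpa using h1) (fun l y hl => ?_) (fun y hy => ?_) h4
    · rw [ha l y hl, h2 l y hl]; simp
    · rcases List.mem_append.1 hy with hy | hy
      · exact h3 y hy
      · rw [List.mem_singleton.1 hy]; exact hu

/-- Reading a fresh neighbor, and opening it. -/
theorem Inv.open_child (h : S.Inv G N s) (hN : ∀ u v, v ∈ N u ↔ G.Adj u v) {v u : V} {rem : List V}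
    {a : List ℕ} {t : List (SFrame V)} (hS : S.stack = ⟨v, u :: rem, a⟩ :: t) (hu : u ∈ S.fresh) :
    Inv G N s ⟨⟨u, N u, []⟩ :: ⟨v, rem, a⟩ :: t, [] :: S.kept, S.fresh \ {u}⟩ := by
  have hst := h.stack
  rw [hS] at hst
  cases hst with
  | cons done h1 h2 h3 h4 =>
    refine h.open hu (by simp [path, hS]) (.cons (done ++ [u]) (by simpa using h1)
      (fun l y hl => ?_) (fun y hy => ?_) (h4.mono Set.sdiff_subset)) ?_
    · rw [h2 l y hl]
      -- The opened neighbor is fresh and hence not on the path, so marking it as read leaves the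
      -- recorded levels correct.
      have hy : y ∉ S.fresh := h.not_fresh y
        (List.mem_append_left _ (by rw [path, hS]; exact List.mem_cons_of_mem _ hl.mem))
      have : y ≠ u := fun e => hy (e ▸ hu)
      simp [this]
    · rcases List.mem_append.1 hy with hy | hy
      · exact fun h => h3 y hy h.1
      · exact fun h => h.2 (List.mem_singleton.1 hy)
    · intro w hw
      simp [path, hS] at hw
      subst hw
      exact ((hN v u).1 (by rw [h1]; simp)).symm

/-- Closing a vertex. -/
theorem Inv.close (h : S.Inv G N s) (hN : ∀ u v, v ∈ N u ↔ G.Adj u v) {v : V} {a : List ℕ}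
    {t : List (SFrame V)} (hS : S.stack = ⟨v, [], a⟩ :: t) {k g : List (VBlock V)}
    {ks : List (List (VBlock V))} (hK : S.kept = k :: g :: ks) :
    Inv G N s ⟨t, (if (g.map code).count (code ((v, (t.length, a)) :: k.flatten)) < s then
      ((v, (t.length, a)) :: k.flatten) :: g else g) :: ks, S.fresh⟩ := by
  set P := t.map SFrame.vert with hP
  have hlen : t.length = P.length := by simp [hP]
  rw [hlen]
  set b : VBlock V := (v, (P.length, a)) :: k.flatten with hb
  have hbv : b.verts = v :: allVerts k := rfl
  have hpath : S.path = v :: P := by simp [path, hS, hP]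
  have hverts : S.verts = v :: P ++ (allVerts k ++ (allVerts g ++ allVerts ks.flatten)) := by
    simp [verts, hpath, hK, allVerts, VBlock.verts]
  have hperm : (b.verts ++ allVerts g ++ P ++ allVerts ks.flatten).Perm S.verts := by
    rw [hverts, hbv]
    simp only [List.cons_append, List.append_assoc]
    refine List.Perm.cons _ ?_
    rw [← List.append_assoc, ← List.append_assoc, ← List.append_assoc, ← List.append_assoc]
    refine List.Perm.append_right _ ?_
    rw [List.append_assoc P]
    exact List.perm_append_comm
  have hn : (b.verts ++ allVerts g ++ P ++ allVerts ks.flatten).Nodup := hperm.nodup_iff.2 h.nodup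
  have hA : ∀ x ∈ S.verts, x ∈ S.alive := fun x hx => .inr hx
  have hkept := h.kept
  rw [hpath, hK] at hkept
  cases hkept with | cons hk hg =>
  have hst := h.stack
  rw [hS] at hst
  cases hst with | cons done hd1 hd2 hd3 hd4 =>
  simp only [List.append_nil] at hd1 hd2
  have hdone : ∀ y, y ∈ done ↔ G.Adj v y := fun y => by rw [← hN v y, hd1]
  have hnv := h.nodup
  rw [hverts, List.cons_append, List.nodup_cons] at hnv
  obtain ⟨hvn, hnv⟩ := hnv
  rw [List.nodup_append, List.nodup_append] at hnv
  obtain ⟨nP, ⟨nk, ngs, nkgs⟩, nPk⟩ := hnv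
  have hbA : b.Attached G S.alive P := by
    refine Attached.close hk nk (fun x hx => hA x (by simp [hverts, hx])) (fun x hx hx' => ?_)
      (fun l y hl => ?_) (fun y hy hvy => ?_)
    · rcases List.mem_cons.1 hx' with rfl | hx'
      · exact hvn (by simp [hx])
      · exact nPk x hx' x (by simp [hx]) rfl
    · rw [← hdone, hd2 l y hl]
    · have hyf := hd3 y ((hdone y).2 hvy)
      have hy' := hy.resolve_left hyf
      rw [hverts] at hy'
      simp only [List.cons_append, List.mem_cons, List.mem_append] at hy'
      rcases hy' with rfl | hy' | hy' | hy'
      · exact absurd hvy (G.irrefl)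
      · exact .inr hy'
      · exact .inl hy'
      · exfalso
        -- The last case would be a cross edge. By closedness `v` would lie in an earlier block or
        -- among its own proper ancestors, against the disjointness of the lists.
        have hy'' : y ∈ allVerts (g :: ks).flatten := by
          simpa [allVerts, VBlock.verts] using hy'
        rcases hg.closed y hy'' v (hA v (by simp [hverts])) hvy.symm with h' | h'
        · have h' : v ∈ allVerts g ++ allVerts ks.flatten := by
            simpa [allVerts, VBlock.verts] using h'
          exact hvn (by simp only [List.mem_append] at h' ⊢; tauto)
        · exact hvn (by simp [h'])
  by_cases hc : (g.map code).count (code b) < s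
  · rw [if_pos hc]
    have hverts' : verts ⟨t, (b :: g) :: ks, S.fresh⟩ =
        P ++ (b.verts ++ (allVerts g ++ allVerts ks.flatten)) := by
      simp [verts, path, ← hP, allVerts, VBlock.verts]
    have hperm' : (verts ⟨t, (b :: g) :: ks, S.fresh⟩).Perm S.verts := by
      rw [hverts', hverts, hbv]
      exact List.perm_middle
    have halive : alive ⟨t, (b :: g) :: ks, S.fresh⟩ = S.alive := by
      ext x
      simp only [alive, Set.mem_ofPred_eq, hperm'.mem_iff]
    refine ⟨hperm'.nodup_iff.2 h.nodup, fun x hx => h.not_fresh x (hperm'.mem_iff.1 hx), ?_, hd4, ?_,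
      ?_⟩
    · have := h.chain
      rw [hpath] at this
      exact this.tail
    · rw [halive]
      refine hg.set_head fun c hc => ?_
      rcases List.mem_cons.1 hc with rfl | hc
      · exact hbA
      · exact hg.head c hc
    · rw [halive]; exact h.equiv
  · rw [if_neg hc]
    have hverts' : verts ⟨t, g :: ks, S.fresh⟩ = P ++ (allVerts g ++ allVerts ks.flatten) := by
      simp [verts, path, ← hP, allVerts, VBlock.verts]
    have hsub : ∀ x ∈ verts ⟨t, g :: ks, S.fresh⟩, x ∈ S.verts := by
      intro x hx
      rw [hverts'] at hx
      rw [hverts]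
      simp only [List.cons_append, List.mem_cons, List.mem_append] at hx ⊢
      tauto
    have halive : alive ⟨t, g :: ks, S.fresh⟩ = S.alive \ {x | x ∈ b.verts} := by
      ext x
      simp only [alive, Set.mem_ofPred_eq, Set.mem_sdiff, hverts']
      constructor
      · rintro (hx | hx)
        · exact ⟨.inl hx, fun hx' => h.not_fresh x (hperm.mem_iff.1 (by simp [hx'])) hx⟩
        · refine ⟨.inr (hsub x (by rwa [hverts'])), fun hx' => ?_⟩
          rw [List.append_assoc, List.append_assoc, List.nodup_append] at hn
          refine hn.2.2 x hx' x ?_ rfl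
          simp only [List.mem_append] at hx ⊢
          tauto
      · rintro ⟨hx | hx, hx'⟩
        · exact .inl hx
        · right
          have := hperm.mem_iff.2 hx
          simp only [List.mem_append] at this ⊢
          tauto
    refine ⟨?_, fun x hx => h.not_fresh x (hsub x hx), ?_, hd4, ?_, fun φ hφ => ?_⟩
    · rw [hverts', List.nodup_append]
      refine ⟨nP, ngs, fun x hx y hy => nPk x hx y (List.mem_append_right _ hy)⟩
    · have := h.chain
      rw [hpath] at this
      exact this.tail
    · rw [halive]
      exact hg.mono Set.sdiff_subset
    · rw [halive, h.equiv φ hφ]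
      -- The failed test says that `s` copies of the code of `b` are already kept at the parent, so
      -- `b` may be deleted.
      refine hbA.satOn_diff_iff hg.head (fun x hx => hA x (hperm.mem_iff.1 (by simp [hx])))
        (fun x hx => hA x (by simp [hverts, hx])) ?_ (not_lt.1 hc) φ hφ
      exact (List.nodup_append.1 hn).1

/-! ### Agreement with the automaton -/

theorem auto_open (S : Search V) (v : V) (rem : List V) {t : List (SFrame V)}
    (ht : t.map SFrame.adj = S.stack.map SFrame.adj) (fresh : Set V) :
    auto ⟨⟨v, rem, []⟩ :: t, [] :: S.kept, fresh⟩ = autoStep s 1 S.auto := by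
  simp [auto, autoStep, ht]

theorem auto_back (S : Search V) {v u : V} {rem : List V} {a : List ℕ} {t : List (SFrame V)}
    (hS : S.stack = ⟨v, u :: rem, a⟩ :: t) (hK : S.kept ≠ []) (l : ℕ) :
    auto ⟨⟨v, rem, if l ∈ a then a else l :: a⟩ :: t, S.kept, S.fresh⟩ =
      autoStep s (l + 3) S.auto := by
  obtain ⟨k, ks, hk⟩ := List.exists_cons_of_ne_nil hK
  simp [auto, autoStep, hS, hk, Frame.addLevel]

theorem auto_skip (S : Search V) {v u : V} {rem : List V} {a : List ℕ} {t : List (SFrame V)}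
    (hS : S.stack = ⟨v, u :: rem, a⟩ :: t) :
    auto ⟨⟨v, rem, a⟩ :: t, S.kept, S.fresh⟩ = autoStep s 0 S.auto := by
  simp [auto, autoStep, hS]

/-- The automaton takes the level of the closed vertex from the height of its own stack. The extra
frame of the virtual root makes the number of frames under the parent's frame equal to that level.
-/
theorem auto_close (S : Search V) {v : V} {a : List ℕ} {t : List (SFrame V)}
    (hS : S.stack = ⟨v, [], a⟩ :: t) {k g : List (VBlock V)} {ks : List (List (VBlock V))}
    (hK : S.kept = k :: g :: ks) (hl : ks.length = t.length) :
    auto ⟨t, (if (g.map code).count (code ((v, (t.length, a)) :: k.flatten)) < s then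
      ((v, (t.length, a)) :: k.flatten) :: g else g) :: ks, S.fresh⟩ = autoStep s 2 S.auto := by
  have hcode : code ((v, (t.length, a)) :: k.flatten) =
      Frame.block t.length (a, k.map code) := by
    simp [code, Frame.block, List.map_flatten]
    rfl
  obtain ⟨x, r, hr⟩ : ∃ x r, t.map SFrame.adj ++ [[]] = x :: r := by
    cases t <;> simp
  have hrl : r.length = t.length := by
    have := congrArg List.length hr
    simpa using this.symm
  simp only [auto, hS, hK, List.map_cons, List.cons_append, hr, List.zipWith_cons_cons, autoStep,
    List.length_zipWith, hrl, hl, min_self, Frame.addBlock, hcode]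
  split_ifs <;> simp [hcode]

theorem length_auto (h : S.Inv G N s) : S.auto.length = S.stack.length + 1 := by
  have := h.kept.length_eq
  simp [auto, this, path]

/-- The outcome of the search. -/
theorem Inv.final (h : S.Inv G N s) (hS : S.stack = []) (hf : S.fresh = ∅) :
    ∃ b : VBlock V, S.auto = [([], S.auto.flatMap Prod.snd)] ∧
      code b = (S.auto.flatMap Prod.snd).flatten ∧ b.Describes G ∧ b.verts.Nodup ∧
      ∀ φ : FOFormula, φ.numVars ≤ s → (φ.SatOn Set.univ G.Adj (fun _ => none) ↔
        φ.SatOn {x | x ∈ b.verts} G.Adj fun _ => none) := by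
  have hp : S.path = [] := by simp [path, hS]
  have hkept := h.kept
  rw [hp] at hkept
  generalize hK : S.kept = K at hkept
  cases hkept with | @nil k hk =>
  have hverts : S.verts = allVerts k := by simp [verts, hp, hK]
  have halive : S.alive = {x | x ∈ allVerts k} := by simp [alive, hf, hverts]
  refine ⟨k.flatten, ?_, ?_, ?_, ?_, ?_⟩
  · simp [auto, hS, hK]
  · simp [auto, hS, hK, code, List.map_flatten]
    rfl
  · exact describes_flatten k hk (hverts ▸ h.nodup) (fun x hx => by rw [halive]; exact hx) (by simp)
  · show (allVerts k).Nodup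
    exact hverts ▸ h.nodup
  · intro φ hφ
    rw [h.equiv φ hφ, halive]
    rfl

end Search

/-! ## Evaluation in the reduced graph -/

namespace Block

/-- The level of a vertex. -/
def lev (b : Block) (i : ℕ) : ℕ := (b.getD i (0, [])).1

/-- The vertex `i` is an ancestor of the vertex `j`, and adjacent to it. -/
def Below (b : Block) (i j : ℕ) : Prop :=
  i < j ∧ (∀ k < j + 1, i < k → b.lev i < b.lev k) ∧ b.lev i ∈ (b.getD j (0, [])).2

/-- Adjacency in the graph described by a block. -/
def Adj (b : Block) (i j : ℕ) : Prop := b.Below i j ∨ b.Below j i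

end Block

/-- The positions in a block serve as vertices: sending a vertex to its position is an isomorphism,
because `Describes` recovers the edges from the code. -/
theorem VBlock.Describes.satOn_iff {V : Type*} {G : SimpleGraph V} {b : VBlock V}
    (hb : b.Describes G) (hn : b.verts.Nodup) (φ : FOFormula) :
    φ.SatOn {x | x ∈ b.verts} G.Adj (fun _ => none) ↔
      φ.SatOn {i | i < b.code.length} b.code.Adj fun _ => none := by
  have hcode : ∀ {i : ℕ} {z : V × Row}, b[i]? = some z → b.code.getD i (0, []) = z.2 := by
    intro i z h
    simp [VBlock.code, List.getD_eq_getElem?_getD, h]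
  have hbelow : ∀ {i j : ℕ} {x y : V × Row}, i < j → b[i]? = some x → b[j]? = some y →
      (G.Adj x.1 y.1 ↔ b.code.Below i j) := by
    intro i j x y hij hx hy
    rw [hb i j x y hij hx hy, Block.Below, Block.lev, hcode hx, hcode hy, and_iff_right hij]
    refine and_congr_left fun _ => ⟨fun h k h1 h2 => ?_, fun h k z h1 h2 h3 => ?_⟩
    · have hk : k < b.length := by
        have := (List.getElem?_eq_some_iff.1 hy).1
        omega
      have hk' := List.getElem?_eq_getElem hk
      rw [Block.lev, hcode hk']
      exact h k _ h2 (by omega) hk'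
    · have := h k (by omega) h1
      rwa [Block.lev, hcode h3] at this
  refine FOFormula.satOn_iff_of_rel (fun x i => ∃ z, b[i]? = some z ∧ z.1 = x) ?_ ?_ ?_ φ _ _
    fun _ _ => .none
  · intro x hx
    obtain ⟨z, hz, rfl⟩ := List.mem_map.1 hx
    obtain ⟨i, hi⟩ := List.mem_iff_getElem?.1 hz
    exact ⟨i, by simpa [VBlock.code] using (List.getElem?_eq_some_iff.1 hi).1, z, hi, rfl⟩
  · intro i hi
    have hi' : i < b.length := by simpa [VBlock.code] using hi
    exact ⟨b[i].1, List.mem_map_of_mem (List.getElem_mem _), _, List.getElem?_eq_getElem hi', rfl⟩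
  · rintro x i x' i' ⟨z, hz, rfl⟩ ⟨z', hz', rfl⟩
    constructor
    · refine ⟨fun e => VBlock.index_unique hn hz hz' e, ?_⟩
      rintro rfl
      rw [hz] at hz'
      simp only [Option.some.injEq] at hz'
      rw [hz']
    · have hnb : ∀ {i j}, i < j → ¬ b.code.Below j i := fun hij h => by
        have := h.1
        omega
      rcases lt_trichotomy i i' with h | rfl | h
      · rw [Block.Adj, or_iff_left (hnb h), hbelow h hz hz']
      · rw [hz] at hz'
        simp only [Option.some.injEq] at hz'
        subst hz'
        refine iff_of_false G.irrefl ?_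
        rintro (h | h) <;> exact lt_irrefl _ h.1
      · rw [Block.Adj, or_iff_right (hnb h), ← hbelow h hz' hz, G.adj_comm]

/-! ### Tables of satisfying assignments -/

/-- A set of assignments of elements of `{0, …, q - 1}`, increased by one, to variables; the value
`0` means that the variable is unassigned. -/
abbrev Table := List (List ℕ)

namespace Table

/-- All assignments for `s` variables. -/
def all (q : ℕ) : ℕ → Table
  | 0 => [[]]
  | s + 1 => (all q s).flatMap fun t => (List.range (q + 1)).map fun v => v :: t

theorem mem_all {q s : ℕ} {t : List ℕ} : t ∈ all q s ↔ t.length = s ∧ ∀ v ∈ t, v ≤ q := by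
  induction s generalizing t with
  | zero => simp +contextual [all]
  | succ s ih =>
    simp only [all, List.mem_flatMap, List.mem_map, List.mem_range]
    constructor
    · rintro ⟨t, ht, v, hv, rfl⟩
      have := ih.1 ht
      refine ⟨by simp [this.1], fun w hw => ?_⟩
      rcases List.mem_cons.1 hw with rfl | hw
      · omega
      · exact this.2 w hw
    · rintro ⟨h1, h2⟩
      rcases t with _ | ⟨v, t⟩
      · simp at h1
      · exact ⟨t, ih.2 ⟨by simpa using h1, fun w hw => h2 w (by simp [hw])⟩, v,
          Nat.lt_succ_of_le (h2 v (by simp)), rfl⟩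

/-- The condition for an assignment `t` to belong to the table of a formula with the main symbol
`op`, with variables `x` and `y` and tables `a` and `a'` for the immediate subformulas. -/
def Cond (b : Block) (op x y : ℕ) (a a' : Table) (t : List ℕ) : Prop :=
  op = 0 ∨
  (op = 2 ∧ t.getD x 0 = t.getD y 0 ∧ t.getD x 0 ≠ 0) ∨
  (op = 3 ∧ t.getD x 0 ≠ 0 ∧ t.getD y 0 ≠ 0 ∧ b.Adj (t.getD x 0 - 1) (t.getD y 0 - 1)) ∨
  (op = 4 ∧ t ∉ a) ∨
  (op = 5 ∧ t ∈ a ∧ t ∈ a') ∨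
  (op = 6 ∧ (t ∈ a ∨ t ∈ a')) ∨
  (op = 7 ∧ (t ∉ a ∨ t ∈ a')) ∨
  (op = 8 ∧ (t ∉ a ∨ t ∈ a') ∧ (t ∉ a' ∨ t ∈ a)) ∨
  (op = 9 ∧ ∃ v < b.length, t.set x (v + 1) ∈ a) ∨
  (op = 10 ∧ ∀ v < b.length, t.set x (v + 1) ∈ a)

open Classical in
/-- The table of a formula, computed from the tables of its immediate subformulas. -/
noncomputable def op (b : Block) (s op x y : ℕ) (a a' : Table) : Table :=
  (all b.length s).filter fun t => Cond b op x y a a' t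

theorem mem_op {b : Block} {s o x y : ℕ} {a a' : Table} {t : List ℕ} (ht : t ∈ all b.length s) :
    t ∈ op b s o x y a a' ↔ Cond b o x y a a' t := by
  simp [op, ht]

/-- The element for a value in an assignment. -/
def value : ℕ → Option ℕ
  | 0 => none
  | v + 1 => some v

/-- The assignment to variable names given by `t`, where `ι` gives the indices of the names. -/
def assign (ι : ℕ → ℕ) (t : List ℕ) (x : ℕ) : Option ℕ := value (t.getD (ι x) 0)

/-- The table `a` is correct for `φ`. -/
def Correct (b : Block) (s : ℕ) (ι : ℕ → ℕ) (φ : FOFormula) (a : Table) : Prop :=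
  ∀ t ∈ all b.length s, (t ∈ a ↔ φ.SatOn {i | i < b.length} b.Adj (assign ι t))

section Correct

variable {b : Block} {s : ℕ} {ι : ℕ → ℕ} {φ ψ : FOFormula} {a a' : Table}

theorem value_eq_some {v i : ℕ} : value v = some i ↔ v = i + 1 := by
  cases v <;> simp [value]

theorem Correct.tru (x y : ℕ) : Correct b s ι .tru (op b s 0 x y a a') := fun t ht => by
  simp [mem_op ht, Cond, FOFormula.SatOn]

theorem Correct.fls (x y : ℕ) : Correct b s ι .fls (op b s 1 x y a a') := fun t ht => by
  simp [mem_op ht, Cond, FOFormula.SatOn]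

theorem Correct.eq (x y : ℕ) : Correct b s ι (.eq x y) (op b s 2 (ι x) (ι y) a a') :=
  fun t ht => by
    simp only [mem_op ht, Cond, FOFormula.SatOn, assign, value_eq_some]
    generalize t.getD (ι x) 0 = u
    generalize t.getD (ι y) 0 = v
    rcases u with _ | u <;> simp [eq_comm]

theorem Correct.adj (x y : ℕ) : Correct b s ι (.adj x y) (op b s 3 (ι x) (ι y) a a') :=
  fun t ht => by
    simp only [mem_op ht, Cond, FOFormula.SatOn, assign, value_eq_some]
    generalize t.getD (ι x) 0 = u
    generalize t.getD (ι y) 0 = v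
    rcases u with _ | u <;> rcases v with _ | v <;> simp [eq_comm]

theorem Correct.neg (h : Correct b s ι φ a) (x y : ℕ) :
    Correct b s ι (.neg φ) (op b s 4 x y a a') := fun t ht => by
  simp [mem_op ht, Cond, FOFormula.SatOn, h t ht]

theorem Correct.and (h : Correct b s ι φ a) (h' : Correct b s ι ψ a') (x y : ℕ) :
    Correct b s ι (.and φ ψ) (op b s 5 x y a a') := fun t ht => by
  simp [mem_op ht, Cond, FOFormula.SatOn, h t ht, h' t ht]

theorem Correct.or (h : Correct b s ι φ a) (h' : Correct b s ι ψ a') (x y : ℕ) :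
    Correct b s ι (.or φ ψ) (op b s 6 x y a a') := fun t ht => by
  simp [mem_op ht, Cond, FOFormula.SatOn, h t ht, h' t ht]

theorem Correct.imp (h : Correct b s ι φ a) (h' : Correct b s ι ψ a') (x y : ℕ) :
    Correct b s ι (.imp φ ψ) (op b s 7 x y a a') := fun t ht => by
  simp [mem_op ht, Cond, FOFormula.SatOn, h t ht, h' t ht, imp_iff_not_or]

theorem Correct.iff (h : Correct b s ι φ a) (h' : Correct b s ι ψ a') (x y : ℕ) :
    Correct b s ι (.iff φ ψ) (op b s 8 x y a a') := fun t ht => by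
  simp [mem_op ht, Cond, FOFormula.SatOn, h t ht, h' t ht, ← imp_iff_not_or, iff_iff_implies_and_implies]

/-- Because `ι` is injective on the names involved, overwriting the entry `ι x` rebinds `x` and no
other name. The value `v` is stored as `v + 1`, as `0` stands for an unassigned name. -/
theorem satOn_set_iff (hι : Set.InjOn ι (insert x φ.vars : Finset ℕ)) (hx : ι x < s) {t : List ℕ}
    (ht : t.length = s) (v : ℕ) :
    φ.SatOn {i | i < b.length} b.Adj (assign ι (t.set (ι x) (v + 1))) ↔
      φ.SatOn {i | i < b.length} b.Adj (Function.update (assign ι t) x (some v)) := by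
  refine FOFormula.satOn_iff_of_rel Eq (fun x h => ⟨x, h, rfl⟩) (fun x h => ⟨x, h, rfl⟩)
    (by rintro x _ y _ rfl rfl; simp) φ _ _ fun z hz => ?_
  have : assign ι (t.set (ι x) (v + 1)) z = Function.update (assign ι t) x (some v) z := by
    by_cases hzx : z = x
    · subst hzx
      simp [assign, List.getD_eq_getElem?_getD, ht, hx, value]
    · have hne : ι x ≠ ι z := fun e => hzx (hι (by simp) (by simp [hz]) e).symm
      simp [assign, List.getD_eq_getElem?_getD, hzx, hne]
  rw [this]
  cases Function.update (assign ι t) x (some v) z with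
  | none => exact .none
  | some w => exact .some rfl

theorem set_mem_all {t : List ℕ} {q : ℕ} (ht : t ∈ all q s) {v : ℕ} (hv : v < q) (i : ℕ) :
    t.set i (v + 1) ∈ all q s := by
  rw [mem_all] at ht ⊢
  refine ⟨by simp [ht.1], fun w hw => ?_⟩
  rcases List.mem_or_eq_of_mem_set hw with h | rfl
  · exact ht.2 w h
  · exact hv

theorem Correct.ex {x : ℕ} (h : Correct b s ι φ a) (hι : Set.InjOn ι (insert x φ.vars : Finset ℕ))
    (hx : ι x < s) (y : ℕ) : Correct b s ι (.ex x φ) (op b s 9 (ι x) y a a') := fun t ht => by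
  have : (∃ v < b.length, t.set (ι x) (v + 1) ∈ a) ↔ ∃ v ∈ {i | i < b.length},
      φ.SatOn {i | i < b.length} b.Adj (Function.update (assign ι t) x (some v)) :=
    exists_congr fun v => and_congr_right fun hv => by
      rw [h _ (set_mem_all ht hv _), satOn_set_iff hι hx (mem_all.1 ht).1]
  simpa [mem_op ht, Cond, FOFormula.SatOn] using this

theorem Correct.all {x : ℕ} (h : Correct b s ι φ a) (hι : Set.InjOn ι (insert x φ.vars : Finset ℕ))
    (hx : ι x < s) (y : ℕ) : Correct b s ι (.all x φ) (op b s 10 (ι x) y a a') := fun t ht => by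
  have : (∀ v < b.length, t.set (ι x) (v + 1) ∈ a) ↔ ∀ v ∈ {i | i < b.length},
      φ.SatOn {i | i < b.length} b.Adj (Function.update (assign ι t) x (some v)) :=
    forall_congr' fun v => forall_congr' fun hv => by
      rw [h _ (set_mem_all ht hv _), satOn_set_iff hι hx (mem_all.1 ht).1]
  simpa [mem_op ht, Cond, FOFormula.SatOn] using this

/-- The truth of a sentence can be read off from its table. -/
theorem Correct.models (h : Correct b s ι φ a) : List.replicate s 0 ∈ a ↔
    φ.SatOn {i | i < b.length} b.Adj fun _ => none := by
  rw [h _ (mem_all.2 ⟨by simp, by simp⟩)]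
  have : assign ι (List.replicate s 0) = fun _ => none := by
    funext x
    simp only [assign, List.getD_eq_getElem?_getD, List.getElem?_replicate]
    split_ifs <;> rfl
  rw [this]

end Correct

open Encodable in
theorem encode_le_of_sublist {α : Type*} [Encodable α] {l l' : List α} (h : l.Sublist l') :
    encode l ≤ encode l' := by
  induction h with
  | slnil => rfl
  | cons a _ ih =>
    rw [encode_list_cons]
    exact ih.trans ((Nat.right_le_pair _ _).trans (Nat.le_succ _))
  | cons_cons a _ ih =>
    rw [encode_list_cons, encode_list_cons]
    exact Nat.succ_le_succ (Nat.pair_mono le_rfl ih)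

/-- Every table is filtered from the list of all assignments, and a sublist has no larger code. So
one bound serves all tables, however long the formula is. -/
theorem encode_op_le (b : Block) (s o x y : ℕ) (a a' : Table) :
    Encodable.encode (op b s o x y a a') ≤ Encodable.encode (all b.length s) :=
  encode_le_of_sublist List.filter_sublist

/-! ### The operations on tables are primitive recursive -/

section Primrec

open Primrec

theorem primrec_all : Primrec₂ all := by
  refine (nat_rec' (f := fun p : ℕ × ℕ => p.2) (g := fun _ => ([[]] : Table))
    (h := fun p r => r.2.flatMap fun t => (List.range (p.1 + 1)).map fun v => v :: t) .snd (.const _)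
    ?_).of_eq ?_
  · refine list_flatMap (f := fun p : (ℕ × ℕ) × (ℕ × Table) => p.2.2)
      (g := fun p t => (List.range (p.1.1 + 1)).map fun v => v :: t) (snd.comp .snd) ?_
    refine list_map (f := fun p : ((ℕ × ℕ) × (ℕ × Table)) × List ℕ => List.range (p.1.1.1 + 1))
      (g := fun p v => v :: p.2) (list_range.comp (succ.comp (fst.comp (fst.comp .fst)))) ?_
    exact list_cons.comp .snd (snd.comp .fst)
  · rintro ⟨q, s⟩
    induction s with
    | zero => rfl
    | succ s ih => simp only at ih ⊢; rw [ih]; rfl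

theorem _root_.Block.primrec_lev : Primrec₂ Block.lev := fst.comp (list_getD _)

theorem _root_.primrecRel_mem {α : Type*} [Primcodable α] :
    PrimrecRel fun (x : α) (l : List α) => x ∈ l := by
  have : PrimrecRel fun (L : List α) b => ∃ a ∈ L, a = b := PrimrecRel.exists_mem_list Primrec.eq
  exact (this.comp .snd .fst).of_eq fun p => by simp

theorem _root_.Block.primrecRel_below :
    PrimrecRel fun (b : Block) (p : ℕ × ℕ) => b.Below p.1 p.2 := by
  have h : PrimrecRel fun (k : ℕ) (p : Block × ℕ) => p.2 < k → p.1.lev p.2 < p.1.lev k := by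
    refine PrimrecPred.of_eq (p := fun q : ℕ × (Block × ℕ) =>
      ¬ q.2.2 < q.1 ∨ q.2.1.lev q.2.2 < q.2.1.lev q.1) (.or (.not ?_) ?_) fun q => imp_iff_not_or.symm
    · exact nat_lt.comp (snd.comp .snd) .fst
    · exact nat_lt.comp (Block.primrec_lev.comp (fst.comp .snd) (snd.comp .snd))
        (Block.primrec_lev.comp (fst.comp .snd) .fst)
  have h' := h.forall_mem_list
  have h'' : PrimrecPred fun p : Block × (ℕ × ℕ) =>
      ∀ k < p.2.2 + 1, p.2.1 < k → p.1.lev p.2.1 < p.1.lev k :=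
    (h'.comp (f := fun p : Block × (ℕ × ℕ) => List.range (p.2.2 + 1)) (g := fun p => (p.1, p.2.1))
      (list_range.comp (succ.comp (snd.comp .snd))) (.pair .fst (fst.comp .snd))).of_eq
      fun p => by simp only [List.mem_range]
  refine PrimrecPred.and (nat_lt.comp (fst.comp .snd) (snd.comp .snd)) (PrimrecPred.and h'' ?_)
  exact primrecRel_mem.comp (Block.primrec_lev.comp .fst (fst.comp .snd))
    (snd.comp ((list_getD _).comp .fst (snd.comp .snd)))

/-- The arguments of `Table.op`. -/
abbrev Args := (Block × ℕ) × ((ℕ × ℕ × ℕ) × (Table × Table))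

theorem primrec_op : Primrec fun p : Args =>
    op p.1.1 p.1.2 p.2.1.1 p.2.1.2.1 p.2.1.2.2 p.2.2.1 p.2.2.2 := by
  classical
  have ht : Primrec fun q : List ℕ × Args => q.1 := .fst
  have hb : Primrec fun q : List ℕ × Args => q.2.1.1 := fst.comp (fst.comp .snd)
  have ho : Primrec fun q : List ℕ × Args => q.2.2.1.1 := fst.comp (fst.comp (snd.comp .snd))
  have hx : Primrec fun q : List ℕ × Args => q.2.2.1.2.1 :=
    fst.comp (snd.comp (fst.comp (snd.comp .snd)))
  have hy : Primrec fun q : List ℕ × Args => q.2.2.1.2.2 :=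
    snd.comp (snd.comp (fst.comp (snd.comp .snd)))
  have ha : Primrec fun q : List ℕ × Args => q.2.2.2.1 := fst.comp (snd.comp (snd.comp .snd))
  have ha' : Primrec fun q : List ℕ × Args => q.2.2.2.2 := snd.comp (snd.comp (snd.comp .snd))
  have hc : ∀ m, PrimrecPred fun q : List ℕ × Args => q.2.2.1.1 = m := fun m =>
    Primrec.eq.comp ho (.const m)
  have hm : PrimrecPred fun q : List ℕ × Args => q.1 ∈ q.2.2.2.1 := primrecRel_mem.comp ht ha
  have hm' : PrimrecPred fun q : List ℕ × Args => q.1 ∈ q.2.2.2.2 := primrecRel_mem.comp ht ha'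
  have hvx : Primrec fun q : List ℕ × Args => q.1.getD q.2.2.1.2.1 0 := (list_getD 0).comp ht hx
  have hvy : Primrec fun q : List ℕ × Args => q.1.getD q.2.2.1.2.2 0 := (list_getD 0).comp ht hy
  have hvx0 : PrimrecPred fun q : List ℕ × Args => q.1.getD q.2.2.1.2.1 0 ≠ 0 :=
    (Primrec.eq.comp hvx (.const 0)).not
  have hvy0 : PrimrecPred fun q : List ℕ × Args => q.1.getD q.2.2.1.2.2 0 ≠ 0 :=
    (Primrec.eq.comp hvy (.const 0)).not
  have hadj : PrimrecPred fun q : List ℕ × Args =>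
      q.2.1.1.Adj (q.1.getD q.2.2.1.2.1 0 - 1) (q.1.getD q.2.2.1.2.2 0 - 1) :=
    .or (Block.primrecRel_below.comp hb (.pair (nat_sub.comp hvx (.const 1))
      (nat_sub.comp hvy (.const 1)))) (Block.primrecRel_below.comp hb
      (.pair (nat_sub.comp hvy (.const 1)) (nat_sub.comp hvx (.const 1))))
  have hset : PrimrecRel fun (v : ℕ) (q : List ℕ × Args) =>
      q.1.set q.2.2.1.2.1 (v + 1) ∈ q.2.2.2.1 :=
    primrecRel_mem.comp (list_set.comp (ht.comp .snd) (.pair (hx.comp .snd) (succ.comp .fst)))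
      (ha.comp .snd)
  have hlen : Primrec fun q : List ℕ × Args => q.2.1.1.length := list_length.comp hb
  have hset' := hset.exists_mem_list
  have hset'' := hset.forall_mem_list
  have hex : PrimrecPred fun q : List ℕ × Args =>
      ∃ v < q.2.1.1.length, q.1.set q.2.2.1.2.1 (v + 1) ∈ q.2.2.2.1 :=
    (hset'.comp (list_range.comp hlen) .id).of_eq fun p => by simp only [List.mem_range, id]
  have hall : PrimrecPred fun q : List ℕ × Args =>
      ∀ v < q.2.1.1.length, q.1.set q.2.2.1.2.1 (v + 1) ∈ q.2.2.2.1 :=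
    (hset''.comp (list_range.comp hlen) .id).of_eq fun p => by simp only [List.mem_range, id]
  have key : PrimrecRel fun (t : List ℕ) (p : Args) =>
      Cond p.1.1 p.2.1.1 p.2.1.2.1 p.2.1.2.2 p.2.2.1 p.2.2.2 t :=
    (hc 0).or <| ((hc 2).and ((Primrec.eq.comp hvx hvy).and hvx0)).or <|
    ((hc 3).and (hvx0.and (hvy0.and hadj))).or <|
    ((hc 4).and hm.not).or <| ((hc 5).and (hm.and hm')).or <| ((hc 6).and (hm.or hm')).or <|
    ((hc 7).and (hm.not.or hm')).or <| ((hc 8).and ((hm.not.or hm').and (hm'.not.or hm))).or <|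
    ((hc 9).and hex).or <| (hc 10).and hall
  exact key.listFilter.comp (primrec_all.comp (list_length.comp (fst.comp .fst)) (snd.comp .fst)) .id

end Primrec

end Table

/-! ## Reading the input -/

namespace FOFormula

/-- The immediate subformulas. -/
def subs : FOFormula → List FOFormula
  | tru => [] | fls => [] | eq _ _ => [] | adj _ _ => []
  | neg φ => [φ]
  | and φ ψ => [φ, ψ] | or φ ψ => [φ, ψ] | imp φ ψ => [φ, ψ] | iff φ ψ => [φ, ψ]
  | ex _ φ => [φ] | all _ φ => [φ]

/-- The main symbol. -/
def symbol : FOFormula → ℕ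
  | tru => 0 | fls => 1 | eq _ _ => 2 | adj _ _ => 3 | neg _ => 4
  | and _ _ => 5 | or _ _ => 6 | imp _ _ => 7 | iff _ _ => 8 | ex _ _ => 9 | all _ _ => 10

/-- The variable names that follow the main symbol. -/
def names : FOFormula → List ℕ
  | eq x y => [x, y] | adj x y => [x, y] | ex x _ => [x] | all x _ => [x]
  | _ => []

/-- The concatenation of formulas as strings of symbols. -/
def encodeAll (F : List FOFormula) : List ℕ := F.flatMap encode

/-- All variable names in a list of formulas. -/
def varsAll (F : List FOFormula) : Finset ℕ := F.foldr (fun φ X => φ.vars ∪ X) ∅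

theorem encode_eq (φ : FOFormula) : φ.encode = φ.symbol :: (φ.names ++ encodeAll φ.subs) := by
  cases φ <;> simp [encode, symbol, names, encodeAll, subs]

theorem vars_eq (φ : FOFormula) : φ.vars = φ.names.toFinset ∪ varsAll φ.subs := by
  cases φ <;> simp [vars, names, varsAll, subs]

theorem varsAll_append (F F' : List FOFormula) : varsAll (F ++ F') = varsAll F ∪ varsAll F' := by
  induction F with
  | nil => simp [varsAll]
  | cons φ F ih => simp only [varsAll, List.cons_append, List.foldr_cons] at ih ⊢; rw [ih]; simp

theorem encodeAll_append (F F' : List FOFormula) :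
    encodeAll (F ++ F') = encodeAll F ++ encodeAll F' := by simp [encodeAll]

theorem encodeAll_eq_nil {F : List FOFormula} (h : encodeAll F = []) : F = [] := by
  rcases F with _ | ⟨φ, F⟩
  · rfl
  · simp [encodeAll, encode_eq] at h

theorem symbol_le (φ : FOFormula) : φ.symbol ≤ 10 := by cases φ <;> simp [symbol]

/-- The formulas that remain to be read after the first `j` symbols that are not variable names. -/
def pending (φ : FOFormula) : ℕ → List FOFormula
  | 0 => [φ]
  | j + 1 => match pending φ j with
    | [] => []
    | ψ :: F => ψ.subs ++ F

theorem pending_succ {φ ψ : FOFormula} {F : List FOFormula} {j : ℕ} (h : φ.pending j = ψ :: F) :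
    φ.pending (j + 1) = ψ.subs ++ F := by simp [pending, h]

end FOFormula

/-- The invariants of the reading loops describe the suffix of the input at the current position;
this extracts the next cell from such a description. -/
theorem List.getD_of_drop_eq_cons {w t : List ℕ} {i x : ℕ} (h : w.drop i = x :: t) :
    w.getD i 0 = x ∧ w.drop (i + 1) = t ∧ i < w.length := by
  have h0 : w[i]? = some x := by rw [← List.head?_drop, h]; rfl
  refine ⟨by simp [List.getD_eq_getElem?_getD, h0], ?_, (List.getElem?_eq_some_iff.1 h0).1⟩
  rw [← List.tail_drop, h]
  rfl

theorem List.getD_of_cons_isPrefix_drop {w t : List ℕ} {i x : ℕ} (h : x :: t <+: w.drop i) :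
    w.getD i 0 = x ∧ t <+: w.drop (i + 1) ∧ i < w.length := by
  obtain ⟨r, hr⟩ := h
  obtain ⟨h1, h2, h3⟩ := List.getD_of_drop_eq_cons hr.symm
  exact ⟨h1, ⟨r, h2.symm⟩, h3⟩

namespace RAM

open NExpr NProg Reg Arr

/-! ### The adjacency lists -/

/-- Reads the number of vertices. -/
def initProg : NProg := .seq (.set size (.inp (.lit 0))) (.set cur (.lit 1))

/-- Finds the adjacency list of the vertex `next`. -/
def listsProg : NProg :=
  .seq (.put ptr (.reg next) (.add (.reg cur) (.lit 1)))
  (.seq (.put rem (.reg next) (.inp (.reg cur)))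
  (.seq (.set cur (.add (.add (.reg cur) (.inp (.reg cur))) (.lit 1)))
    (.set next (.add (.reg next) (.lit 1)))))

/-- The entry of the input for the vertex `u`. -/
def listEntry {n : ℕ} (N : Fin n → List (Fin n)) (u : Fin n) : List ℕ :=
  (N u).length :: (N u).map Fin.val

/-- The adjacency list of `u` has been found. -/
def ListOK (w : List ℕ) {n : ℕ} (N : Fin n → List (Fin n)) (S : NState) (u : Fin n) : Prop :=
  S.arr rem u = (N u).length ∧ (N u).map Fin.val <+: w.drop (S.arr ptr u)

/-- The invariant of the loop that reads the adjacency lists. -/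
structure ListsInv (w : List ℕ) {n : ℕ} (N : Fin n → List (Fin n)) (φ : FOFormula) (S : NState) :
    Prop where
  size : S.reg size = n
  len : S.reg len = w.length
  names : S.reg names = 0
  count : S.reg count = 0
  height : S.reg height = 0
  status : ∀ i, S.arr status i = 0
  idx : ∀ i, S.arr idx i = 0
  vals : ∀ i, S.arr vals i = 0
  next : S.reg next ≤ n
  drop : w.drop (S.reg cur) = ((List.finRange n).drop (S.reg Reg.next)).flatMap (listEntry N) ++
    φ.encode
  lists : ∀ u : Fin n, u.1 < S.reg Reg.next → ListOK w N S u

theorem listsInv_init {n : ℕ} (N : Fin n → List (Fin n)) (φ : FOFormula) :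
    ListsInv (modelCheckingInput N φ) N φ ((initProg.run (modelCheckingInput N φ)
      ⟨fun x => if x = len then (modelCheckingInput N φ).length else 0, fun _ _ => 0⟩)) := by
  have hm : (modelCheckingInput N φ).getD 0 0 = n := rfl
  constructor <;> simp [initProg, NProg.run, NState.set_reg, NExpr.eval, NState.mem_of_lt, hm]
  case drop => rfl
  case size => rfl

/-- The suffix at `cur` starts with the entry of the vertex `next`, so its first cell is the degree
and tells how far to skip. The list itself is not copied; `ptr` remembers where it starts. -/
theorem listsInv_step {w : List ℕ} {n : ℕ} {N : Fin n → List (Fin n)} {φ : FOFormula} {S : NState}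
    (h : ListsInv w N φ S) (h0 : (NExpr.sub (.reg Reg.size) (.reg Reg.next)).eval w S ≠ 0) :
    ListsInv w N φ (listsProg.run w S) ∧
      n - (listsProg.run w S).reg Reg.next < n - S.reg Reg.next ∧ listsProg.dynCost w S ≤ 0 := by
  have hlt : S.reg Reg.next < n := by
    have := h.size
    simp only [NExpr.eval] at h0
    omega
  have hdrop := h.drop
  rw [List.drop_eq_getElem_cons (l := List.finRange n) (by simpa using hlt), List.flatMap_cons, listEntry] at hdrop
  simp only [List.getElem_finRange, List.cons_append, List.append_assoc] at hdrop
  obtain ⟨h1, h2, h3⟩ := List.getD_of_drop_eq_cons hdrop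
  set v : Fin n := Fin.cast (by simp) (⟨S.reg Reg.next, by simpa using hlt⟩ : Fin (List.finRange n).length) with hv
  have hv1 : v.1 = S.reg Reg.next := rfl
  have hm : ∀ T : NState, T.mem w (S.reg cur) = (N v).length := fun T => by
    rw [NState.mem_of_lt _ (by omega), h1]
  have hs : listsProg.run w S = (((S.put ptr (S.reg Reg.next) (S.reg cur + 1)).put rem
      (S.reg Reg.next) (N v).length).set cur (S.reg cur + (N v).length + 1)).set Reg.next
        (S.reg Reg.next + 1) := by
    simp [listsProg, NProg.run, NExpr.eval, hm, NState.set_reg]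
  rw [hs]
  refine ⟨⟨?_, ?_, ?_, ?_, ?_, ?_, ?_, ?_, ?_, ?_, ?_⟩, ?_, ?_⟩
  · simp [NState.set_reg, h.size]
  · simp [NState.set_reg, h.len]
  · simp [NState.set_reg, h.names]
  · simp [NState.set_reg, h.count]
  · simp [NState.set_reg, h.height]
  · simp [NState.put_arr, h.status]
  · simp [NState.put_arr, h.idx]
  · simp [NState.put_arr, h.vals]
  · simp [NState.set_reg]; omega
  · have e : S.reg cur + (N v).length + 1 = S.reg cur + 1 + ((N v).map Fin.val).length := by
      simp; omega
    have := congrArg (List.drop ((N v).map Fin.val).length) h2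
    rw [List.drop_drop, List.drop_left, ← e] at this
    simpa [NState.set_reg] using this
  · intro u hu
    simp only [NState.set_reg, if_true] at hu
    by_cases e : u = v
    · subst e
      refine ⟨by simp [NState.put_arr, ← hv1], ?_⟩
      simp only [NState.set_arr, NState.put_arr, ← hv1]
      simp only [reduceCtorEq, false_and, if_false, and_self, if_true]
      rw [h2]
      exact List.prefix_append _ _
    · have e' : u.1 ≠ S.reg Reg.next := fun e' => e (Fin.ext (e'.trans hv1.symm))
      obtain ⟨g1, g2⟩ := h.lists u (by omega)
      exact ⟨by simpa [NState.put_arr, e'] using g1, by simpa [NState.put_arr, e'] using g2⟩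
  · simp [NState.set_reg]; omega
  · simp [listsProg, NProg.dynCost]

/-! ### The formula -/

/-- Assigns an index to a variable name. -/
def NState.addName (S : NState) (x : ℕ) : NState :=
  if S.arr idx x = 0 then (S.set names (S.reg names + 1)).put idx x (S.reg names + 1) else S

theorem NState.addName_reg (S : NState) (x : ℕ) {y : Reg} (hy : y ≠ names) :
    (S.addName x).reg y = S.reg y := by
  rw [addName]; split_ifs <;> simp [set_reg, hy]

theorem NState.addName_arr (S : NState) (x : ℕ) {a : Arr} (ha : a ≠ idx) :
    (S.addName x).arr a = S.arr a := by
  rw [addName]; split_ifs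
  · funext i; simp [put_arr, ha]
  · rfl

/-- Assigns an index to the variable name that is `k` symbols after the current one. -/
def nameProg (k : ℕ) : NProg :=
  .ite (.arr idx (.inp (.add (.reg cur) (.lit k)))) .skip
    (.seq (.set names (.add (.reg names) (.lit 1)))
      (.put idx (.inp (.add (.reg cur) (.lit k))) (.reg names)))

/-- Arrays are addressed directly by variable names, so finding out whether a name is new takes
constant time, however large the name is. -/
theorem nameProg_run {w : List ℕ} {S : NState} {k x : ℕ} (h : S.reg cur < w.length) (hk : k ≤ 3)
    (hx : w.getD (S.reg cur + k) 0 = x) : (nameProg k).run w S = S.addName x := by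
  have hm : ∀ T : NState, T.mem w (S.reg cur + k) = x := fun T => by
    rw [NState.mem_of_lt _ (by omega), hx]
  simp [nameProg, NProg.run, NExpr.eval, hm, NState.addName, NState.set_reg]

/-- Reads a symbol that is not a variable name, and the variable names after it. -/
def parseProg : NProg :=
  .seq (.put pos (.reg count) (.reg cur))
  (.seq (.set count (.add (.reg count) (.lit 1)))
  (.seq (.set event (.inp (.reg cur)))
  (.ite (.sub (.reg event) (.lit 8))
    (.seq (nameProg 1) (.set cur (.add (.reg cur) (.lit 2))))
  (.ite (.sub (.reg event) (.lit 3))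
    (.set cur (.add (.reg cur) (.lit 1)))
  (.ite (.sub (.reg event) (.lit 1))
    (.seq (nameProg 1) (.seq (nameProg 2) (.set cur (.add (.reg cur) (.lit 3)))))
    (.set cur (.add (.reg cur) (.lit 1))))))))

/-- Truncated subtraction of `8`, `3` and `1` separates, in turn, the quantifiers, the connectives,
the atoms and the constants, and thereby the number of names to be read. -/
theorem parseProg_run {w : List ℕ} {S : NState} {φ : FOFormula} {t : List ℕ}
    (h : w.drop (S.reg cur) = φ.symbol :: (φ.names ++ t)) :
    parseProg.run w S = (φ.names.foldl NState.addName (((S.put pos (S.reg count) (S.reg cur)).set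
      count (S.reg count + 1)).set event φ.symbol)).set cur (S.reg cur + 1 + φ.names.length) := by
  obtain ⟨h1, h2, h3⟩ := List.getD_of_drop_eq_cons h
  have hm : ∀ T : NState, T.mem w (S.reg cur) = φ.symbol := fun T => by
    rw [NState.mem_of_lt _ (by omega), h1]
  have hone : ∀ {x : ℕ} {r : List ℕ}, φ.names ++ t = x :: r → w.getD (S.reg cur + 1) 0 = x :=
    fun e => (List.getD_of_drop_eq_cons (h2.trans e)).1
  have htwo : ∀ {x y : ℕ} {r : List ℕ}, φ.names ++ t = x :: y :: r →
      w.getD (S.reg cur + 2) 0 = y := fun e =>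
    (List.getD_of_drop_eq_cons (List.getD_of_drop_eq_cons (h2.trans e)).2.1).1
  simp only [parseProg, NProg.run, NExpr.eval, NState.set_reg, NState.put_reg, reduceCtorEq,
    if_true, if_false, hm]
  cases φ with
  | eq x y =>
    have e1 := nameProg_run (w := w) (k := 1) (x := x) (S := ((S.put pos (S.reg Reg.count)
      (S.reg cur)).set Reg.count (S.reg Reg.count + 1)).set event 2)
      (by simpa [NState.set_reg] using h3) (by omega) (by simpa [NState.set_reg] using hone rfl)
    have e2 := nameProg_run (w := w) (k := 2) (x := y) (S := (((S.put pos (S.reg Reg.count)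
      (S.reg cur)).set Reg.count (S.reg Reg.count + 1)).set event 2).addName x)
      (by simpa [NState.addName_reg, NState.set_reg] using h3) (by omega)
      (by simpa [NState.addName_reg, NState.set_reg] using htwo rfl)
    simp [FOFormula.symbol, FOFormula.names, e1, e2, NState.addName_reg, NState.set_reg]
  | adj x y =>
    have e1 := nameProg_run (w := w) (k := 1) (x := x) (S := ((S.put pos (S.reg Reg.count)
      (S.reg cur)).set Reg.count (S.reg Reg.count + 1)).set event 3)
      (by simpa [NState.set_reg] using h3) (by omega) (by simpa [NState.set_reg] using hone rfl)
    have e2 := nameProg_run (w := w) (k := 2) (x := y) (S := (((S.put pos (S.reg Reg.count)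
      (S.reg cur)).set Reg.count (S.reg Reg.count + 1)).set event 3).addName x)
      (by simpa [NState.addName_reg, NState.set_reg] using h3) (by omega)
      (by simpa [NState.addName_reg, NState.set_reg] using htwo rfl)
    simp [FOFormula.symbol, FOFormula.names, e1, e2, NState.addName_reg, NState.set_reg]
  | ex x φ =>
    have e1 := nameProg_run (w := w) (k := 1) (x := x) (S := ((S.put pos (S.reg Reg.count)
      (S.reg cur)).set Reg.count (S.reg Reg.count + 1)).set event 9)
      (by simpa [NState.set_reg] using h3) (by omega) (by simpa [NState.set_reg] using hone rfl)
    simp [FOFormula.symbol, FOFormula.names, e1, NState.addName_reg, NState.set_reg]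
  | all x φ =>
    have e1 := nameProg_run (w := w) (k := 1) (x := x) (S := ((S.put pos (S.reg Reg.count)
      (S.reg cur)).set Reg.count (S.reg Reg.count + 1)).set event 10)
      (by simpa [NState.set_reg] using h3) (by omega) (by simpa [NState.set_reg] using hone rfl)
    simp [FOFormula.symbol, FOFormula.names, e1, NState.addName_reg, NState.set_reg]
  | _ => simp [FOFormula.symbol, FOFormula.names, NState.set_reg]

/-- The variable names in `X` have distinct indices. -/
structure NamesOK (X : Finset ℕ) (S : NState) : Prop where
  names : S.reg names = X.card
  idx_ne_zero : ∀ x, S.arr idx x ≠ 0 ↔ x ∈ X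
  inj : ∀ x ∈ X, ∀ y ∈ X, S.arr idx x = S.arr idx y → x = y
  le : ∀ x, S.arr idx x ≤ X.card

/-- Indices run from `1` to the number of names seen, and `0` marks an unseen name. A new name
receives an index above all earlier ones. -/
theorem NamesOK.addName {X : Finset ℕ} {S : NState} (h : NamesOK X S) (x : ℕ) :
    NamesOK (insert x X) (S.addName x) := by
  rw [NState.addName]
  by_cases hx : S.arr idx x = 0
  · have hxX : x ∉ X := fun hxX => (h.idx_ne_zero x).2 hxX hx
    have harr : ∀ y, ((S.set Reg.names (S.reg Reg.names + 1)).put idx x (S.reg Reg.names + 1)).arr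
        idx y = if y = x then X.card + 1 else S.arr idx y := fun y => by
      simp [NState.put_arr, h.names]
    rw [if_pos hx]
    refine ⟨by simp [NState.set_reg, h.names, hxX], fun y => ?_, fun y hy z hz => ?_, fun y => ?_⟩
    · rw [harr]
      by_cases e : y = x
      · simp [e]
      · simp [e, h.idx_ne_zero]
    · rw [harr, harr]
      have hy' := h.le y
      have hz' := h.le z
      split_ifs with e1 e2 e2
      · exact fun _ => e1.trans e2.symm
      · intro e; omega
      · intro e; omega
      · exact h.inj y (Finset.mem_of_mem_insert_of_ne hy e1) z (Finset.mem_of_mem_insert_of_ne hz e2)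
    · rw [harr, Finset.card_insert_of_notMem hxX]
      have := h.le y
      split_ifs <;> omega
  · rw [if_neg hx, Finset.insert_eq_of_mem ((h.idx_ne_zero x).1 hx)]
    exact h

theorem foldl_addName_reg (l : List ℕ) (S : NState) {y : Reg} (hy : y ≠ names) :
    (l.foldl NState.addName S).reg y = S.reg y := by
  induction l generalizing S with
  | nil => rfl
  | cons x l ih => rw [List.foldl_cons, ih, NState.addName_reg _ _ hy]

theorem foldl_addName_arr (l : List ℕ) (S : NState) {a : Arr} (ha : a ≠ idx) :
    (l.foldl NState.addName S).arr a = S.arr a := by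
  induction l generalizing S with
  | nil => rfl
  | cons x l ih => rw [List.foldl_cons, ih, NState.addName_arr _ _ ha]

theorem NamesOK.foldl {X : Finset ℕ} {S : NState} (h : NamesOK X S) (l : List ℕ) :
    NamesOK (l.toFinset ∪ X) (l.foldl NState.addName S) := by
  induction l generalizing S X with
  | nil => simpa using h
  | cons x l ih => simpa using ih (h.addName x)

theorem NamesOK.congr {X : Finset ℕ} {S T : NState} (h : NamesOK X S)
    (h1 : T.reg Reg.names = S.reg Reg.names) (h2 : T.arr idx = S.arr idx) : NamesOK X T :=
  ⟨h1 ▸ h.names, h2 ▸ h.idx_ne_zero, h2 ▸ h.inj, h2 ▸ h.le⟩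

/-- The invariant of the loop that reads the formula. -/
structure ParseInv (w : List ℕ) {n : ℕ} (N : Fin n → List (Fin n)) (φ : FOFormula) (S : NState) :
    Prop where
  size : S.reg size = n
  len : S.reg len = w.length
  height : S.reg height = 0
  status : ∀ i, S.arr status i = 0
  vals : ∀ i, S.arr vals i = 0
  lists : ∀ u : Fin n, ListOK w N S u
  drop : w.drop (S.reg cur) = FOFormula.encodeAll (φ.pending (S.reg count))
  pos : ∀ j < S.reg count, φ.pending j ≠ [] ∧
    w.drop (S.arr pos j) = FOFormula.encodeAll (φ.pending j)
  le : S.reg count + (w.length - S.reg cur) ≤ φ.length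
  names : ∃ X, NamesOK X S ∧ X ∪ FOFormula.varsAll (φ.pending (S.reg count)) = φ.vars

theorem ListsInv.parseInv {w : List ℕ} {n : ℕ} {N : Fin n → List (Fin n)} {φ : FOFormula}
    {S : NState} (h : ListsInv w N φ S)
    (h0 : (NExpr.sub (.reg Reg.size) (.reg Reg.next)).eval w S = 0) : ParseInv w N φ S := by
  have hn : S.reg Reg.next = n := by
    have := h.size
    have := h.next
    simp only [NExpr.eval] at h0
    omega
  have hdrop : w.drop (S.reg cur) = φ.encode := by
    have := h.drop
    rw [hn, List.drop_eq_nil_of_le (as := List.finRange n) (by simp)] at this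
    simpa using this
  refine ⟨h.size, h.len, h.height, h.status, h.vals, fun u => h.lists u (by omega), ?_, ?_, ?_, ∅,
    ⟨by simp [h.names], by simp [h.idx], by simp, by simp [h.idx]⟩, ?_⟩
  · rw [hdrop, h.count]; simp [FOFormula.pending, FOFormula.encodeAll]
  · simp [h.count]
  · rw [h.count, ← List.length_drop, hdrop]; simp [FOFormula.length]
  · simp [h.count, FOFormula.pending, FOFormula.varsAll]

/-- Reading a main symbol and its names replaces the first pending formula by its immediate
subformulas. Each round consumes at least one cell, which keeps the number of recorded positions
within the length of `φ`. -/
theorem parseInv_step {w : List ℕ} {n : ℕ} {N : Fin n → List (Fin n)} {φ : FOFormula} {S : NState}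
    (h : ParseInv w N φ S) (h0 : (NExpr.sub (.reg Reg.len) (.reg Reg.cur)).eval w S ≠ 0) :
    ParseInv w N φ (parseProg.run w S) ∧
      w.length - (parseProg.run w S).reg cur < w.length - S.reg cur ∧
      parseProg.dynCost w S ≤ 0 := by
  have hlt : S.reg cur < w.length := by
    have := h.len
    simp only [NExpr.eval] at h0
    omega
  have hdrop := h.drop
  rcases hp : φ.pending (S.reg Reg.count) with _ | ⟨ψ, F⟩
  · rw [hp] at hdrop
    simp [FOFormula.encodeAll] at hdrop
    omega
  have he : FOFormula.encodeAll (ψ :: F) =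
      ψ.symbol :: (ψ.names ++ FOFormula.encodeAll (ψ.subs ++ F)) := by
    rw [FOFormula.encodeAll_append, FOFormula.encodeAll, List.flatMap_cons, FOFormula.encode_eq]
    simp [FOFormula.encodeAll]
  have hdrop' := hdrop
  rw [hp, he] at hdrop'
  have hrun := parseProg_run hdrop'
  obtain ⟨-, h2, -⟩ := List.getD_of_drop_eq_cons hdrop'
  have hlen : S.reg cur + 1 + ψ.names.length ≤ w.length := by
    have := congrArg List.length hdrop'
    simp at this
    omega
  rw [hrun]
  refine ⟨⟨?_, ?_, ?_, ?_, ?_, fun u => ⟨?_, ?_⟩, ?_, ?_, ?_, ?_⟩, ?_, ?_⟩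
  · simp [NState.set_reg, foldl_addName_reg, h.size]
  · simp [NState.set_reg, foldl_addName_reg, h.len]
  · simp [NState.set_reg, foldl_addName_reg, h.height]
  · simp [NState.put_arr, foldl_addName_arr, h.status]
  · simp [NState.put_arr, foldl_addName_arr, h.vals]
  · simp [NState.put_arr, foldl_addName_arr, (h.lists u).1]
  · simpa [NState.put_arr, foldl_addName_arr] using (h.lists u).2
  · have := congrArg (List.drop ψ.names.length) h2
    rw [List.drop_drop, List.drop_left] at this
    simpa [NState.set_reg, foldl_addName_reg, FOFormula.pending_succ hp] using this
  · intro j hj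
    simp [NState.set_reg, foldl_addName_reg] at hj
    simp only [NState.set_arr, foldl_addName_arr _ _ (show pos ≠ idx by simp), NState.put_arr,
      true_and]
    by_cases e : j = S.reg Reg.count
    · rw [if_pos e, e]
      exact ⟨by simp [hp], hdrop⟩
    · rw [if_neg e]
      exact h.pos j (by omega)
  · have := h.le
    simp [NState.set_reg, foldl_addName_reg]
    omega
  · obtain ⟨X, hX, hX'⟩ := h.names
    refine ⟨ψ.names.toFinset ∪ X, NamesOK.congr (NamesOK.foldl (hX.congr
      (T := ((S.put Arr.pos (S.reg Reg.count) (S.reg cur)).set Reg.count (S.reg Reg.count + 1)).set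
        event ψ.symbol) ?_ ?_) ψ.names) ?_ ?_, ?_⟩
    · simp [NState.set_reg]
    · funext i; simp [NState.put_arr]
    · simp [NState.set_reg]
    · simp
    · rw [← hX', hp]
      simp only [NState.set_reg, foldl_addName_reg _ _ (show Reg.count ≠ Reg.names by simp),
        reduceCtorEq, if_false, if_true, FOFormula.pending_succ hp, FOFormula.varsAll_append]
      rw [show FOFormula.varsAll (ψ :: F) = ψ.vars ∪ FOFormula.varsAll F from rfl,
        FOFormula.vars_eq]
      ext x
      simp only [Finset.mem_union]
      tauto
  · simp [NState.set_reg]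
    omega
  · simp [parseProg, nameProg, NProg.dynCost]

/-- Once nothing is pending, the names seen are exactly those of `φ`, so the machine has found the
number `s` of variables by itself. -/
theorem ParseInv.final {w : List ℕ} {n : ℕ} {N : Fin n → List (Fin n)} {φ : FOFormula}
    {S : NState} (h : ParseInv w N φ S)
    (h0 : (NExpr.sub (.reg Reg.len) (.reg Reg.cur)).eval w S = 0) :
    φ.pending (S.reg Reg.count) = [] ∧ NamesOK φ.vars S := by
  have hd := h.drop
  have hl := h.len
  simp only [NExpr.eval] at h0
  rw [List.drop_eq_nil_of_le (by omega)] at hd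
  have hp := FOFormula.encodeAll_eq_nil hd.symm
  obtain ⟨X, hX, hX'⟩ := h.names
  rw [hp] at hX'
  simp only [FOFormula.varsAll, List.foldr_nil, Finset.union_empty] at hX'
  exact ⟨hp, hX' ▸ hX⟩

end RAM

/-! ## Calls of primitive recursive functions -/

namespace RAM

open Encodable

/-- The function on codes that is given by a function on encodable types. -/
def onCodes {α β : Type*} [Primcodable α] [Primcodable β] (f : α → β) (n : ℕ) : ℕ :=
  (encode ((decode n : Option α).map f)).pred

theorem onCodes_encode {α β : Type*} [Primcodable α] [Primcodable β] (f : α → β) (a : α) :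
    onCodes f (encode a) = encode (f a) := by
  simp [onCodes]

theorem onCodes_primrec {α β : Type*} [Primcodable α] [Primcodable β] {f : α → β}
    (hf : Primrec f) : Nat.Primrec (onCodes f) :=
  Nat.Primrec.pred.comp hf

/-- The sum of the values of `f` up to `B`. -/
def sumTo (f : ℕ → ℕ) (B : ℕ) : ℕ := B.rec (f 0) fun j x => x + f (j + 1)

/-- Costs need not be monotone in the argument. The sum of all values up to `B` still bounds each of
them, and it is primitive recursive in `B`. -/
theorem le_sumTo (f : ℕ → ℕ) {j B : ℕ} (h : j ≤ B) : f j ≤ sumTo f B := by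
  induction B with
  | zero => rw [Nat.le_zero.1 h]; rfl
  | succ B ih =>
    show f j ≤ sumTo f B + f (B + 1)
    rcases Nat.le_succ_iff.1 h with h | rfl
    · exact (ih h).trans (Nat.le_add_right _ _)
    · exact Nat.le_add_left _ _

theorem primrec_sumTo {f : ℕ → ℕ} (hf : Primrec f) : Primrec (sumTo f) :=
  Primrec.nat_rec₁ (f 0) (Primrec.nat_add.comp .snd (hf.comp (Primrec.succ.comp .fst)))

/-! ## The search -/

/-- Whether a program assigns to a register. -/
def NProg.sets (x : Reg) : NProg → Bool
  | skip => false
  | set y _ => y = x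
  | put _ _ _ => false
  | seq p q => p.sets x || q.sets x
  | ite _ p q => p.sets x || q.sets x
  | call _ _ y _ _ => y = x

/-- Whether a program writes to an array. -/
def NProg.puts (a : Arr) : NProg → Bool
  | skip => false
  | set _ _ => false
  | put b _ _ => b = a
  | seq p q => p.puts a || q.puts a
  | ite _ p q => p.puts a || q.puts a
  | call _ _ _ _ _ => false

/-- A frame rule with a syntactic premise; for a concrete program the premise holds by `rfl`. -/
theorem NProg.run_reg {x : Reg} (w : List ℕ) {p : NProg} (h : p.sets x = false) (S : NState) :
    (p.run w S).reg x = S.reg x := by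
  induction p generalizing S with
  | skip => rfl
  | set y e =>
    rw [run, NState.set_reg, if_neg]
    rintro rfl
    simp [sets] at h
  | put a e₁ e₂ => rfl
  | seq p q ihp ihq =>
    simp only [sets, Bool.or_eq_false_iff] at h
    rw [run, ihq h.2, ihp h.1]
  | ite e p q ihp ihq =>
    simp only [sets, Bool.or_eq_false_iff] at h
    rw [run]
    split_ifs
    · exact ihq h.2 S
    · exact ihp h.1 S
  | call F hF y e₁ e₂ =>
    rw [run, NState.set_reg, if_neg]
    rintro rfl
    simp [sets] at h

theorem NProg.run_arr {a : Arr} (w : List ℕ) {p : NProg} (h : p.puts a = false) (S : NState) :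
    (p.run w S).arr a = S.arr a := by
  induction p generalizing S with
  | skip => rfl
  | set y e => rfl
  | put b e₁ e₂ =>
    have : a ≠ b := by
      rintro rfl
      simp [puts] at h
    funext i
    rw [run, NState.put_arr, if_neg fun e => this e.1]
  | seq p q ihp ihq =>
    simp only [puts, Bool.or_eq_false_iff] at h
    rw [run, ihq h.2, ihp h.1]
  | ite e p q ihp ihq =>
    simp only [puts, Bool.or_eq_false_iff] at h
    rw [run]
    split_ifs
    · exact ihq h.2 S
    · exact ihp h.1 S
  | call F hF y e₁ e₂ => rfl

open NExpr NProg Reg Arr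

/-- Visits the vertex `nbr`. -/
def openProg : NProg :=
  .seq (.put status (.reg nbr) (.add (.reg height) (.lit 2)))
  (.seq (.put stack (.reg height) (.reg nbr))
  (.seq (.set height (.add (.reg height) (.lit 1)))
    (.set event (.lit 1))))

/-- Reads the next neighbor of the vertex `vert`. -/
def nextProg : NProg :=
  .seq (.set nbr (.inp (.arr ptr (.reg vert))))
  (.seq (.put ptr (.reg vert) (.add (.arr ptr (.reg vert)) (.lit 1)))
    (.put rem (.reg vert) (.sub (.arr rem (.reg vert)) (.lit 1))))

/-- Reads the next neighbor of the vertex `vert`, and visits it if it is fresh. -/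
def readProg : NProg :=
  .seq nextProg
  (.ite (.arr status (.reg nbr))
    (.ite (.sub (.arr status (.reg nbr)) (.lit 1))
      (.set event (.add (.arr status (.reg nbr)) (.lit 1)))
      .skip)
    openProg)

/-- Leaves the vertex `vert`. -/
def closeProg : NProg :=
  .seq (.set event (.lit 2))
  (.seq (.put status (.reg vert) (.lit 1))
    (.set height (.sub (.reg height) (.lit 1))))

/-- Starts the search from the vertex `next` if it is fresh. -/
def rootProg : NProg :=
  .seq (.ite (.arr status (.reg next)) .skip (.seq (.set nbr (.reg next)) openProg))
    (.set next (.add (.reg next) (.lit 1)))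

/-- A step of the search. -/
def moveProg : NProg :=
  .seq (.set event (.lit 0))
  (.ite (.reg height)
    (.seq (.set vert (.arr stack (.sub (.reg height) (.lit 1))))
      (.ite (.arr rem (.reg vert)) readProg closeProg))
    rootProg)

/-- The arrays represent the path of a search. -/
structure SearchRep (w : List ℕ) {n : ℕ} (N : Fin n → List (Fin n)) (t : List (SFrame (Fin n)))
    (fresh : Set (Fin n)) (S : NState) : Prop where
  height : S.reg height = t.length
  status_eq_zero : ∀ u : Fin n, S.arr status u = 0 ↔ u ∈ fresh
  level : ∀ (u : Fin n) l, AtLevel (t.map SFrame.vert) l u →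
    S.arr status u = l + 2 ∧ S.arr Arr.stack l = u
  done : ∀ u : Fin n, u ∉ fresh → u ∉ t.map SFrame.vert → S.arr status u = 1
  lists : ∀ u ∈ fresh, ListOK w N S u
  frames : ∀ f ∈ t, S.arr rem f.vert.1 = f.rem.length ∧
    f.rem.map Fin.val <+: w.drop (S.arr ptr f.vert.1)

/-- A bound for the number of remaining steps at a vertex. -/
def weight {n : ℕ} (N : Fin n → List (Fin n)) (S : NState) (u : Fin n) : ℕ :=
  if S.arr status u = 0 then (N u).length + 2 else if S.arr status u = 1 then 0
  else S.arr rem u + 1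

variable {w : List ℕ} {n : ℕ} {N : Fin n → List (Fin n)} {t : List (SFrame (Fin n))}
  {fresh : Set (Fin n)} {S : NState}

theorem SearchRep.congr (h : SearchRep w N t fresh S) {S' : NState}
    (h1 : S'.reg Reg.height = S.reg Reg.height) (h2 : S'.arr = S.arr) :
    SearchRep w N t fresh S' := by
  refine ⟨h1 ▸ h.height, ?_, ?_, ?_, fun u hu => ?_, ?_⟩
  · rw [h2]; exact h.status_eq_zero
  · rw [h2]; exact h.level
  · rw [h2]; exact h.done
  · have := h.lists u hu
    rw [ListOK] at this ⊢
    rwa [h2]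
  · rw [h2]; exact h.frames

/-- The statuses `0`, `1` and `l + 2` mean fresh, closed, and on the path at level `l`. Opening
lowers the weight of `u` from its degree plus `2` to its degree plus `1`, and changes no other
weight. -/
theorem SearchRep.open (h : SearchRep w N t fresh S) {u : Fin n} (hu : u ∈ fresh)
    (hn : S.reg nbr = u) :
    SearchRep w N (⟨u, N u, []⟩ :: t) (fresh \ {u}) (openProg.run w S) ∧
      (openProg.run w S).reg event = 1 ∧
      ∑ v, weight N (openProg.run w S) v < ∑ v, weight N S v := by
  have hup : u ∉ t.map SFrame.vert := fun hm => by
    obtain ⟨l, hl⟩ := AtLevel.exists_of_mem hm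
    have := (h.level u l hl).1
    rw [(h.status_eq_zero u).2 hu] at this
    omega
  have hst : ∀ v : Fin n, (openProg.run w S).arr status v =
      if v = u then t.length + 2 else S.arr status v := fun v => by
    simp [openProg, NProg.run, NExpr.eval, NState.put_arr, hn, h.height, Fin.ext_iff]
  have hrem : (openProg.run w S).arr rem = S.arr rem := run_arr w rfl S
  have hptr : (openProg.run w S).arr ptr = S.arr ptr := run_arr w rfl S
  refine ⟨⟨?_, fun v => ?_, fun v l hl => ?_, fun v hv hv' => ?_, fun v hv => ?_, ?_⟩, ?_, ?_⟩
  · simp [openProg, NProg.run, NState.set_reg, NExpr.eval, h.height]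
  · rw [hst]
    by_cases e : v = u
    · simp [e]
    · simp [e, h.status_eq_zero]
  · have hstack : (openProg.run w S).arr Arr.stack l = if l = t.length then u.1 else
        S.arr Arr.stack l := by
      simp [openProg, NProg.run, NExpr.eval, NState.put_arr, hn, h.height]
    rw [hst, hstack]
    rcases hl with ⟨rfl, rfl⟩ | hl
    · simp
    · have h1 : v ≠ u := fun e => hup (e ▸ hl.mem)
      have h2 : l ≠ t.length := by have := hl.lt; simp at this; omega
      rw [if_neg h1, if_neg h2]
      exact h.level v l hl
  · have h1 : v ≠ u := fun e => hv' (by simp [e])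
    rw [hst, if_neg h1]
    exact h.done v (fun hf => hv ⟨hf, h1⟩) fun hm => hv' (by simp at hm ⊢; exact .inr hm)
  · rw [ListOK, hrem, hptr]
    exact h.lists v hv.1
  · intro f hf
    rw [hrem, hptr]
    rcases List.mem_cons.1 hf with rfl | hf
    · exact h.lists u hu
    · exact h.frames f hf
  · simp [openProg, NProg.run, NState.set_reg, NExpr.eval]
  · have hw : ∀ v, v ≠ u → weight N (openProg.run w S) v = weight N S v := fun v hv => by
      rw [weight, weight, hst, hrem, if_neg hv]
    have hwu : weight N (openProg.run w S) u < weight N S u := by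
      rw [weight, weight, hst, hrem, if_pos rfl, (h.status_eq_zero u).2 hu, (h.lists u hu).1]
      simp
    refine Finset.sum_lt_sum (fun v _ => ?_) ⟨u, Finset.mem_univ _, hwu⟩
    by_cases e : v = u
    · exact e ▸ hwu.le
    · exact (hw v e).le

/-- One unread neighbor fewer means one unit of weight less. The list `a'` is arbitrary because the
arrays do not store the adjacent levels; the automaton does. -/
theorem SearchRep.next {v u : Fin n} {r : List (Fin n)} {a : List ℕ}
    (h : SearchRep w N (⟨v, u :: r, a⟩ :: t) fresh S) (hv : S.reg vert = v)
    (hnd : (v :: t.map SFrame.vert).Nodup) (a' : List ℕ) :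
    SearchRep w N (⟨v, r, a'⟩ :: t) fresh (nextProg.run w S) ∧
      (nextProg.run w S).reg nbr = u ∧
      ∑ x, weight N (nextProg.run w S) x < ∑ x, weight N S x := by
  obtain ⟨f1, f2⟩ := h.frames ⟨v, u :: r, a⟩ (by simp)
  obtain ⟨g1, g2, g3⟩ := List.getD_of_cons_isPrefix_drop f2
  have hlev := (h.level v t.length (.inl ⟨by simp, rfl⟩)).1
  have hvf : v ∉ fresh := fun hf => by rw [(h.status_eq_zero v).2 hf] at hlev; omega
  have hst : (nextProg.run w S).arr status = S.arr status := run_arr w rfl S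
  have hstack : (nextProg.run w S).arr Arr.stack = S.arr Arr.stack := run_arr w rfl S
  have hrem : ∀ x : Fin n, (nextProg.run w S).arr rem x =
      if x = v then r.length else S.arr rem x := fun x => by
    simp only [List.length_cons] at f1
    simp [nextProg, NProg.run, NState.put_arr, NState.set_reg, NExpr.eval, hv, f1, Fin.ext_iff]
  have hptr : ∀ x : Fin n, (nextProg.run w S).arr ptr x =
      if x = v then S.arr ptr v + 1 else S.arr ptr x := fun x => by
    simp [nextProg, NProg.run, NState.put_arr, NState.set_reg, NExpr.eval, hv, Fin.ext_iff]
  refine ⟨⟨?_, ?_, ?_, ?_, fun x hx => ?_, ?_⟩, ?_, ?_⟩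
  · rw [run_reg w rfl, h.height]; rfl
  · rw [hst]; exact h.status_eq_zero
  · rw [hst, hstack]; exact h.level
  · rw [hst]; exact h.done
  · have hxv : x ≠ v := fun e => hvf (e ▸ hx)
    rw [ListOK, hrem, hptr, if_neg hxv, if_neg hxv]
    exact h.lists x hx
  · intro f hf
    rw [hrem, hptr]
    rcases List.mem_cons.1 hf with rfl | hf
    · simpa using g2
    · have hfv : f.vert ≠ v := fun e =>
        (List.nodup_cons.1 hnd).1 (List.mem_map.2 ⟨f, hf, e⟩)
      rw [if_neg hfv, if_neg hfv]
      exact h.frames f (by simp [hf])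
  · simp only [nextProg, NProg.run, NState.set_reg, NState.put_reg, NExpr.eval, if_true, hv]
    rw [NState.mem_of_lt _ (lt_of_lt_of_le g3 (Nat.le_add_right _ _)), g1]
  · have hw : ∀ x, x ≠ v → weight N (nextProg.run w S) x = weight N S x := fun x hx => by
      rw [weight, weight, hst, hrem, if_neg hx]
    have hwv : weight N (nextProg.run w S) v < weight N S v := by
      rw [weight, weight, hst, hrem, if_pos rfl, hlev, f1]
      simp
    refine Finset.sum_lt_sum (fun x _ => ?_) ⟨v, Finset.mem_univ _, hwv⟩
    by_cases e : x = v
    · exact e ▸ hwv.le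
    · exact (hw x e).le

/-- With its list exhausted, `v` has weight `1`, which drops to `0` when its status becomes closed.
-/
theorem SearchRep.close {v : Fin n} {a : List ℕ} (h : SearchRep w N (⟨v, [], a⟩ :: t) fresh S)
    (hv : S.reg vert = v) (hnd : (v :: t.map SFrame.vert).Nodup) :
    SearchRep w N t fresh (closeProg.run w S) ∧ (closeProg.run w S).reg event = 2 ∧
      ∑ x, weight N (closeProg.run w S) x < ∑ x, weight N S x := by
  have hlev := (h.level v t.length (.inl ⟨by simp, rfl⟩)).1
  have hvf : v ∉ fresh := fun hf => by rw [(h.status_eq_zero v).2 hf] at hlev; omega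
  have hst : ∀ x : Fin n, (closeProg.run w S).arr status x =
      if x = v then 1 else S.arr status x := fun x => by
    simp [closeProg, NProg.run, NExpr.eval, NState.put_arr, NState.set_reg, hv, Fin.ext_iff]
  have hstack : (closeProg.run w S).arr Arr.stack = S.arr Arr.stack := run_arr w rfl S
  have hrem : (closeProg.run w S).arr rem = S.arr rem := run_arr w rfl S
  have hptr : (closeProg.run w S).arr ptr = S.arr ptr := run_arr w rfl S
  refine ⟨⟨?_, fun x => ?_, fun x l hl => ?_, fun x hx hx' => ?_, fun x hx => ?_, fun f hf => ?_⟩,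
    ?_, ?_⟩
  · simp [closeProg, NProg.run, NState.set_reg, NExpr.eval, h.height]
  · rw [hst]
    by_cases e : x = v
    · simp [e, hvf]
    · simp [e, h.status_eq_zero]
  · have hxv : x ≠ v := fun e => (List.nodup_cons.1 hnd).1 (e ▸ hl.mem)
    rw [hst, if_neg hxv, hstack]
    exact h.level x l (.inr hl)
  · rw [hst]
    split_ifs with e
    · rfl
    · exact h.done x hx fun hm => (List.mem_cons.1 hm).elim e hx'
  · rw [ListOK, hrem, hptr]
    exact h.lists x hx
  · rw [hrem, hptr]
    exact h.frames f (by simp [hf])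
  · simp [closeProg, NProg.run, NState.set_reg, NExpr.eval]
  · have hw : ∀ x, x ≠ v → weight N (closeProg.run w S) x = weight N S x := fun x hx => by
      rw [weight, weight, hst, hrem, if_neg hx]
    have hwv : weight N (closeProg.run w S) v < weight N S v := by
      rw [weight, weight, hst, hrem, if_pos rfl, hlev]
      simp
    refine Finset.sum_lt_sum (fun x _ => ?_) ⟨v, Finset.mem_univ _, hwv⟩
    by_cases e : x = v
    · exact e ▸ hwv.le
    · exact (hw x e).le

end RAM

/-! ### A step of the search on the machine -/

namespace RAM

open Encodable NExpr NProg Reg Arr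

variable {w : List ℕ} {n : ℕ} {G : SimpleGraph (Fin n)} {N : Fin n → List (Fin n)} {s h : ℕ}
  {T : Search (Fin n)} {S : NState}

/-- A bound for the number of remaining steps of the search. -/
def searchMeasure {n : ℕ} (N : Fin n → List (Fin n)) (S : NState) : ℕ :=
  (n - S.reg next) + ∑ u, weight N S u

/-- The outcome of a step of the search. -/
structure Moved (w : List ℕ) {n : ℕ} (G : SimpleGraph (Fin n)) (N : Fin n → List (Fin n))
    (s h : ℕ) (T : Search (Fin n)) (S S' : NState) (T' : Search (Fin n)) : Prop where
  rep : SearchRep w N T'.stack T'.fresh S'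
  inv : T'.Inv G N s
  auto : T'.auto = autoStep s (S'.reg event) T.auto
  bounded : AutoBounded s h T.auto → AutoBounded s h T'.auto
  event_le : S'.reg event ≤ h + 3
  next_le : S'.reg Reg.next ≤ n
  next : ∀ u : Fin n, u.1 < S'.reg Reg.next → u ∉ T'.fresh
  decrease : searchMeasure N S' < searchMeasure N S

theorem weight_congr {S' : NState} (h : S'.arr = S.arr) : weight N S' = weight N S := by
  funext u
  rw [weight, weight, h]

theorem weight_set (N : Fin n → List (Fin n)) (S : NState) (x : Reg) (c : ℕ) :
    weight N (S.set x c) = weight N S := weight_congr rfl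

/-- With an empty path, `next` advances in either case. Since every vertex below it has been
visited, the search is exhausted when `next` reaches `n` with an empty path. -/
theorem move_root (hT : T.Inv G N s) (hS : SearchRep w N T.stack T.fresh S) (h0 : T.stack = [])
    (hn : S.reg Reg.next < n) (hf : ∀ u : Fin n, u.1 < S.reg Reg.next → u ∉ T.fresh) :
    ∃ T', Moved w G N s h T S (moveProg.run w S) T' := by
  have hheight : S.reg height = 0 := by rw [hS.height, h0]; rfl
  have hrun : moveProg.run w S = rootProg.run w (S.set event 0) := by
    simp [moveProg, NProg.run, NExpr.eval, NState.set_reg, hheight]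
  have hlt : ∀ u : Fin n, u.1 < S.reg Reg.next + 1 → u.1 ≠ S.reg Reg.next → u ∉ T.fresh :=
    fun u h1 h2 => hf u (by omega)
  by_cases hv : S.arr status (S.reg Reg.next) = 0
  · set v : Fin n := ⟨S.reg Reg.next, hn⟩ with hvdef
    have hvf : v ∈ T.fresh := (hS.status_eq_zero v).1 hv
    set S1 := (S.set event 0).set nbr (S.reg Reg.next) with hS1
    have hrun : moveProg.run w S = (openProg.run w S1).set Reg.next (S.reg Reg.next + 1) := by
      rw [hrun]
      simp [rootProg, NProg.run, NExpr.eval, NState.set_reg, hv, ← hS1]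
      rw [run_reg w rfl]
      simp [hS1, NState.set_reg]
    have hS' : SearchRep w N T.stack T.fresh S1 := hS.congr (by simp [hS1, NState.set_reg]) rfl
    obtain ⟨g1, g2, g3⟩ := hS'.open hvf (by simp [hS1, NState.set_reg, hvdef])
    have hadj : ∀ u ∈ T.path.head?, G.Adj v u := by simp [Search.path, h0]
    have ha := Search.auto_open (s := s) T v (N v) (t := T.stack) rfl (T.fresh \ {v})
    have hw : weight N S1 = weight N S := by rw [hS1, weight_set, weight_set]
    rw [hw] at g3
    refine ⟨⟨⟨v, N v, []⟩ :: T.stack, [] :: T.kept, T.fresh \ {v}⟩, ?_, ?_, ?_, ?_, ?_, ?_, ?_, ?_⟩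
    all_goals rw [hrun] at *
    · exact g1.congr (by simp [NState.set_reg]) rfl
    · exact hT.open hvf rfl (hT.stack.mono Set.sdiff_subset) hadj
    · rw [ha, NState.set_reg, if_neg (by simp), g2]
    · intro hb
      rw [ha]
      exact hb.step_open
    · rw [NState.set_reg, if_neg (by simp), g2]; omega
    · simp [NState.set_reg]; omega
    · intro u hu
      simp only [NState.set_reg, if_true] at hu
      rintro ⟨h1, h2⟩
      exact hlt u hu (fun e => h2 (Fin.ext e)) h1
    · rw [searchMeasure, searchMeasure, weight_set]
      simp only [NState.set_reg, if_true]
      omega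
  · have hrun : moveProg.run w S = (S.set event 0).set Reg.next (S.reg Reg.next + 1) := by
      rw [hrun]
      simp [rootProg, NProg.run, NExpr.eval, NState.set_reg, hv]
    refine ⟨T, ?_, hT, ?_, id, ?_, ?_, ?_, ?_⟩
    all_goals rw [hrun] at *
    · exact hS.congr (by simp [NState.set_reg]) rfl
    · simp [NState.set_reg, autoStep]
    · simp [NState.set_reg]
    · simp [NState.set_reg]; omega
    · intro u hu
      simp only [NState.set_reg, if_true] at hu
      by_cases e : u.1 = S.reg Reg.next
      · rw [← hS.status_eq_zero, e]
        exact hv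
      · exact hlt u hu e
    · rw [searchMeasure, searchMeasure, weight_set, weight_set]
      simp [NState.set_reg]
      omega

/-- The four possible moves at the end of the path are closing it, opening a fresh neighbor, passing
over a closed neighbor, and recording an ancestor. Tree edges are recorded like other edges, when
the child reads its parent. The bound `hlen` keeps the levels, and so the events, small. -/
theorem move_path (hN : ∀ u v, v ∈ N u ↔ G.Adj u v)
    (hlen : ∀ T : Search (Fin n), T.Inv G N s → T.stack.length < h) (hT : T.Inv G N s)
    (hS : SearchRep w N T.stack T.fresh S) (h0 : T.stack ≠ []) (hn : S.reg Reg.next ≤ n)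
    (hf : ∀ u : Fin n, u.1 < S.reg Reg.next → u ∉ T.fresh) :
    ∃ T', Moved w G N s h T S (moveProg.run w S) T' := by
  obtain ⟨⟨v, r, a⟩, t, hst⟩ := List.exists_cons_of_ne_nil h0
  rw [hst] at hS
  have hheight : S.reg height = t.length + 1 := by rw [hS.height]; rfl
  have hpath : T.path = v :: t.map SFrame.vert := by simp [Search.path, hst]
  have hnd : (v :: t.map SFrame.vert).Nodup := by
    rw [← hpath]
    exact (List.nodup_append.1 hT.nodup).1
  have hk := hT.kept.length_eq
  rw [hpath] at hk
  simp only [List.length_cons, List.length_map] at hk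
  have hv := (hS.level v t.length (.inl ⟨by simp, rfl⟩)).2
  have hrem : S.arr rem v = r.length := (hS.frames ⟨v, r, a⟩ (by simp)).1
  set S1 := (S.set event 0).set vert v with hS1
  have hS1r : SearchRep w N (⟨v, r, a⟩ :: t) T.fresh S1 := hS.congr (by simp [hS1, NState.set_reg]) rfl
  have hw1 : weight N S1 = weight N S := by rw [hS1, weight_set, weight_set]
  have hvert : S1.reg vert = v := by simp [hS1, NState.set_reg]
  have hnext1 : S1.reg Reg.next = S.reg Reg.next := by simp [hS1, NState.set_reg]
  have hTl := hlen T hT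
  rw [hst, List.length_cons] at hTl
  have hZ := Search.length_auto hT
  rw [hst, List.length_cons] at hZ
  have hnext : ∀ S', (S'.reg Reg.next = S.reg Reg.next) → ∑ x, weight N S' x < ∑ x, weight N S x →
      searchMeasure N S' < searchMeasure N S := fun S' e1 e2 => by
    rw [searchMeasure, searchMeasure, e1]; omega
  rcases r with _ | ⟨u, r⟩
  · have hrun : moveProg.run w S = closeProg.run w S1 := by
      simp [moveProg, NProg.run, NExpr.eval, NState.set_reg, hheight, hv, hrem, hS1]
    obtain ⟨g1, g2, g3⟩ := hS1r.close hvert hnd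
    obtain ⟨k, ks', hK⟩ := List.exists_cons_of_length_pos (l := T.kept) (by omega)
    obtain ⟨g, ks, rfl⟩ := List.exists_cons_of_length_pos (l := ks') (by rw [hK] at hk; simp at hk; omega)
    have ha := Search.auto_close (s := s) T hst hK (by rw [hK] at hk; simpa using hk)
    have hnx : (closeProg.run w S1).reg Reg.next = S.reg Reg.next := by rw [run_reg w rfl, hnext1]
    refine ⟨_, ?_, hT.close hN hst hK, ?_, ?_, ?_, ?_, ?_, ?_⟩
    all_goals try rw [hrun]
    · exact g1
    · rw [ha, g2]
    · intro hb
      rw [ha]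
      exact hb.step_close (by omega)
    · rw [g2]; omega
    · rwa [hnx]
    · rwa [hnx]
    · exact hnext _ hnx (hw1 ▸ g3)
  · have hrun : moveProg.run w S = readProg.run w S1 := by
      simp [moveProg, NProg.run, NExpr.eval, NState.set_reg, hheight, hv, hrem, hS1]
    have hgen := fun a' => hS1r.next hvert hnd a'
    set S2 := nextProg.run w S1 with hS2
    have hnbr := (hgen a).2.1
    have hdec := (hgen a).2.2
    rw [hw1] at hdec
    have hstat : S2.arr status = S1.arr status := run_arr w rfl _
    have hev2 : S2.reg event = 0 := by
      rw [hS2, run_reg w rfl]; simp [hS1, NState.set_reg]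
    have hnx2 : S2.reg Reg.next = S.reg Reg.next := by rw [hS2, run_reg w rfl, hnext1]
    -- The neighbor is fresh, closed, or on the path at level `m`.
    rcases hsu : S.arr status u with _ | _ | m
    · have hu : u ∈ T.fresh := (hS.status_eq_zero u).1 hsu
      have hsu2 : S2.arr status u = 0 := by rw [hstat]; exact hsu
      have hrun : moveProg.run w S = openProg.run w S2 := by
        rw [hrun]
        simp [readProg, NProg.run, NExpr.eval, ← hS2, hnbr, hsu2]
      obtain ⟨g1, g2, g3⟩ := (hgen a).1.open hu hnbr
      have ha := Search.auto_open (s := s) T u (N u) (t := ⟨v, r, a⟩ :: t) (by simp [hst])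
        (T.fresh \ {u})
      have hnx : (openProg.run w S2).reg Reg.next = S.reg Reg.next := by rw [run_reg w rfl, hnx2]
      refine ⟨_, ?_, hT.open_child hN hst hu, ?_, ?_, ?_, ?_, ?_, ?_⟩
      all_goals try rw [hrun]
      · exact g1
      · rw [ha, g2]
      · intro hb
        rw [ha]
        exact hb.step_open
      · rw [g2]; omega
      · rwa [hnx]
      · rw [hnx]
        exact fun x hx hx' => hf x hx hx'.1
      · exact hnext _ hnx (g3.trans hdec)
    · have hu : u ∉ T.fresh := fun hu => by
        rw [(hS.status_eq_zero u).2 hu] at hsu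
        omega
      have hsu2 : S2.arr status u = 1 := by rw [hstat]; exact hsu
      have hrun : moveProg.run w S = S2 := by
        rw [hrun]
        simp [readProg, NProg.run, NExpr.eval, ← hS2, hnbr, hsu2]
      have ha := Search.auto_skip (s := s) T hst
      refine ⟨_, ?_, hT.read hst hu (a' := a) fun l y hl => ?_, ?_, ?_, ?_, ?_, ?_, ?_⟩
      rotate_left 1
      · have : y ≠ u := by
          rintro rfl
          have := (hS.level y l (.inr hl)).1
          omega
        simp [this]
      all_goals try rw [hrun]
      · rw [ha, hev2]
      · intro hb
        rw [ha]
        exact hb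
      · rw [hev2]; omega
      · rwa [hnx2]
      · rwa [hnx2]
      · exact hnext _ hnx2 hdec
      · exact (hgen a).1
    · have hu : u ∉ T.fresh := fun hu => by
        rw [(hS.status_eq_zero u).2 hu] at hsu
        omega
      have hsu2 : S2.arr status u = m + 2 := by rw [hstat]; exact hsu
      obtain ⟨l, hl⟩ : ∃ l, AtLevel (v :: t.map SFrame.vert) l u := by
        refine AtLevel.exists_of_mem (by_contra fun hm => ?_)
        have := hS.done u hu hm
        omega
      have hlm : l = m := by
        have := (hS.level u l hl).1
        omega
      subst hlm
      have hlt := hl.lt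
      simp only [List.length_cons, List.length_map] at hlt
      have hrun : moveProg.run w S = S2.set event (l + 3) := by
        rw [hrun]
        simp [readProg, NProg.run, NExpr.eval, ← hS2, hnbr, hsu2]
      have ha := Search.auto_back (s := s) T hst (by rintro e; rw [e] at hk; simp at hk) l
      have hev : (S2.set event (l + 3)).reg event = l + 3 := by simp [NState.set_reg]
      have hnx : (S2.set event (l + 3)).reg Reg.next = S.reg Reg.next := by
        rw [NState.set_reg, if_neg (by simp), hnx2]
      refine ⟨_, ?_, hT.read hst hu (a' := if l ∈ a then a else l :: a) fun j y hj => ?_,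
        ?_, ?_, ?_, ?_, ?_, ?_⟩
      rotate_left 1
      · have hjy : j = l ↔ y = u := by
          constructor
          · rintro rfl
            exact AtLevel.right_unique (P := v :: t.map SFrame.vert) (Or.inr hj) hl
          · rintro rfl
            exact AtLevel.left_unique hnd (Or.inr hj) hl
        by_cases hla : l ∈ a
        · rw [if_pos hla, ← hjy]
          constructor
          · exact .inl
          · rintro (h | rfl)
            · exact h
            · exact hla
        · rw [if_neg hla, List.mem_cons, hjy, or_comm]
      all_goals try rw [hrun]
      · rw [ha, hev]
      · intro hb
        rw [ha]
        exact hb.step_back (by omega)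
      · rw [hev]; omega
      · rwa [hnx]
      · rwa [hnx]
      · exact hnext _ hnx (by rw [weight_set]; exact hdec)
      · exact ((hgen _).1).congr (by simp [NState.set_reg]) rfl

end RAM

/-! ### The search together with the automaton -/

namespace RAM

open Encodable NExpr NProg Reg Arr

variable {w : List ℕ} {n : ℕ} {G : SimpleGraph (Fin n)} {N : Fin n → List (Fin n)} {s h : ℕ}
  {T : Search (Fin n)} {S : NState}

/-- The step of the automaton on codes. -/
def stepCode : ℕ → ℕ := onCodes fun p : (ℕ × ℕ) × List Frame => autoStep p.1.1 p.1.2 p.2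

theorem stepCode_primrec : Nat.Primrec stepCode := onCodes_primrec primrec_autoStep

theorem stepCode_pair (s e : ℕ) (Z : List Frame) :
    stepCode (Nat.pair (Nat.pair s e) (encode Z)) = encode (autoStep s e Z) :=
  onCodes_encode (fun p : (ℕ × ℕ) × List Frame => autoStep p.1.1 p.1.2 p.2) ((s, e), Z)

/-- The instruction `pairInto x e₁ e₂` writes the code of a pair to a register. -/
def pairInto (x : Reg) (e₁ e₂ : NExpr) : NProg := .call (fun n => n) .id x e₁ e₂

/-- A step of the automaton. -/
def tickProg : NProg :=
  .seq (pairInto left (.reg names) (.reg event))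
    (.call stepCode stepCode_primrec auto (.reg left) (.reg auto))

/-- The running time of forming a pair. -/
noncomputable def pairCost (m : ℕ) : ℕ := callCost (fun n => n) .id m

/-- A bound for the running time of a step of the automaton. -/
noncomputable def tickBound (s h : ℕ) : ℕ :=
  sumTo pairCost (Nat.pair s (h + 3)) +
    sumTo (callCost stepCode stepCode_primrec)
      (Nat.pair (Nat.pair s (h + 3)) (Block.autoBound s h))

theorem tickProg_run {Z : List Frame} (hs : S.reg names = s) (hZ : S.reg auto = encode Z) :
    tickProg.run w S =
      (S.set left (Nat.pair s (S.reg event))).set auto (encode (autoStep s (S.reg event) Z)) := by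
  simp [tickProg, pairInto, NProg.run, NExpr.eval, NState.set_reg, hs, hZ, stepCode_pair]

theorem tickProg_dynCost_le {Z : List Frame} (hs : S.reg names = s) (hZ : S.reg auto = encode Z)
    (hb : encode Z ≤ Block.autoBound s h) (he : S.reg event ≤ h + 3) :
    tickProg.dynCost w S ≤ tickBound s h := by
  simp only [tickProg, pairInto, NProg.dynCost, NProg.run, NExpr.eval, NState.set_reg, hs, hZ,
    if_true, reduceCtorEq, if_false]
  exact Nat.add_le_add (le_sumTo _ (Nat.pair_mono le_rfl he))
    (le_sumTo _ (Nat.pair_mono (Nat.pair_mono le_rfl he) hb))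

/-- The body of the loop of the search. -/
def searchProg : NProg := .seq moveProg tickProg

/-- The invariant of the search; `R` is the state at its beginning. -/
structure SearchInv (w : List ℕ) {n : ℕ} (G : SimpleGraph (Fin n)) (N : Fin n → List (Fin n))
    (s h : ℕ) (R : NState) (T : Search (Fin n)) (S : NState) : Prop where
  rep : SearchRep w N T.stack T.fresh S
  inv : T.Inv G N s
  auto : S.reg auto = encode T.auto
  bounded : AutoBounded s h T.auto
  next_le : S.reg Reg.next ≤ n
  next : ∀ u : Fin n, u.1 < S.reg Reg.next → u ∉ T.fresh
  size : S.reg size = n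
  names : S.reg names = s
  count : S.reg count = R.reg count
  arrs : ∀ a ∈ [idx, pos, vals], S.arr a = R.arr a

/-- The condition of the loop of the search. -/
def searchCond : NExpr := .add (.reg height) (.sub (.reg size) (.reg next))

/-- The search moves without calls; all the variable cost lies in the single step of the automaton.
The state before that step is bounded by the invariant, and the event by the height. -/
theorem searchInv_step {R : NState} (hN : ∀ u v, v ∈ N u ↔ G.Adj u v)
    (hlen : ∀ T : Search (Fin n), T.Inv G N s → T.stack.length < h)
    (hI : SearchInv w G N s h R T S) (h0 : searchCond.eval w S ≠ 0) :
    (∃ T', SearchInv w G N s h R T' (searchProg.run w S)) ∧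
      searchMeasure N (searchProg.run w S) < searchMeasure N S ∧
      searchProg.dynCost w S ≤ tickBound s h := by
  obtain ⟨T', hM⟩ : ∃ T', Moved w G N s h T S (moveProg.run w S) T' := by
    by_cases hst : T.stack = []
    · refine move_root hI.inv hI.rep hst ?_ hI.next
      have h1 := hI.rep.height
      have h2 := hI.size
      rw [hst] at h1
      simp only [searchCond, NExpr.eval, h1, h2, List.length_nil] at h0
      omega
    · exact move_path hN hlen hI.inv hI.rep hst hI.next_le hI.next
  set S1 := moveProg.run w S with hS1
  have hnames : S1.reg names = s := by rw [hS1, run_reg w rfl, hI.names]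
  have hauto : S1.reg Reg.auto = encode T.auto := by rw [hS1, run_reg w rfl, hI.auto]
  have hb : encode T.auto ≤ Block.autoBound s h := by
    refine hI.bounded.encode_le ?_
    rw [Search.length_auto hI.inv]
    have := hlen T hI.inv
    omega
  have hrun : searchProg.run w S = tickProg.run w S1 := rfl
  have ht := tickProg_run (w := w) hnames hauto
  refine ⟨⟨T', ?_, hM.inv, ?_, hM.bounded hI.bounded, ?_, ?_, ?_, ?_, ?_, ?_⟩, ?_, ?_⟩
  · rw [hrun, ht]
    exact hM.rep.congr (by simp [NState.set_reg]) rfl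
  · rw [hrun, ht, hM.auto]
    simp [NState.set_reg]
  · rw [hrun, run_reg w rfl]; exact hM.next_le
  · rw [hrun, run_reg w rfl]; exact hM.next
  · rw [hrun, run_reg w rfl, hS1, run_reg w rfl, hI.size]
  · rw [hrun, run_reg w rfl, hnames]
  · rw [hrun, run_reg w rfl, hS1, run_reg w rfl, hI.count]
  · intro a ha
    rw [← hI.arrs a ha]
    simp only [List.mem_cons, List.not_mem_nil, or_false] at ha
    rcases ha with rfl | rfl | rfl <;> rw [hrun, run_arr w rfl, hS1, run_arr w rfl]
  · refine lt_of_le_of_lt (le_of_eq ?_) hM.decrease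
    rw [searchMeasure, searchMeasure, hrun, run_reg w rfl, ht, weight_set, weight_set]
  · show moveProg.dynCost w S + tickProg.dynCost w S1 ≤ _
    have : moveProg.dynCost w S = 0 := by
      simp [moveProg, readProg, nextProg, rootProg, openProg, closeProg, NProg.dynCost]
    rw [this, zero_add]
    exact tickProg_dynCost_le hnames hauto hb hM.event_le

/-- Initialization of the search. -/
def startProg : NProg :=
  .seq (.set next (.lit 0)) (.set auto (.lit (encode ([([], [])] : List Frame))))

theorem searchInv_init {φ : FOFormula} (hP : ParseInv w N φ S) (hn : S.reg names = s) (h : ℕ) :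
    SearchInv w G N s h S ⟨[], [[]], Set.univ⟩ (startProg.run w S) := by
  have harr : (startProg.run w S).arr = S.arr := rfl
  refine ⟨⟨?_, fun u => ?_, ?_, ?_, fun u _ => ?_, ?_⟩, ⟨?_, ?_, ?_, .nil, .nil (by simp), ?_⟩, ?_,
    .cons ⟨by simp, by simp, by simp, by simp, by simp⟩ .nil, ?_, ?_, ?_, ?_, ?_, ?_⟩
  · rw [run_reg w rfl, hP.height]; rfl
  · simp [harr, hP.status]
  · intro u l hl
    exact hl.elim
  · simp
  · rw [ListOK, harr]
    exact hP.lists u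
  · simp
  · simp [Search.verts, Search.path, VBlock.allVerts, VBlock.verts]
  · simp [Search.verts, Search.path, VBlock.allVerts, VBlock.verts]
  · simp [Search.path]
  · intro φ _
    rw [show Search.alive (V := Fin n) ⟨[], [[]], Set.univ⟩ = Set.univ by
      simp [Search.alive]]
  · simp [startProg, NProg.run, NExpr.eval, NState.set_reg, Search.auto]
  · simp [startProg, NProg.run, NExpr.eval, NState.set_reg]
  · simp [startProg, NProg.run, NExpr.eval, NState.set_reg]
  · rw [run_reg w rfl, hP.size]
  · rw [run_reg w rfl, hn]
  · rw [run_reg w rfl]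
  · exact fun a _ => rfl

/-- Each vertex contributes its degree plus `2`, and one more for the advance of `next`. -/
theorem searchMeasure_init (hP : ∀ i, S.arr status i = 0) :
    searchMeasure N S ≤ 3 * n + ∑ u, (N u).length := by
  have : ∀ u, weight N S u = (N u).length + 2 := fun u => by rw [weight, if_pos (hP _)]
  simp only [searchMeasure, this, Finset.sum_add_distrib, Finset.sum_const, Finset.card_univ,
    Fintype.card_fin, smul_eq_mul]
  omega

/-! ### The reduced graph -/

/-- The reduced graph on codes. -/
def kernelCode : ℕ → ℕ :=
  onCodes fun p : List Frame × ℕ => ((p.1.flatMap Prod.snd).flatten, p.2)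

theorem kernelCode_primrec : Nat.Primrec kernelCode :=
  onCodes_primrec (Primrec.pair (Primrec.list_flatten.comp
    (Primrec.list_flatMap .fst (Primrec.snd.comp .snd))) .snd)

theorem kernelCode_pair (Z : List Frame) (s : ℕ) :
    kernelCode (Nat.pair (encode Z) s) = encode ((Z.flatMap Prod.snd).flatten, s) :=
  onCodes_encode (fun p : List Frame × ℕ => ((p.1.flatMap Prod.snd).flatten, p.2)) (Z, s)

/-- Computes the reduced graph. -/
def kernelProg : NProg := .call kernelCode kernelCode_primrec auto (.reg auto) (.reg names)

/-- A bound for the code of the reduced graph. -/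
def kernelBound (s h : ℕ) : ℕ := sumTo kernelCode (Nat.pair (Block.autoBound s h) s)

/-- A bound for the running time of its computation. -/
noncomputable def kernelCost (s h : ℕ) : ℕ :=
  sumTo (callCost kernelCode kernelCode_primrec) (Nat.pair (Block.autoBound s h) s)

end RAM

/-- This transfers the injectivity and the bounds of the indices from the names of `φ` to those of
the subformula under evaluation. -/
theorem FOFormula.vars_subset_of_mem_pending {φ : FOFormula} (j : ℕ) :
    ∀ ψ ∈ φ.pending j, ψ.vars ⊆ φ.vars := by
  induction j with
  | zero => simp [pending]
  | succ j ih =>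
    rcases hp : φ.pending j with _ | ⟨ψ, F⟩
    · simp [pending, hp]
    · rw [pending_succ hp]
      rw [hp] at ih
      intro χ hχ
      rcases List.mem_append.1 hχ with hχ | hχ
      · refine Finset.Subset.trans ?_ (ih ψ (by simp))
        cases ψ <;> simp [subs] at hχ <;> simp [vars, hχ]
        all_goals rcases hχ with rfl | rfl <;> simp
      · exact ih χ (by simp [hχ])

namespace RAM

open Encodable NExpr NProg Reg Arr

variable {w : List ℕ} {S : NState} {b : Block} {s : ℕ} {ι : ℕ → ℕ} {φ : FOFormula}

/-! ## The evaluation of the formula -/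

/-- The operation on tables on codes. -/
noncomputable def opCode : ℕ → ℕ := onCodes fun p : Table.Args =>
  Table.op p.1.1 p.1.2 p.2.1.1 p.2.1.2.1 p.2.1.2.2 p.2.2.1 p.2.2.2

theorem opCode_primrec : Nat.Primrec opCode := onCodes_primrec Table.primrec_op

theorem opCode_pair (b : Block) (s o x y : ℕ) (a a' : Table) :
    opCode (Nat.pair (encode (b, s)) (Nat.pair (Nat.pair o (Nat.pair x y))
      (Nat.pair (encode a) (encode a')))) = encode (Table.op b s o x y a a') :=
  onCodes_encode (fun p : Table.Args =>
    Table.op p.1.1 p.1.2 p.2.1.1 p.2.1.2.1 p.2.1.2.2 p.2.2.1 p.2.2.2)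
    ((b, s), ((o, x, y), (a, a')))

/-- The list of all assignments on codes. -/
def allCode : ℕ → ℕ := onCodes fun p : Block × ℕ => Table.all p.1.length p.2

theorem allCode_primrec : Nat.Primrec allCode :=
  onCodes_primrec (Table.primrec_all.comp (Primrec.list_length.comp .fst) .snd)

theorem allCode_encode (b : Block) (s : ℕ) :
    allCode (encode (b, s)) = encode (Table.all b.length s) :=
  onCodes_encode (fun p : Block × ℕ => Table.all p.1.length p.2) (b, s)

/-- The index of the variable name that is `k` symbols after the current one. -/
def nameIndex (k : ℕ) : NExpr :=
  .sub (.arr idx (.inp (.add (.reg cur) (.lit k)))) (.lit 1)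

/-- Evaluates a formula whose immediate subformulas have been evaluated. -/
noncomputable def evalProg : NProg :=
  .seq (.set count (.sub (.reg count) (.lit 1)))
  (.seq (.set cur (.arr pos (.reg count)))
  (.seq (.set event (.inp (.reg cur)))
  (.seq (pairInto left (nameIndex 1) (nameIndex 2))
  (.seq (pairInto left (.reg event) (.reg left))
  (.seq (pairInto right (.arr vals (.sub (.reg height) (.lit 1)))
    (.arr vals (.sub (.reg height) (.lit 2))))
  (.seq (pairInto right (.reg left) (.reg right))
  (.seq (.call opCode opCode_primrec right (.reg auto) (.reg right))
  (.seq (.ite (.sub (.reg event) (.lit 8)) .skip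
    (.ite (.sub (.reg event) (.lit 4)) (.set height (.sub (.reg height) (.lit 1)))
    (.ite (.sub (.reg event) (.lit 3)) .skip (.set height (.add (.reg height) (.lit 1))))))
    (.put vals (.sub (.reg height) (.lit 1)) (.reg right))))))))))

/-- A bound for the running time of `evalProg`, for a bound `m` on the code of the reduced
graph. -/
noncomputable def evalBound (m s : ℕ) : ℕ :=
  sumTo pairCost (Nat.pair s s) + sumTo pairCost (Nat.pair 10 (Nat.pair s s)) +
  sumTo pairCost (Nat.pair (sumTo allCode m) (sumTo allCode m)) +
  sumTo pairCost (Nat.pair (Nat.pair 10 (Nat.pair s s))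
    (Nat.pair (sumTo allCode m) (sumTo allCode m))) +
  sumTo (callCost opCode opCode_primrec) (Nat.pair m (Nat.pair (Nat.pair 10 (Nat.pair s s))
    (Nat.pair (sumTo allCode m) (sumTo allCode m))))

/-- The array `v` contains correct tables for a list of formulas, in reverse order. -/
def ValsOK (b : Block) (s : ℕ) (ι : ℕ → ℕ) (v : ℕ → ℕ) : List FOFormula → Prop
  | [] => True
  | φ :: F => (∃ a : Table, v F.length = encode a ∧ Table.Correct b s ι φ a) ∧ ValsOK b s ι v F

theorem ValsOK.congr {v v' : ℕ → ℕ} {F : List FOFormula} (h : ValsOK b s ι v F)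
    (hv : ∀ i < F.length, v' i = v i) : ValsOK b s ι v' F := by
  induction F with
  | nil => trivial
  | cons φ F ih =>
    refine ⟨?_, ih h.2 fun i hi => hv i (by simp; omega)⟩
    rw [hv _ (by simp)]
    exact h.1

/-- The invariant of the evaluation. -/
structure EvalInv (w : List ℕ) (φ : FOFormula) (b : Block) (S : NState) : Prop where
  auto : S.reg auto = encode (b, φ.numVars)
  names : NamesOK φ.vars S
  pos : ∀ j < S.reg count, φ.pending j ≠ [] ∧
    w.drop (S.arr pos j) = FOFormula.encodeAll (φ.pending j)
  height : S.reg height = (φ.pending (S.reg count)).length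
  bounded : ∀ i, ∃ a : Table, S.arr vals i = encode a ∧
    encode a ≤ encode (Table.all b.length φ.numVars)
  vals : ValsOK b φ.numVars (fun x => S.arr idx x - 1) (S.arr vals) (φ.pending (S.reg count))

/-- The value of a formula is computed from the values of its immediate subformulas. -/
theorem ValsOK.correct {ψ : FOFormula} {F : List FOFormula} {v : ℕ → ℕ}
    (hv : ValsOK b s ι v (ψ.subs ++ F)) (hι : Set.InjOn ι ψ.vars) (hs : ∀ x ∈ ψ.vars, ι x < s)
    {x y : ℕ} (hx : ∀ z r, ψ.names = z :: r → x = ι z) (hy : ∀ z z' r, ψ.names = z :: z' :: r → y = ι z')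
    {a a' : Table} (ha : v ((ψ.subs ++ F).length - 1) = encode a)
    (ha' : v ((ψ.subs ++ F).length - 2) = encode a') :
    Table.Correct b s ι ψ (Table.op b s ψ.symbol x y a a') := by
  have hone : ∀ χ, ψ.subs = [χ] → Table.Correct b s ι χ a := by
    intro χ hχ
    rw [hχ] at hv ha
    obtain ⟨⟨c, h1, h2⟩, -⟩ := hv
    rw [show ([χ] ++ F).length - 1 = F.length by simp] at ha
    have ha := h1.symm.trans ha
    rwa [← encode_injective ha]
  have htwo : ∀ χ χ', ψ.subs = [χ, χ'] → Table.Correct b s ι χ a ∧ Table.Correct b s ι χ' a' := by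
    intro χ χ' hχ
    rw [hχ] at hv ha ha'
    obtain ⟨⟨c, h1, h2⟩, ⟨c', h3, h4⟩, -⟩ := hv
    rw [show ([χ, χ'] ++ F).length - 1 = (χ' :: F).length by simp] at ha
    rw [show ([χ, χ'] ++ F).length - 2 = F.length by simp] at ha'
    have ha := h1.symm.trans ha
    have ha' := h3.symm.trans ha'
    rw [← encode_injective ha, ← encode_injective ha']
    exact ⟨h2, h4⟩
  cases ψ with
  | tru => exact .tru x y
  | fls => exact .fls x y
  | eq z z' => rw [hx z _ rfl, hy z z' _ rfl]; exact .eq z z'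
  | adj z z' => rw [hx z _ rfl, hy z z' _ rfl]; exact .adj z z'
  | neg χ => exact (hone χ rfl).neg x y
  | and χ χ' => exact (htwo χ χ' rfl).1.and (htwo χ χ' rfl).2 x y
  | or χ χ' => exact (htwo χ χ' rfl).1.or (htwo χ χ' rfl).2 x y
  | imp χ χ' => exact (htwo χ χ' rfl).1.imp (htwo χ χ' rfl).2 x y
  | iff χ χ' => exact (htwo χ χ' rfl).1.iff (htwo χ χ' rfl).2 x y
  | ex z χ =>
    rw [hx z _ rfl]
    exact (hone χ rfl).ex hι (hs z (by simp [FOFormula.vars])) y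
  | all z χ =>
    rw [hx z _ rfl]
    exact (hone χ rfl).all hι (hs z (by simp [FOFormula.vars])) y

/-- Going back by one symbol undoes a step of `pending`: the tables of the immediate subformulas, on
top of the stack with the first operand topmost, give way to the table of `ψ`. The height grows for
atoms and constants, stays for unary symbols, and shrinks for binary ones. -/
theorem evalProg_run {j : ℕ} {ψ : FOFormula} {F : List FOFormula} (hcount : S.reg count = j + 1)
    (hp : φ.pending j = ψ :: F) (hI : EvalInv w φ b S) :
    ∃ a : Table, Table.Correct b φ.numVars (fun x => S.arr idx x - 1) ψ a ∧
      encode a ≤ encode (Table.all b.length φ.numVars) ∧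
      (evalProg.run w S).reg height = F.length + 1 ∧
      (evalProg.run w S).reg count = j ∧
      (∀ i, (evalProg.run w S).arr vals i = if i = F.length then encode a else S.arr vals i) ∧
      ∀ m, encode (b, φ.numVars) ≤ m → evalProg.dynCost w S ≤ evalBound m φ.numVars := by
  have hdrop := (hI.pos j (by omega)).2
  have he : FOFormula.encodeAll (ψ :: F) =
      ψ.symbol :: (ψ.names ++ FOFormula.encodeAll (ψ.subs ++ F)) := by
    rw [FOFormula.encodeAll_append, FOFormula.encodeAll, List.flatMap_cons, FOFormula.encode_eq]
    simp [FOFormula.encodeAll]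
  rw [hp, he] at hdrop
  have hpend : φ.pending (S.reg count) = ψ.subs ++ F := by rw [hcount, FOFormula.pending_succ hp]
  have hheight := hI.height
  have hvals := hI.vals
  rw [hpend] at hheight hvals
  obtain ⟨h1, h2, h3⟩ := List.getD_of_drop_eq_cons hdrop
  have hm : ∀ T : NState, ∀ k ≤ 3, T.mem w (S.arr Arr.pos j + k) = w.getD (S.arr Arr.pos j + k) 0 :=
    fun T k hk => NState.mem_of_lt _ (by omega)
  have hm0 : ∀ T : NState, T.mem w (S.arr Arr.pos j) = ψ.symbol := fun T => (hm T 0 (by omega)).trans h1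
  have hm1 := fun T => hm T 1 (by omega)
  have hm2 := fun T => hm T 2 (by omega)
  obtain ⟨a, ha, ha'⟩ := hI.bounded (S.reg height - 1)
  obtain ⟨c, hc, hc'⟩ := hI.bounded (S.reg height - 2)
  set x := S.arr idx (w.getD (S.arr Arr.pos j + 1) 0) - 1 with hx
  set y := S.arr idx (w.getD (S.arr Arr.pos j + 2) 0) - 1 with hy
  have hop := opCode_pair b φ.numVars ψ.symbol x y a c
  have hsub : ψ.vars ⊆ φ.vars :=
    FOFormula.vars_subset_of_mem_pending j ψ (by rw [hp]; simp)
  have hidx : ∀ z ∈ ψ.vars, S.arr idx z ≠ 0 := fun z hz => (hI.names.idx_ne_zero z).2 (hsub hz)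
  refine ⟨Table.op b φ.numVars ψ.symbol x y a c, ?_, Table.encode_op_le .., ?_, ?_, ?_, ?_⟩
  · refine hvals.correct (fun z hz z' hz' e => ?_) (fun z hz => ?_) (fun z r hz => ?_)
      (fun z z' r hz => ?_) ?_ ?_
    · have g1 := hidx z hz
      have g2 := hidx z' hz'
      exact hI.names.inj z (hsub hz) z' (hsub hz') (by simp only at e; omega)
    · have g1 := hidx z hz
      have g2 := hI.names.le z
      simp only [FOFormula.numVars]
      omega
    · rw [hz] at h2
      rw [hx, (List.getD_of_drop_eq_cons h2).1]
    · rw [hz] at h2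
      rw [hy, (List.getD_of_drop_eq_cons (List.getD_of_drop_eq_cons h2).2.1).1]
    · rw [← hheight, ha]
    · rw [← hheight, hc]
  all_goals simp only [evalProg, pairInto, nameIndex, NProg.run, NProg.dynCost, NExpr.eval,
    NState.set_reg, NState.set_arr, if_true, if_false, reduceCtorEq, hcount, Nat.add_sub_cancel,
    hm0, hm1, hm2, ← hx, ← hy, ha, hc, hI.auto, hop]
  · cases ψ <;> simp [FOFormula.symbol, NState.set_reg, hheight, FOFormula.subs]
  · split_ifs <;> simp [NState.set_reg]
  · intro i
    cases ψ <;> simp [FOFormula.symbol, NState.set_reg, NState.put_arr, hheight, FOFormula.subs]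
  · intro m hm
    -- Names and operands are looked up even where the symbol has none. This is harmless for the
    -- cost, as the bounds hold for every entry of `idx` and of `vals`.
    have hxs : x ≤ φ.numVars := (Nat.sub_le _ _).trans (hI.names.le _)
    have hys : y ≤ φ.numVars := (Nat.sub_le _ _).trans (hI.names.le _)
    have hall : encode (Table.all b.length φ.numVars) ≤ sumTo allCode m := by
      rw [← allCode_encode]
      exact le_sumTo _ hm
    have ha := ha'.trans hall
    have hc := hc'.trans hall
    have ho := ψ.symbol_le
    have p1 := Nat.pair_mono hxs hys
    have p2 := Nat.pair_mono ho p1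
    have p3 := Nat.pair_mono ha hc
    have p4 := Nat.pair_mono p2 p3
    have p5 := Nat.pair_mono hm p4
    have c1 := le_sumTo pairCost p1
    have c2 := le_sumTo pairCost p2
    have c3 := le_sumTo pairCost p3
    have c4 := le_sumTo pairCost p4
    have c5 := le_sumTo (callCost opCode opCode_primrec) p5
    simp only [pairCost] at c1 c2 c3 c4
    simp only [evalBound, pairCost, ite_self]
    omega

theorem evalInv_step (hI : EvalInv w φ b S) (h0 : (NExpr.reg Reg.count).eval w S ≠ 0) {m : ℕ}
    (hm : encode (b, φ.numVars) ≤ m) :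
    EvalInv w φ b (evalProg.run w S) ∧ (evalProg.run w S).reg count < S.reg count ∧
      evalProg.dynCost w S ≤ evalBound m φ.numVars := by
  obtain ⟨j, hj⟩ : ∃ j, S.reg count = j + 1 := Nat.exists_eq_succ_of_ne_zero h0
  obtain ⟨ψ, F, hp⟩ := List.exists_cons_of_ne_nil (hI.pos j (by omega)).1
  obtain ⟨a, h1, h2, h3, h4, h5, h6⟩ := evalProg_run hj hp hI
  have hidx : (evalProg.run w S).arr idx = S.arr idx := run_arr w rfl S
  refine ⟨⟨?_, hI.names.congr (run_reg w rfl S) hidx, ?_, ?_, fun i => ?_, ?_⟩, by omega, h6 m hm⟩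
  · rw [run_reg w rfl, hI.auto]
  · rw [h4, run_arr w rfl]
    exact fun i hi => hI.pos i (by omega)
  · rw [h4, h3, hp]; rfl
  · rw [h5]
    split_ifs
    · exact ⟨a, rfl, h2⟩
    · exact hI.bounded i
  · rw [h4, hp, hidx]
    refine ⟨⟨a, by simp [h5], h1⟩, ?_⟩
    have hv := hI.vals
    rw [hj, FOFormula.pending_succ hp] at hv
    -- The tables of the pending formulas below the operands sit at lower indices than the written
    -- cell and remain valid.
    have hF : ∀ L : List FOFormula, ValsOK b φ.numVars (fun x => S.arr idx x - 1) (S.arr vals)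
        (L ++ F) → ValsOK b φ.numVars (fun x => S.arr idx x - 1) (S.arr vals) F := by
      intro L
      induction L with
      | nil => exact id
      | cons χ L ih => exact fun h => ih h.2
    exact (hF _ hv).congr fun i hi => by rw [h5, if_neg hi.ne]

/-- Reading off the truth value, on codes. -/
def truthCode : ℕ → ℕ := onCodes fun p : (Block × ℕ) × Table =>
  if (List.range p.1.2).map (fun _ => 0) ∈ p.2 then 1 else 0

theorem truthCode_primrec : Nat.Primrec truthCode :=
  onCodes_primrec (Primrec.ite (primrecRel_mem.comp (Primrec.list_map (Primrec.list_range.comp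
    (Primrec.snd.comp .fst)) (Primrec.const 0).to₂) .snd) (.const 1) (.const 0))

open Classical in
theorem truthCode_pair (b : Block) (s : ℕ) (a : Table) :
    truthCode (Nat.pair (encode (b, s)) (encode a)) = if List.replicate s 0 ∈ a then 1 else 0 := by
  refine (onCodes_encode (fun p : (Block × ℕ) × Table =>
    if (List.range p.1.2).map (fun _ => 0) ∈ p.2 then 1 else 0) ((b, s), a)).trans ?_
  simp [List.map_const']

/-- Computes the truth value. -/
def truthProg : NProg := .call truthCode truthCode_primrec left (.reg auto) (.arr vals (.lit 0))

-- At count `0` the only pending formula is `φ`, so cell `0` holds its table. The empty assignment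
-- is the list of zeros, and its membership in the table is the truth value.
open Classical in
theorem truthProg_run (hI : EvalInv w φ b S) (h0 : (NExpr.reg Reg.count).eval w S = 0) {m : ℕ}
    (hm : encode (b, φ.numVars) ≤ m) :
    (truthProg.run w S).reg left =
      (if φ.SatOn {i | i < b.length} b.Adj (fun _ => none) then 1 else 0) ∧
    truthProg.dynCost w S ≤
      sumTo (callCost truthCode truthCode_primrec) (Nat.pair m (sumTo allCode m)) := by
  have hv := hI.vals
  rw [show S.reg count = 0 from h0] at hv
  obtain ⟨⟨a, h1, h2⟩, -⟩ := hv
  have h1 : S.arr vals 0 = encode a := h1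
  obtain ⟨a', h3, h4⟩ := hI.bounded 0
  have : encode a ≤ sumTo allCode m := by
    rw [← h1, h3]
    refine h4.trans ?_
    rw [← allCode_encode]
    exact le_sumTo _ hm
  constructor
  · rw [truthProg, NProg.run, NState.set_reg, if_pos rfl]
    simp only [NExpr.eval, hI.auto, h1, truthCode_pair, h2.models]
  · simp only [truthProg, NProg.dynCost, NExpr.eval, hI.auto, h1]
    exact le_sumTo _ (Nat.pair_mono hm this)

end RAM

namespace RAM

open Encodable NExpr NProg Reg Arr

/-! ## The algorithm -/

/-- The end of the search links the two halves: the blocks at the virtual root form the reduced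
graph, on which `φ` has the same truth value as on `G`. Its code is bounded as the value of a fixed
function at a bounded state. -/
theorem evalInv_init {w : List ℕ} {n : ℕ} {G : SimpleGraph (Fin n)} {N : Fin n → List (Fin n)}
    {h : ℕ} {T : Search (Fin n)} {R S : NState} {φ : FOFormula} (hP : ParseInv w N φ R)
    (hp : φ.pending (R.reg Reg.count) = []) (hn : NamesOK φ.vars R)
    (hI : SearchInv w G N φ.numVars h R T S) (h0 : searchCond.eval w S = 0) :
    ∃ b : Block, EvalInv w φ b (kernelProg.run w S) ∧
      encode (b, φ.numVars) ≤ kernelBound φ.numVars h ∧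
      kernelProg.dynCost w S ≤ kernelCost φ.numVars h ∧
      (φ.Models G ↔ φ.SatOn {i | i < b.length} b.Adj fun _ => none) := by
  have hheight := hI.rep.height
  have hsize := hI.size
  have hnext := hI.next_le
  simp only [searchCond, NExpr.eval] at h0
  have hst : T.stack = [] := List.eq_nil_of_length_eq_zero (by omega)
  have hf : T.fresh = ∅ := Set.eq_empty_iff_forall_notMem.2 fun u => hI.next u (by omega)
  obtain ⟨b, h1, h2, h3, h4, h5⟩ := hI.inv.final hst hf
  have hb : encode T.auto ≤ Block.autoBound φ.numVars h := by
    refine hI.bounded.encode_le ?_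
    rw [Search.length_auto hI.inv, hst]
    simp
  have hpair := Nat.pair_mono hb (le_refl φ.numVars)
  have hauto : (kernelProg.run w S).reg Reg.auto = encode (b.code, φ.numVars) := by
    simp only [kernelProg, NProg.run, NExpr.eval, NState.set_reg, if_true, hI.auto, hI.names,
      kernelCode_pair, h2]
  have hidx := hI.arrs idx (by simp)
  have hpos := hI.arrs Arr.pos (by simp)
  have hvals := hI.arrs Arr.vals (by simp)
  -- The cells of `vals` still hold `0`, which is the code of the empty table.
  refine ⟨b.code, ⟨hauto, hn.congr ?_ hidx, ?_, ?_, fun i => ⟨[], ?_, ?_⟩, ?_⟩, ?_, ?_, ?_⟩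
  · rw [run_reg w rfl, hI.names, hn.names]; rfl
  · rw [run_reg w rfl, hI.count, run_arr w rfl, hpos]
    exact hP.pos
  · rw [run_reg w rfl, run_reg w rfl, hI.count, hp, hheight, hst]; rfl
  · rw [run_arr w rfl, hvals, hP.vals]; rfl
  · simp
  · rw [run_reg w rfl, hI.count, hp]
    trivial
  · rw [h2, ← kernelCode_pair]
    exact le_sumTo _ hpair
  · simp only [kernelProg, NProg.dynCost, NExpr.eval, hI.auto, hI.names]
    exact le_sumTo _ hpair
  · rw [FOFormula.Models, ← h3.satOn_iff h4, ← h5 φ le_rfl, FOFormula.satOn_univ]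

theorem NProg.loop_runs_le {w : List ℕ} {e : NExpr} {p : NProg} {I : NState → Prop}
    {μ : NState → ℕ} {D m : ℕ} (h : ∀ S, I S → e.eval w S ≠ 0 →
      I (p.run w S) ∧ μ (p.run w S) < μ S ∧ p.dynCost w S ≤ D)
    {S : NState} {σ : State} (hS : S.Rep w σ) (hI : I S) (hm : μ S ≤ m) :
    Runs (.loop e.compile p.compile) σ ((m + 1) * ((p.baseCost + 1 + e.compile.cost) + D))
      fun τ => ∃ S' : NState, S'.Rep w τ ∧ I S' ∧ e.eval w S' = 0 := by
  refine (loop_runs I μ D h hS hI).mono ?_ fun _ h => h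
  have h1 := Nat.mul_le_mul_right (p.baseCost + D + 1 + e.compile.cost) hm
  have h2 : (m + 1) * ((p.baseCost + 1 + e.compile.cost) + D) =
      m * (p.baseCost + D + 1 + e.compile.cost) + (p.baseCost + 1 + e.compile.cost + D) := by ring
  omega

theorem NState.rep_initial (w : List ℕ) :
    NState.Rep w ⟨fun x => if x = len then w.length else 0, fun _ _ => 0⟩
      ⟨Function.update (Function.update (initial w).reg 1 w.length) 0 (w.length + 4),
        (initial w).mem⟩ := by
  refine ⟨?_, by simp, fun x => ?_⟩
  · funext i
    simp only [initial, NState.mem]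
    split_ifs
    · rfl
    · exact List.getD_eq_default _ _ (by omega)
  · cases x <;> simp [initial, Reg.index, Function.update_apply]

/-- The condition of the loop that reads the adjacency lists. -/
def listsCond : NExpr := .sub (.reg size) (.reg next)

/-- The condition of the loop that reads the formula. -/
def parseCond : NExpr := .sub (.reg len) (.reg cur)

/-- The model checking algorithm. -/
noncomputable def modelChecker : Prog :=
  .seq (.assign 1 (.reg 0)) <| .seq (.assign 0 (.add (.reg 0) (.lit 4))) <|
  .seq initProg.compile <| .seq (.loop listsCond.compile listsProg.compile) <|
  .seq (.loop parseCond.compile parseProg.compile) <| .seq startProg.compile <|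
  .seq (.loop searchCond.compile searchProg.compile) <| .seq kernelProg.compile <|
  .seq (.loop (NExpr.reg count).compile evalProg.compile) <|
  .seq truthProg.compile <| .assign 0 (.reg left.index)

/-- A bound for the running time of the final step. -/
noncomputable def truthBound (m : ℕ) : ℕ :=
  sumTo (callCost truthCode truthCode_primrec) (Nat.pair m (sumTo allCode m))

/-- The running time of the loop body, including the test. -/
def loopCost (e : NExpr) (p : NProg) : ℕ := p.baseCost + 1 + e.compile.cost

/-- A bound for the running time. -/
noncomputable def timeBound (s h n r l : ℕ) : ℕ :=
  2 + (4 + (initProg.baseCost + ((n + 1) * (loopCost listsCond listsProg + 0) +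
  ((l + 1) * (loopCost parseCond parseProg + 0) + (startProg.baseCost +
  ((r + 1) * (loopCost searchCond searchProg + tickBound s h) +
  ((kernelProg.baseCost + kernelCost s h) +
  ((l + 1) * (loopCost (.reg count) evalProg + evalBound (kernelBound s h) s) +
  ((truthProg.baseCost + truthBound (kernelBound s h)) + 2)))))))))

-- The height bound `2 ^ k` appears in the invariants and in the time, but the program does not
-- contain it.
open Classical in
theorem modelChecker_runs {n : ℕ} {G : SimpleGraph (Fin n)} {N : Fin n → List (Fin n)}
    (hN : IsAdjacencyLists G N) (φ : FOFormula) :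
    Runs modelChecker (initial (modelCheckingInput N φ))
      (timeBound φ.numVars (2 ^ G.treeDepth) n (3 * n + 2 * (n * G.treeDepth)) φ.length)
      fun τ => τ.reg 0 = if φ.Models G then 1 else 0 := by
  set w := modelCheckingInput N φ with hw
  have hN' : ∀ u v, v ∈ N u ↔ G.Adj u v := fun u => (hN u).2
  -- The path of the search is a path of `G` without repeated vertices, so the bound in terms of
  -- tree-depth applies at every moment.
  have hlen : ∀ T : Search (Fin n), T.Inv G N φ.numVars → T.stack.length < 2 ^ G.treeDepth := by
    intro T hT
    have := G.length_lt_two_pow_treeDepth (List.nodup_append.1 hT.nodup).1 hT.chain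
    simpa [Search.path] using this
  refine .seq (.assign (.seq (.assign (.seq ?_))))
  have hrep := NState.rep_initial w
  refine (initProg.compile_runs hrep).mono (by simp [initProg, NProg.dynCost]) fun τ h1 => ?_
  refine .seq ((NProg.loop_runs_le (μ := fun S => n - S.reg Reg.next) (fun S => listsInv_step) h1
    (listsInv_init N φ) (Nat.sub_le _ _)).mono le_rfl fun τ => ?_)
  rintro ⟨S, h2, hL, hL0⟩
  have hP := hL.parseInv hL0
  refine .seq ((NProg.loop_runs_le (μ := fun S => w.length - S.reg cur) (m := φ.length)
    (fun S => parseInv_step) h2 hP (by have := hP.le; omega)).mono le_rfl fun τ => ?_)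
  clear hP
  rintro ⟨R, h3, hP, hP0⟩
  obtain ⟨hp, hn⟩ := hP.final hP0
  refine .seq ((startProg.compile_runs h3).mono (by simp [startProg, NProg.dynCost]) fun τ h4 => ?_)
  refine .seq ((NProg.loop_runs_le (μ := searchMeasure N)
    (I := fun S => ∃ T, SearchInv w G N φ.numVars (2 ^ G.treeDepth) R T S)
    (fun S hS h0 => hS.elim fun T hT => searchInv_step hN' hlen hT h0) h4
    ⟨_, searchInv_init hP hn.names _⟩ ((searchMeasure_init (by
      intro i
      rw [run_arr w rfl]
      exact hP.status i)).trans
      (Nat.add_le_add_left (G.sum_length_le_treeDepth hN) _))).mono le_rfl fun τ => ?_)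
  rintro ⟨S, h5, ⟨T, hI⟩, h0⟩
  obtain ⟨b, hE, hm, hc, hM⟩ := evalInv_init hP hp hn hI h0
  refine .seq ((kernelProg.compile_runs h5).mono (Nat.add_le_add_left hc _) fun τ h6 => ?_)
  refine .seq ((NProg.loop_runs_le (μ := fun S => S.reg Reg.count) (m := φ.length)
    (I := fun S => EvalInv w φ b S) (fun S hS h0 => evalInv_step hS h0 hm) h6 hE (by
      rw [run_reg w rfl, hI.count]
      have := hP.le
      omega)).mono le_rfl fun τ => ?_)
  rintro ⟨S', h7, hE', hE0⟩
  obtain ⟨ht, hc'⟩ := truthProg_run hE' hE0 hm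
  refine .seq ((truthProg.compile_runs h7).mono (Nat.add_le_add_left hc' _) fun τ h8 => ?_)
  refine .assign ?_
  simp only [Expr.eval, Function.update_self, h8.reg, ht, hM]

end RAM

/-! ### The parameter dependence is primitive recursive -/

namespace RAM

open Primrec

theorem primrec_sumTo_pairCost : Primrec (sumTo pairCost) :=
  primrec_sumTo (callCost_primrec _ Nat.Primrec.id)

theorem primrec_tickBound : Primrec₂ tickBound := by
  have hp : Primrec fun p : ℕ × ℕ => Nat.pair p.1 (p.2 + 3) :=
    Primrec₂.natPair.comp .fst (nat_add.comp .snd (.const 3))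
  exact nat_add.comp (primrec_sumTo_pairCost.comp hp)
    ((primrec_sumTo (callCost_primrec _ _)).comp (Primrec₂.natPair.comp hp Block.primrec_autoBound))

theorem primrec_kernelBound : Primrec₂ kernelBound :=
  (primrec_sumTo (Primrec.nat_iff.2 kernelCode_primrec)).comp
    (Primrec₂.natPair.comp Block.primrec_autoBound .fst)

theorem primrec_kernelCost : Primrec₂ kernelCost :=
  (primrec_sumTo (callCost_primrec _ _)).comp (Primrec₂.natPair.comp Block.primrec_autoBound .fst)

theorem primrec_sumTo_allCode : Primrec (sumTo allCode) :=
  primrec_sumTo (Primrec.nat_iff.2 allCode_primrec)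

theorem primrec_evalBound : Primrec₂ evalBound := by
  have h1 : Primrec fun p : ℕ × ℕ => Nat.pair p.2 p.2 := Primrec₂.natPair.comp .snd .snd
  have h2 : Primrec fun p : ℕ × ℕ => Nat.pair 10 (Nat.pair p.2 p.2) :=
    Primrec₂.natPair.comp (.const 10) h1
  have h3 : Primrec fun p : ℕ × ℕ => Nat.pair (sumTo allCode p.1) (sumTo allCode p.1) :=
    Primrec₂.natPair.comp (primrec_sumTo_allCode.comp .fst) (primrec_sumTo_allCode.comp .fst)
  have h4 := Primrec₂.natPair.comp h2 h3
  have hc := primrec_sumTo_pairCost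
  exact nat_add.comp (nat_add.comp (nat_add.comp (nat_add.comp (hc.comp h1) (hc.comp h2))
    (hc.comp h3)) (hc.comp h4)) ((primrec_sumTo (callCost_primrec _ _)).comp
      (Primrec₂.natPair.comp .fst h4))

theorem primrec_truthBound : Primrec truthBound :=
  (primrec_sumTo (callCost_primrec _ _)).comp (Primrec₂.natPair.comp .id primrec_sumTo_allCode)

/-- The part of the running time that depends on the number of variables and on a bound for the
lengths of paths. -/
noncomputable def callBound (s h : ℕ) : ℕ :=
  tickBound s h + kernelCost s h + evalBound (kernelBound s h) s + truthBound (kernelBound s h) + 1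

theorem primrec_callBound : Primrec₂ callBound :=
  nat_add.comp (nat_add.comp (nat_add.comp (nat_add.comp primrec_tickBound primrec_kernelCost)
    (primrec_evalBound.comp primrec_kernelBound .fst)) (primrec_truthBound.comp primrec_kernelBound))
    (.const 1)

/-- The parameter dependence of the running time. -/
noncomputable def parameterBound (p : ℕ × ℕ) : ℕ := (2 * p.2 + 4) * callBound p.1 (2 ^ p.2)

theorem primrec_parameterBound : Primrec parameterBound := by
  have hpow : Primrec fun k => 2 ^ k :=
    (Primrec.nat_rec₁ (f := fun _ x => x + x) 1 (nat_add.comp .snd .snd)).of_eq fun k => by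
        induction k with
        | zero => rfl
        | succ k ih => simp only at ih ⊢; rw [ih, pow_succ, mul_two]
  exact nat_mul.comp (nat_add.comp (nat_mul.comp (.const 2) .snd) (.const 4))
    (primrec_callBound.comp .fst (hpow.comp .snd))

/-- The constant factor of the running time. -/
noncomputable def constantBound : ℕ :=
  (8 + NProg.baseCost initProg + NProg.baseCost startProg) + loopCost listsCond listsProg +
  loopCost parseCond parseProg + loopCost searchCond searchProg + NProg.baseCost kernelProg +
  loopCost (.reg .count) evalProg + NProg.baseCost truthProg + 7

/-- Each part of the time is a number of rounds at most `A` times a constant `c` plus a call cost at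
most `D`. As `D` is positive, this is at most `(c + 1) * (A * D)`. The positivity of `l` makes `A`
large enough when `n = 0`. -/
theorem timeBound_le (s k n l : ℕ) (hl : 0 < l) :
    timeBound s (2 ^ k) n (3 * n + 2 * (n * k)) l ≤
      constantBound * (parameterBound (s, k) * (n + l)) := by
  set D := callBound s (2 ^ k) with hD
  set A := (2 * k + 4) * (n + l) with hA
  have key : ∀ {a c d : ℕ}, a ≤ A → d ≤ D → a * (c + d) ≤ (c + 1) * (A * D) := by
    intro a c d ha hd
    have hD1 : 1 ≤ D := by rw [hD, callBound]; omega
    calc a * (c + d) ≤ A * ((c + 1) * D) := Nat.mul_le_mul ha (by nlinarith)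
      _ = (c + 1) * (A * D) := by ring
  have hA' : A = 2 * (n * k) + 2 * (l * k) + 4 * n + 4 * l := by rw [hA]; ring
  have t0 := key (a := 1) (c := 8 + NProg.baseCost initProg + NProg.baseCost startProg) (d := 0)
    (by omega) (by omega)
  have t1 := key (a := n + 1) (c := loopCost listsCond listsProg) (d := 0) (by omega) (by omega)
  have t2 := key (a := l + 1) (c := loopCost parseCond parseProg) (d := 0) (by omega) (by omega)
  have t3 := key (a := 3 * n + 2 * (n * k) + 1) (c := loopCost searchCond searchProg)
    (d := tickBound s (2 ^ k)) (by omega) (by rw [hD, callBound]; omega)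
  have t4 := key (a := 1) (c := NProg.baseCost kernelProg) (d := kernelCost s (2 ^ k))
    (by omega) (by rw [hD, callBound]; omega)
  have t5 := key (a := l + 1) (c := loopCost (.reg .count) evalProg)
    (d := evalBound (kernelBound s (2 ^ k)) s) (by omega) (by rw [hD, callBound]; omega)
  have t6 := key (a := 1) (c := NProg.baseCost truthProg)
    (d := truthBound (kernelBound s (2 ^ k))) (by omega) (by rw [hD, callBound]; omega)
  have e : parameterBound (s, k) * (n + l) = A * D := by
    rw [parameterBound, hA]; ring
  rw [e, timeBound, constantBound]
  -- The seven bounds contribute the `7` in `constantBound`, one for each `c + 1`; its `8` collects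
  -- the three assignments outside of the compiled parts.
  linarith

end RAM

theorem FOFormula.length_pos (φ : FOFormula) : 0 < φ.length := by
  rw [FOFormula.length, FOFormula.encode_eq]
  simp

theorem mainTheorem2 :
    ∃ (f : ℕ × ℕ → ℕ) (A : RAM.Prog) (C : ℕ), Computable f ∧
      ∀ (φ : FOFormula), φ.IsSentence →
        ∀ (n : ℕ) (G : SimpleGraph (Fin n)) (N : Fin n → List (Fin n)), IsAdjacencyLists G N →
          ∃ t : ℕ, RAM.DecidesIn A (modelCheckingInput N φ) t (φ.Models G) ∧
            t ≤ C * (f (φ.numVars, G.treeDepth) * (n + φ.length)) := by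
  classical
  refine ⟨RAM.parameterBound, RAM.modelChecker, RAM.constantBound,
    RAM.primrec_parameterBound.to_comp, fun φ _ n G N hN => ?_⟩
  obtain ⟨t, τ, h, ht, hτ⟩ := RAM.modelChecker_runs hN φ
  refine ⟨t, ⟨τ, h, ?_⟩, ht.trans (RAM.timeBound_le _ _ _ _ φ.length_pos)⟩
  by_cases hM : φ.Models G
  · exact .inl ⟨hM, by rw [hτ, if_pos hM]⟩
  · exact .inr ⟨hM, by rw [hτ, if_neg hM]⟩
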